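/- **Setting.** Let $d\in\{2,3\}$ and let $\mathcal O\subset\mathbb R^d$ be a bounded open convex polyhedral domain. Let $\mathcal K_h$ be a finite conforming partition of $\overline{\mathcal O}$ into convex polytopes (e.g. simplices) with non-empty, pairwise disjoint interiors, such that each $(d-1)$-dimensional face of a cell lies on $\partial\mathcal O$ or is also a face of another cell, and let it be shape-regular: $h_K/\rho_K\le\rho$ for all $K$, with $h_K=\operatorname{diam}K$ and $\rho_K$ the radius of the largest ball inscribed in $K$. Let $\mathcal F_h=\mathcal F_h^i\cup\mathcal F_h^b$ be the set of interior and boundary faces, and $h_F=|F|^{1/(d-1)}$. On $F\in\mathcal F_h^i$ a unit normal $\mathbf n_F$ pointing from one adjacent cell $K_F^1$ to the other one $K_F^2$ is fixed, and $[w]=w|_{K_F^1}-w|_{K_F^2}$, $\{w\}=\frac12(w|_{K_F^1}+w|_{K_F^2})$; on $F\in\mathcal F_h^b$, $\mathbf n_F$ is the outward normal and $[w]=\{w\}=w$. On $\partial K$, $\mathbf n_K$ is the outward normal, and $w^{\rm int}$, $w^{\rm ext}$ are the traces from inside and outside $K$, with $w^{\rm ext}=0$ on $\partial\mathcal O$.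 Let $r_1\ge1$, $r_2\ge0$ be integers with $r_1-1\le r_2\le r_1+1$. Let $\mathbf M_h$ be the space of vector fields that are in $(\mathbb P_{r_1}(K))^d$ on each $K\in\mathcal K_h$, $P_h$ the space of functions that are in $\mathbb P_{r_2}(K)$ on each $K$, and $P_h^0=\{g\in P_h:\int_{\mathcal O}g=0\}$. Let $(\cdot,\cdot)$ be the $L^2(\mathcal O)$ inner product, $\epsilon\in\{-1,0,1\}$, $\sigma,\tilde\sigma>0$, and $$\begin{aligned} \mathcal A_c(\boldsymbol\theta;\mathbf z,\boldsymbol\varphi,\mathbf w)&=\sum_K\int_K\Big((\mathbf z\cdot\nabla\boldsymbol\varphi)\cdot\mathbf w+\tfrac12(\nabla\cdot\mathbf z)\,\boldsymbol\varphi\cdot\mathbf w\Big)-\tfrac12\sum_{F\in\mathcal F_h}\int_F[\mathbf z]\cdot\mathbf n_F\{\boldsymbol\varphi\cdot\mathbf w\}\\ &\quad+\sum_K\int_{\partial K_-^{\boldsymbol\theta}}|\{\mathbf z\}\cdot\mathbf n_K|(\boldsymbol\varphi^{\rm int}-\boldsymbol\varphi^{\rm ext})\cdot\mathbf w^{\rm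 int},\qquad \partial K_-^{\boldsymbol\theta}=\{x\in\partial K:\{\boldsymbol\theta\}\cdot\mathbf n_K<0\},\\ \mathcal A_\epsilon(\mathbf u,\mathbf w)&=\sum_K\int_K\nabla\mathbf u:\nabla\mathbf w-\sum_{F\in\mathcal F_h}\int_F\{\nabla\mathbf u\}\mathbf n_F\cdot[\mathbf w]+\epsilon\sum_{F\in\mathcal F_h}\int_F\{\nabla\mathbf w\}\mathbf n_F\cdot[\mathbf u]+\sum_{F\in\mathcal F_h}\frac{\sigma}{h_F}\int_F[\mathbf u]\cdot[\mathbf w],\\ b(\mathbf w,g)&=\sum_K\int_K(\nabla\cdot\mathbf w)g-\sum_{F\in\mathcal F_h}\int_F\{g\}\,\mathbf n_F\cdot[\mathbf w],\\ \mathcal A_{\rm sip}(v,g)&=\sum_K\int_K\nabla v\cdot\nabla g-\sum_{F\in\mathcal F_h^i}\int_F\big(\{\nabla v\}\cdot\mathbf n_F[g]+\{\nabla g\}\cdot\mathbf n_F[v]\big)+\sum_{F\in\mathcal F_h^i}\frac{\tilde\sigma}{h_F}\int_F[v][g], \end{aligned}$$ with $\mathcal A_d=\mathcal A_{-1}$ the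 symmetric form. Put $\|\mathbf w\|_{\rm dG}^2=\sum_K\|\nabla\mathbf w\|_{L^2(K)}^2+\sum_{F\in\mathcal F_h}\frac{\sigma}{h_F}\|[\mathbf w]\|_{L^2(F)}^2$ and $|g|_{\rm dG}^2=\sum_K\|\nabla g\|_{L^2(K)}^2+\sum_{F\in\mathcal F_h^i}\frac{\tilde\sigma}{h_F}\|[g]\|_{L^2(F)}^2$. Let $\mu,\gamma,\eta,\delta>0$, $\beta(t)=\gamma e^{-\eta t}$, let $\tau>0$ be the time step, $t_j=j\tau$, and $q_r^n(\boldsymbol\varphi)=\tau\sum_{j=1}^n\beta(t_n-t_j)\boldsymbol\varphi^j$. For $n\ge1$, given $\mathbf f^n\in L^2(\mathcal O)^d$, $\mathbf u_h^{n-1}\in\mathbf M_h$, $p_h^{n-1}\in P_h^0$ and the earlier intermediate velocities $\widetilde{\mathbf u}_h^1,\dots,\widetilde{\mathbf u}_h^{n-1}\in\mathbf M_h$, step $n$ of the scheme asks for $\widetilde{\mathbf u}_h^n,\mathbf u_h^n\in\mathbf M_h$ and $p_h^n\in P_h^0$ such that, with some $v_h^n\in P_h^0$, $$\begin{aligned}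 &(\widetilde{\mathbf u}_h^n,\mathbf w)+\tau\mathcal A_c(\mathbf u_h^{n-1};\mathbf u_h^{n-1},\widetilde{\mathbf u}_h^n,\mathbf w)+\tau\mu\mathcal A_\epsilon(\widetilde{\mathbf u}_h^n,\mathbf w)+\tau\mathcal A_\epsilon(q_r^n(\widetilde{\mathbf u}_h),\mathbf w)=(\mathbf u_h^{n-1},\mathbf w)+\tau b(\mathbf w,p_h^{n-1})+\tau(\mathbf f^n,\mathbf w)&&\forall\,\mathbf w\in\mathbf M_h,\\ &\mathcal A_{\rm sip}(v_h^n,g)=-\tfrac1\tau b(\widetilde{\mathbf u}_h^n,g)&&\forall\,g\in P_h^0,\\ &(p_h^n,g)=(p_h^{n-1},g)+(v_h^n,g)-\delta\mu\,b(\widetilde{\mathbf u}_h^n,g)-\delta\,b(q_r^n(\widetilde{\mathbf u}_h),g)&&\forall\,g\in P_h,\\ &(\mathbf u_h^n,\mathbf w)=(\widetilde{\mathbf u}_h^n,\mathbf w)+\tau b(\mathbf w,v_h^n)&&\forall\,\mathbf w\in\mathbf M_h. \end{aligned}$$ The penalty parameters are assumed to be such that $$\mathcal A_\epsilon(\mathbf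 w,\mathbf w)\ge\omega\|\mathbf w\|_{\rm dG}^2\ \ \forall\,\mathbf w\in\mathbf M_h,\qquad \mathcal A_{\rm sip}(g,g)\ge\tfrac12|g|_{\rm dG}^2\ \ \forall\,g\in P_h,\tag{$*$}$$ with $\omega=1$ if $\epsilon=1$ and $\omega=\frac12$ if $\epsilon\in\{-1,0\}$. **Lemma 2 (existence and uniqueness of the discrete solution).** 1. Condition $(*)$ holds for sufficiently large penalty parameters: there is $\sigma_0>0$, depending only on $d,r_1,r_2,\rho$, such that the first inequality holds if $\epsilon=1$ (for every $\sigma>0$) and if $\epsilon\in\{-1,0\}$ and $\sigma\ge\sigma_0$, and the second one holds if $\tilde\sigma\ge\sigma_0$. 2. For the symmetric form $\mathcal A_d$ ($\epsilon=-1$), under $(*)$, for every $\tau>0$, every $n\ge1$ and all data as above, there is a unique solution $(\widetilde{\mathbf u}_h^n,\mathbf u_h^n,p_h^n)\in\mathbf M_h\times\mathbf M_h\times P_h^0$ of step $n$. 3. For a nonsymmetric form $\mathcal A_\epsilon$ ($\epsilon\in\{0,1\}$) there is $\tau_0>0$, depending only on $d,r_1,r_2,\rho,\epsilon,\mu,\gamma,\eta,\delta,\sigma,\tilde\sigma$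 (not on the domain, the mesh, $n$ or the data), such that under $(*)$, for every $0<\tau<\tau_0$, every $n\ge1$ and all data as above, there is a unique solution $(\widetilde{\mathbf u}_h^n,\mathbf u_h^n,p_h^n)\in\mathbf M_h\times\mathbf M_h\times P_h^0$ of step $n$. -/

import Mathlib

noncomputable section

namespace DGOldroyd

open MeasureTheory
open scoped RealInnerProductSpace

/-- Euclidean space `ℝ^d`. -/
abbrev E (d : ℕ) := EuclideanSpace ℝ (Fin d)

/-! ### Domain and mesh -/

/-- A bounded convex polytope: a bounded intersection of finitely many closed half-spaces. -/
def IsConvexPolytope {d : ℕ} (K : Set (E d)) : Prop :=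
  Bornology.IsBounded K ∧
    ∃ S : Finset (E d × ℝ), K = {x | ∀ s ∈ S, ⟪s.1, x⟫ ≤ s.2}

/-- An open, bounded, convex, polyhedral domain. -/
structure IsConvexPolyhedralDomain {d : ℕ} (O : Set (E d)) : Prop where
  isOpen : IsOpen O
  nonempty : O.Nonempty
  convex : Convex ℝ O
  polytope : IsConvexPolytope (closure O)

/-- `S` is a facet (a face of dimension `d - 1`) of `K`, and `n` is the unit normal to `S` that
points out of `K`. -/
def IsFacet {d : ℕ} (K S : Set (E d)) (n : E d) : Prop :=
  ‖n‖ = 1 ∧ Module.finrank ℝ (vectorSpan ℝ S) + 1 = d ∧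
    ∃ b : ℝ, (∀ x ∈ K, ⟪n, x⟫ ≤ b) ∧ S = {x ∈ K | ⟪n, x⟫ = b}

/-- A finite conforming partition of `O` into convex polytopes (simplices, for instance), with its
set of faces and a choice of a unit normal on every face. The face `F` lies on the cell `fst F`,
and the normal of `F` points out of `fst F`. If `snd F = some K`, then `F` is an interior face, and
its normal points from `fst F` to `K`; if `snd F = none`, then `F` is a boundary face. -/
structure Mesh {d : ℕ} (O : Set (E d)) where
  /-- index set of the cells -/
  Cell : Type
  /-- index set of the faces -/
  Face : Type
  [fintypeCell : Fintype Cell]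
  [fintypeFace : Fintype Face]
  /-- the closed set that a cell occupies -/
  cell : Cell → Set (E d)
  /-- the closed set that a face occupies -/
  face : Face → Set (E d)
  /-- the chosen unit normal of a face -/
  normal : Face → E d
  /-- the cell from which the normal points outwards -/
  fst : Face → Cell
  /-- the cell on the other side, if there is one -/
  snd : Face → Option Cell
  cell_polytope : ∀ K, IsConvexPolytope (cell K)
  cell_interior : ∀ K, (interior (cell K)).Nonempty
  cover : ⋃ K, cell K = closure O
  disjoint : ∀ K L, K ≠ L → Disjoint (interior (cell K)) (interior (cell L))
  face_injective : Function.Injective face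
  fst_facet : ∀ F, IsFacet (cell (fst F)) (face F) (normal F)
  snd_facet : ∀ F K, snd F = some K → IsFacet (cell K) (face F) (-normal F)
  boundary : ∀ F, snd F = none → face F ⊆ frontier O
  /-- every facet of every cell is a face of the mesh -/
  facet_mem : ∀ K S n, IsFacet (cell K) S n → ∃ F, face F = S ∧ (fst F = K ∨ snd F = some K)

attribute [instance] Mesh.fintypeCell Mesh.fintypeFace

/-- The radius of the largest ball inscribed in `K`. -/
def inradius {d : ℕ} (K : Set (E d)) : ℝ :=
  sSup {r : ℝ | 0 ≤ r ∧ ∃ x, Metric.closedBall x r ⊆ K}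

namespace Mesh

variable {d : ℕ} {O : Set (E d)} (m : Mesh O)

/-- Shape regularity with parameter `ρ`. -/
def ShapeRegular (ρ : ℝ) : Prop :=
  ∀ K, Metric.diam (m.cell K) / inradius (m.cell K) ≤ ρ

/-! ### Broken functions, jumps and averages

A broken function is given by one function for each cell, of which only the values on that closed
cell matter; its value on the boundary of the cell is the trace from the inside of the cell. -/

/-- broken scalar functions -/
abbrev Scal := m.Cell → E d → ℝ

/-- broken vector fields -/
abbrev Vec := m.Cell → E d → E d

section traces

variable {V : Type*} [AddCommGroup V] [Module ℝ V]

/-- The trace on `F` from the side opposite to `fst F`; zero on a boundary face. -/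
def outer (w : m.Cell → E d → V) (F : m.Face) (x : E d) : V :=
  (m.snd F).elim 0 fun K => w K x

/-- The jump `[w]` on `F`; on a boundary face it is the trace. -/
def jump (w : m.Cell → E d → V) (F : m.Face) (x : E d) : V :=
  w (m.fst F) x - m.outer w F x

/-- The average `{w}` on `F`; on a boundary face it is the trace. -/
def avg (w : m.Cell → E d → V) (F : m.Face) (x : E d) : V :=
  (m.snd F).elim (w (m.fst F) x) fun K => (1 / 2 : ℝ) • (w (m.fst F) x + w K x)

end traces

/-- The integral over a subset `S` of `ℝ^d` with respect to the surface measure of dimension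
`d - 1`. -/
def _root_.DGOldroyd.surfInt {d : ℕ} (S : Set (E d)) (g : E d → ℝ) : ℝ :=
  ∫ x in S, g x ∂(Measure.euclideanHausdorffMeasure (d - 1))

/-- `h_F = |F|^{1/(d-1)}` -/
def hF (F : m.Face) : ℝ :=
  ((Measure.euclideanHausdorffMeasure (d - 1) : Measure (E d)).real (m.face F)) ^
    (1 / ((d : ℝ) - 1))

/-- The set of interior faces. -/
def intFaces : Finset m.Face := Finset.univ.filter fun F => (m.snd F).isSome

/-! ### Differential operators on one cell -/

/-- `∇u : ∇w` -/
def _root_.DGOldroyd.gradDot {d : ℕ} (u w : E d → E d) (x : E d) : ℝ :=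
  ∑ j, ⟪fderiv ℝ u x (EuclideanSpace.single j 1), fderiv ℝ w x (EuclideanSpace.single j 1)⟫

/-- `∇ · w` -/
def _root_.DGOldroyd.div {d : ℕ} (w : E d → E d) (x : E d) : ℝ :=
  ∑ j, (fderiv ℝ w x (EuclideanSpace.single j 1)) j

/-- The broken Jacobian matrix `∇_h w`, as a family of linear maps. -/
def jac (w : m.Vec) : m.Cell → E d → (E d →L[ℝ] E d) := fun K => fderiv ℝ (w K)

/-- The broken gradient `∇_h g`. -/
def grad (g : m.Scal) : m.Vec := fun K x => gradient (g K) x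

/-! ### Scalar products and discrete forms -/

/-- `(u, w)` for broken vector fields -/
def innerVec (u w : m.Vec) : ℝ := ∑ K, ∫ x in m.cell K, ⟪u K x, w K x⟫

/-- `(p, g)` for broken scalar functions -/
def innerScal (p g : m.Scal) : ℝ := ∑ K, ∫ x in m.cell K, p K x * g K x

/-- The inflow boundary part of `F`, seen from `fst F` (`s = 1`) or from the other side
(`s = -1`): the points of `F` with `{θ} · (s n_F) < 0`. -/
def inflow (θ : m.Vec) (F : m.Face) (s : ℝ) : Set (E d) :=
  {x ∈ m.face F | ⟪m.avg θ F x, s • m.normal F⟫ < 0}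

/-- The convection form `A_c(θ; z, φ, w)`. The last two sums are the sum over all cells `K` of
`∫_{∂K_-^θ} |{z} · n_K| (φ^int - φ^ext) · w^int`: a face occurs once for each cell that it
bounds, first with `K = fst F`, then, for an interior face, with the cell on the other side. -/
def Ac (θ z φ w : m.Vec) : ℝ :=
  (∑ K, ((∫ x in m.cell K, ⟪fderiv ℝ (φ K) x (z K x), w K x⟫)
      + (1 / 2) * ∫ x in m.cell K, div (z K) x * ⟪φ K x, w K x⟫))
  - (1 / 2) * ∑ F, surfInt (m.face F) (fun x =>
      ⟪m.jump z F x, m.normal F⟫ * m.avg (fun K y => ⟪φ K y, w K y⟫) F x)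
  + ∑ F, surfInt (m.inflow θ F 1) (fun x =>
      |⟪m.avg z F x, m.normal F⟫| * ⟪φ (m.fst F) x - m.outer φ F x, w (m.fst F) x⟫)
  + ∑ F ∈ m.intFaces, surfInt (m.inflow θ F (-1)) (fun x =>
      |⟪m.avg z F x, m.normal F⟫| * ⟪m.outer φ F x - φ (m.fst F) x, m.outer w F x⟫)

/-- The interior penalty form `A_ε(u, w)` with penalty parameter `σ`. -/
def Aeps (ε σ : ℝ) (u w : m.Vec) : ℝ :=
  (∑ K, ∫ x in m.cell K, gradDot (u K) (w K) x)
  - (∑ F, surfInt (m.face F) fun x => ⟪m.avg (m.jac u) F x (m.normal F), m.jump w F x⟫)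
  + ε * (∑ F, surfInt (m.face F) fun x => ⟪m.avg (m.jac w) F x (m.normal F), m.jump u F x⟫)
  + ∑ F, σ / m.hF F * surfInt (m.face F) fun x => ⟪m.jump u F x, m.jump w F x⟫

/-- The form `b(w, g)`. -/
def b (w : m.Vec) (g : m.Scal) : ℝ :=
  (∑ K, ∫ x in m.cell K, div (w K) x * g K x)
  - ∑ F, surfInt (m.face F) fun x => m.avg g F x * ⟪m.normal F, m.jump w F x⟫

/-- The form `A_sip(v, g)` with penalty parameter `σ'`. -/
def Asip (σ' : ℝ) (v g : m.Scal) : ℝ :=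
  (∑ K, ∫ x in m.cell K, ⟪m.grad v K x, m.grad g K x⟫)
  - (∑ F ∈ m.intFaces, surfInt (m.face F) fun x =>
      ⟪m.avg (m.grad v) F x, m.normal F⟫ * m.jump g F x)
  - (∑ F ∈ m.intFaces, surfInt (m.face F) fun x =>
      ⟪m.avg (m.grad g) F x, m.normal F⟫ * m.jump v F x)
  + ∑ F ∈ m.intFaces, σ' / m.hF F * surfInt (m.face F) fun x => m.jump v F x * m.jump g F x

/-- `‖w‖²_dG` -/
def normSqVec (σ : ℝ) (w : m.Vec) : ℝ :=
  (∑ K, ∫ x in m.cell K, gradDot (w K) (w K) x)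
  + ∑ F, σ / m.hF F * surfInt (m.face F) fun x => ‖m.jump w F x‖ ^ 2

/-- `|g|²_dG` -/
def normSqScal (σ' : ℝ) (g : m.Scal) : ℝ :=
  (∑ K, ∫ x in m.cell K, ‖m.grad g K x‖ ^ 2)
  + ∑ F ∈ m.intFaces, σ' / m.hF F * surfInt (m.face F) fun x => (m.jump g F x) ^ 2

/-! ### Discrete spaces -/

/-- The real polynomial functions on `ℝ^d` of total degree at most `r`. -/
def _root_.DGOldroyd.polyFun (d r : ℕ) : Submodule ℝ (E d → ℝ) where
  carrier := {g | ∃ q : MvPolynomial (Fin d) ℝ, q.totalDegree ≤ r ∧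
    ∀ x, g x = MvPolynomial.eval (fun i => x i) q}
  zero_mem' := ⟨0, by simp, by simp⟩
  add_mem' := by
    rintro g g' ⟨q, hq, h⟩ ⟨q', hq', h'⟩
    exact ⟨q + q', (MvPolynomial.totalDegree_add q q').trans (max_le hq hq'),
      fun x => by simp [h x, h' x]⟩
  smul_mem' := by
    rintro c g ⟨q, hq, h⟩
    exact ⟨c • q, (MvPolynomial.totalDegree_smul_le c q).trans hq,
      fun x => by simp [h x, MvPolynomial.smul_eval]⟩

/-- The velocity space `M_h`: vector fields whose restriction to each cell is a polynomial of
degree at most `r`. The polynomial on a cell is determined by its restriction to the cell, which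
has interior points, and is used to represent that restriction. -/
def Mh (r : ℕ) : Submodule ℝ m.Vec where
  carrier := {w | ∀ K i, (fun x => w K x i) ∈ polyFun d r}
  zero_mem' := fun _ _ => (polyFun d r).zero_mem
  add_mem' := fun h h' K i => (polyFun d r).add_mem (h K i) (h' K i)
  smul_mem' := fun c _ h K i => (polyFun d r).smul_mem c (h K i)

/-- The space `P_h` of scalar functions whose restriction to each cell is a polynomial of degree
at most `r`, represented as in `Mh`. -/
def Ph (r : ℕ) : Submodule ℝ m.Scal where
  carrier := {g | ∀ K, g K ∈ polyFun d r}
  zero_mem' := fun _ => (polyFun d r).zero_mem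
  add_mem' := fun h h' K => (polyFun d r).add_mem (h K) (h' K)
  smul_mem' := fun c _ h K => (polyFun d r).smul_mem c (h K)

/-- The subset `P_h⁰` of the functions in `P_h` whose integral is zero. -/
def Ph0 (r : ℕ) : Set m.Scal := {g | g ∈ m.Ph r ∧ ∑ K, ∫ x in m.cell K, g K x = 0}

/-! ### Coercivity requirements on the penalty parameters -/

/-- The coercivity constant of `A_ε`. -/
def _root_.DGOldroyd.omega (ε : ℝ) : ℝ := if ε = 1 then 1 else 1 / 2

/-- `A_ε(w, w) ≥ ω ‖w‖²_dG` on `M_h`. -/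
def CoerciveVel (r : ℕ) (ε σ : ℝ) : Prop :=
  ∀ w ∈ m.Mh r, omega ε * m.normSqVec σ w ≤ m.Aeps ε σ w w

/-- `A_sip(g, g) ≥ ½ |g|²_dG` on `P_h`. -/
def CoerciveSip (r : ℕ) (σ' : ℝ) : Prop :=
  ∀ g ∈ m.Ph r, 1 / 2 * m.normSqScal σ' g ≤ m.Asip σ' g g

end Mesh

/-! ### The scheme -/

/-- The parameters of the model and of the scheme: viscosity `μ`, memory kernel
`β(t) = γ exp(-η t)`, pressure parameter `δ`, penalty parameters `σ` (of `A_ε`) and `σ'`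
(of `A_sip`). -/
structure Params where
  μ : ℝ
  γ : ℝ
  η : ℝ
  δ : ℝ
  σ : ℝ
  σ' : ℝ
  μ_pos : 0 < μ
  γ_pos : 0 < γ
  η_pos : 0 < η
  δ_pos : 0 < δ
  σ_pos : 0 < σ
  σ'_pos : 0 < σ'

/-- The memory kernel. -/
def Params.β (q : Params) (t : ℝ) : ℝ := q.γ * Real.exp (-q.η * t)

variable {d : ℕ} {O : Set (E d)}

/-- The right rectangle rule `τ ∑_{j=1}^n β(t_n - t_j) φ^j`, where `t_j = j τ`. -/
def Params.quad (q : Params) (τ : ℝ) (n : ℕ) (m : Mesh O) (φ : ℕ → m.Vec) : m.Vec :=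
  τ • ∑ j ∈ Finset.Icc 1 n, q.β (n * τ - j * τ) • φ j

/-- The equations of step `n` of the pressure correction scheme with time step `τ`, right-hand
side `f = f(t_n)` and earlier intermediate velocities `hist j`, `1 ≤ j ≤ n - 1`; the sequence
`Function.update hist n ut` continues these by the new intermediate velocity `ut`. The other data
from step `n - 1` are `u0` and `p0`; the unknowns are `ut`, the potential `v`, `p` and `u`. -/
structure IsStepSolution (m : Mesh O) (r₁ r₂ : ℕ) (q : Params) (ε τ : ℝ) (n : ℕ)
    (f : E d → E d) (hist : ℕ → m.Mh r₁) (u0 : m.Mh r₁) (p0 : m.Ph0 r₂)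
    (ut u : m.Mh r₁) (p v : m.Ph0 r₂) : Prop where
  velocity : ∀ w ∈ m.Mh r₁,
    m.innerVec ut w + τ * m.Ac u0 u0 ut w + τ * q.μ * m.Aeps ε q.σ ut w
      + τ * m.Aeps ε q.σ (q.quad τ n m fun j => Function.update hist n ut j) w
    = m.innerVec u0 w + τ * m.b w p0 + τ * m.innerVec (fun _ => f) w
  potential : ∀ g ∈ m.Ph0 r₂, m.Asip q.σ' v g = -(1 / τ) * m.b ut g
  pressure : ∀ g ∈ m.Ph r₂,
    m.innerScal p g = m.innerScal p0 g + m.innerScal v g - q.δ * q.μ * m.b ut g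
      - q.δ * m.b (q.quad τ n m fun j => Function.update hist n ut j) g
  correction : ∀ w ∈ m.Mh r₁, m.innerVec u w = m.innerVec ut w + τ * m.b w v

/-- Unique solvability of step `n` in `M_h × M_h × P_h⁰`, for every right-hand side in
`L²(O)^d` and all data from the earlier steps. -/
def UniquelySolvable (m : Mesh O) (r₁ r₂ : ℕ) (q : Params) (ε τ : ℝ) (n : ℕ) : Prop :=
  ∀ f : E d → E d, MemLp f 2 (volume.restrict O) →
    ∀ (hist : ℕ → m.Mh r₁) (u0 : m.Mh r₁) (p0 : m.Ph0 r₂),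
      ∃! s : m.Mh r₁ × m.Mh r₁ × m.Ph0 r₂,
        ∃ v : m.Ph0 r₂, IsStepSolution m r₁ r₂ q ε τ n f hist u0 p0 s.1 s.2.1 s.2.2 v

end DGOldroyd

end

noncomputable section

namespace DGOldroyd

open MeasureTheory Module Set
open scoped RealInnerProductSpace

/-! ### Surface measure on hyperplanes -/

/-! A step decouples into four square linear systems on finite-dimensional spaces, solved in the
order intermediate velocity, potential, pressure, velocity. A bilinear form that vanishes on no
nonzero diagonal element is nonsingular (`existsUnique_riesz`), so definiteness on the diagonal is
all that each system needs.

For the intermediate velocity, the newest node of the quadrature contributes `τ γ` times the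
unknown, so the form is `(u, w) + τ A_c + τ (μ + τ γ) A_ε`. The mass term is definite, `A_c(z; z, φ,
φ) ≥ 0` by upwinding (`Ac_self_nonneg`), and `A_ε ≥ 0` on the diagonal by coercivity. This argument
needs neither symmetry of `A_ε` nor a small `τ`. For the potential, `A_sip` dominates half the
square of a seminorm that is a norm on functions of mean zero (`eq_zero_of_normSqScal`). The
pressure and the velocity are Riesz representatives for the `L²` product; the pressure is found in
`P_h` and has mean zero because `b(w, 1) = 0` (`b_const_one`).

Coercivity is the usual interior penalty argument: Young's inequality and a discrete trace
inequality absorb the consistency terms (`sum_surfInt_le`, `exists_trace_constant`).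

The geometry rests on one construction. Up to a null set, a polytope is the disjoint union of the
cones over its facets with a common interior apex (`ae_eq_iUnion_cone`, `aedisjoint_cone`), and
volume integrals become integrals along rays. On a ray a polynomial has one variable, which yields
the trace inequality. Differentiating `t^d g` along rays expresses `∫ (d g + ∇g · (x - x₀))` by
facet integrals; comparing two apexes `x₀` gives the divergence theorem (`setIntegral_fderiv`).

The divergence theorem then supplies `b(w, 1) = 0`, the sign of `A_c`, and the fact that a piecewise
constant function without interior jumps is constant (`eq_of_forall_jump_eq_zero`). The last is
shown by sliding a bump function from one cell to another inside the convex domain, which avoids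
chains of adjacent cells. -/

/-- A parametrization of the hyperplane `⟪n, x⟫ = b` by `ℝ^(d-1)`. -/
lemma exists_isometry_hyperplane {d : ℕ} (hd : 1 ≤ d) {n : E d} (hn : ‖n‖ = 1) (b : ℝ) :
    ∃ ι : E (d - 1) →ₗᵢ[ℝ] E d, range (fun y => ι y + b • n) = {x | ⟪n, x⟫ = b} := by
  have hn0 : n ≠ 0 := by rintro rfl; simp at hn
  have : Fact (finrank ℝ (E d) = (d - 1) + 1) := ⟨by simp; omega⟩
  let u := OrthonormalBasis.fromOrthogonalSpanSingleton (𝕜 := ℝ) (d - 1) hn0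
  refine ⟨(Submodule.subtypeₗᵢ _).comp u.repr.symm.toLinearIsometry, ?_⟩
  ext x
  constructor
  · rintro ⟨y, rfl⟩
    have : ⟪n, (u.repr.symm y : E d)⟫ = 0 :=
      Submodule.mem_orthogonal_singleton_iff_inner_right.1 (u.repr.symm y).2
    simp [inner_add_right, inner_smul_right, this, hn]
  · intro hx
    have hx' : x - b • n ∈ (ℝ ∙ n)ᗮ := by
      rw [Submodule.mem_orthogonal_singleton_iff_inner_right]
      have : ⟪n, x⟫ = b := hx
      simp [inner_sub_right, inner_smul_right, this, hn]
    exact ⟨u.repr ⟨_, hx'⟩, by simp⟩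

/-- Isometries preserve the Hausdorff measure, and on `ℝ^(d-1)` the normalized Hausdorff measure of
dimension `d - 1` is Lebesgue measure. Facet measures can thus be estimated in coordinates. -/
lemma surface_eq_volume {d : ℕ} {n : E d} {b : ℝ} (ι : E (d - 1) →ₗᵢ[ℝ] E d)
    (hι : range (fun y => ι y + b • n) = {x | ⟪n, x⟫ = b}) {S : Set (E d)}
    (hS : S ⊆ {x | ⟪n, x⟫ = b}) :
    Measure.euclideanHausdorffMeasure (d - 1) S = volume ((fun y => ι y + b • n) ⁻¹' S) := by
  have hi : Isometry (fun y => ι y + b • n) :=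
    (IsometryEquiv.addRight (b • n)).isometry.comp ι.isometry
  rw [← EuclideanSpace.euclideanHausdorffMeasure_eq_volume, hi.euclideanHausdorffMeasure_preimage,
    hι, inter_eq_left.2 hS]

/-- The surface measure of a bounded subset of a hyperplane. -/
lemma surface_le {d : ℕ} (hd : 1 ≤ d) {n : E d} (hn : ‖n‖ = 1) {b : ℝ} {S : Set (E d)}
    (hS : S ⊆ {x | ⟪n, x⟫ = b}) (hb : Bornology.IsBounded S) :
    Measure.euclideanHausdorffMeasure (d - 1) S ≤
      ENNReal.ofReal (Metric.diam S ^ (d - 1)) * volume (Metric.closedBall (0 : E (d - 1)) 1) := by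
  obtain ⟨ι, hι⟩ := exists_isometry_hyperplane hd hn b
  rcases S.eq_empty_or_nonempty with rfl | ⟨x, hx⟩
  · simp
  obtain ⟨y, rfl⟩ : x ∈ range (fun y => ι y + b • n) := hι ▸ hS hx
  rw [surface_eq_volume ι hι hS]
  have hsub : (fun y => ι y + b • n) ⁻¹' S ⊆ Metric.closedBall y (Metric.diam S) := by
    intro z hz
    have := Metric.dist_le_diam_of_mem hb hz hx
    simpa [dist_add_right] using this
  refine (measure_mono hsub).trans ?_
  rw [Measure.addHaar_closedBall' _ _ Metric.diam_nonneg]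
  simp

lemma surface_lt_top {d : ℕ} (hd : 1 ≤ d) {n : E d} (hn : ‖n‖ = 1) {b : ℝ} {S : Set (E d)}
    (hS : S ⊆ {x | ⟪n, x⟫ = b}) (hb : Bornology.IsBounded S) :
    Measure.euclideanHausdorffMeasure (d - 1) S < ⊤ :=
  (surface_le hd hn hS hb).trans_lt (ENNReal.mul_lt_top ENNReal.ofReal_lt_top
    (isCompact_closedBall _ _).measure_lt_top)

/-- In the coordinates of the hyperplane `S` becomes a convex set of full dimension, and such a set
has interior points. -/
lemma surface_pos {d : ℕ} (hd : 2 ≤ d) {n : E d} (hn : ‖n‖ = 1) {b : ℝ} {S : Set (E d)}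
    (hS : S ⊆ {x | ⟪n, x⟫ = b}) (hc : Convex ℝ S)
    (hdim : finrank ℝ (vectorSpan ℝ S) + 1 = d) :
    0 < Measure.euclideanHausdorffMeasure (d - 1) S := by
  obtain ⟨ι, hι⟩ := exists_isometry_hyperplane (by omega) hn b
  rw [surface_eq_volume ι hι hS]
  set j : E (d - 1) →ᵃ[ℝ] E d := ι.toLinearMap.toAffineMap + AffineMap.const ℝ _ (b • n) with hj
  have hjf : (fun y => ι y + b • n) = j := by ext; simp [hj]
  rw [hjf] at hι ⊢
  have himg : j '' (j ⁻¹' S) = S := by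
    rw [image_preimage_eq_inter_range, hι, inter_eq_left.2 hS]
  have hspan : vectorSpan ℝ S = (vectorSpan ℝ (j ⁻¹' S)).map ι.toLinearMap := by
    have := AffineMap.map_vectorSpan (s := j ⁻¹' S) j
    rw [himg] at this
    rw [← this]
    simp [hj]
  have hfr : finrank ℝ (vectorSpan ℝ (j ⁻¹' S)) = d - 1 := by
    rw [hspan, LinearEquiv.finrank_eq (Submodule.equivMapOfInjective _ ι.injective _).symm] at hdim
    omega
  have hconv : Convex ℝ (j ⁻¹' S) := hc.affine_preimage j
  -- This is where `d ≥ 2` enters: for `d = 1` the empty set would satisfy the dimension condition.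
  have hne : (j ⁻¹' S).Nonempty := by
    by_contra h
    rw [not_nonempty_iff_eq_empty] at h
    rw [h, vectorSpan_empty, finrank_bot] at hfr
    omega
  have htop : vectorSpan ℝ (j ⁻¹' S) = ⊤ := by
    apply Submodule.eq_top_of_finrank_eq
    simp [hfr]
  have haff := (AffineSubspace.affineSpan_eq_top_iff_vectorSpan_eq_top_of_nonempty ℝ _ _ hne).2 htop
  have hint := hconv.interior_nonempty_iff_affineSpan_eq_top.2 haff
  exact (isOpen_interior.measure_pos volume hint).trans_le (measure_mono interior_subset)

/-! ### Cones -/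

/-- The cone with apex `x₀` over `S`, without the apex. -/
def cone {d : ℕ} (x₀ : E d) (S : Set (E d)) : Set (E d) :=
  {x | ∃ t ∈ Ioc (0 : ℝ) 1, ∃ y ∈ S, x = x₀ + t • (y - x₀)}

/-- The measure on `ℝ × ℝ^d` whose image under `(t, y) ↦ x₀ + t (y - x₀)` is the volume on the
cone with apex `x₀` over `S`, where `D` is the distance from `x₀` to the hyperplane of `S`. -/
def coneMeasure {d : ℕ} (D : ℝ) (S : Set (E d)) : Measure (ℝ × E d) :=
  ((volume.restrict (Ioc (0 : ℝ) 1)).withDensity fun t => ENNReal.ofReal (D * t ^ (d - 1))).prod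
    ((Measure.euclideanHausdorffMeasure (d - 1)).restrict S)

/-- The height over the apex, measured in units of the distance `b - ⟪n, x₀⟫`, is exactly the cone
parameter. Slices parallel to the base are therefore homothetic copies of `S`. -/
lemma cone_inter_slice {d : ℕ} {n x₀ : E d} (hn : ‖n‖ = 1) {b : ℝ} (hb : ⟪n, x₀⟫ < b)
    {S : Set (E d)} (hS : S ⊆ {x | ⟪n, x⟫ = b}) (t : ℝ) :
    cone x₀ S ∩ AffineSubspace.mk' (t • ((b - ⟪n, x₀⟫) • n) +ᵥ x₀) (ℝ ∙ ((b - ⟪n, x₀⟫) • n))ᗮ =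
      if t ∈ Ioc (0 : ℝ) 1 then AffineMap.homothety x₀ t '' S else ∅ := by
  have hD : b - ⟪n, x₀⟫ ≠ 0 := by linarith
  have hmem : ∀ x, x ∈ AffineSubspace.mk' (t • ((b - ⟪n, x₀⟫) • n) +ᵥ x₀)
      (ℝ ∙ ((b - ⟪n, x₀⟫) • n))ᗮ ↔ ⟪n, x⟫ - ⟪n, x₀⟫ = t * (b - ⟪n, x₀⟫) := by
    intro x
    rw [AffineSubspace.mem_mk', Submodule.mem_orthogonal_singleton_iff_inner_right]
    simp only [vadd_eq_add, vsub_eq_sub, inner_sub_right, inner_add_right, inner_smul_left,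
      inner_smul_right, real_inner_self_eq_norm_sq, hn, RCLike.conj_to_real]
    constructor
    · intro h
      apply mul_left_cancel₀ hD
      linarith
    · intro h
      linear_combination (b - ⟪n, x₀⟫) * h
  have hcone : ∀ s : ℝ, ∀ y ∈ S, ⟪n, x₀ + s • (y - x₀)⟫ - ⟪n, x₀⟫ = s * (b - ⟪n, x₀⟫) := by
    intro s y hy
    have : ⟪n, y⟫ = b := hS hy
    simp [inner_add_right, inner_smul_right, inner_sub_right, this]
  ext x
  simp only [mem_inter_iff, SetLike.mem_coe, hmem]
  constructor
  · rintro ⟨⟨s, hs, y, hy, rfl⟩, h⟩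
    rw [hcone s y hy] at h
    obtain rfl := mul_right_cancel₀ hD h
    rw [if_pos hs]
    exact ⟨y, hy, by simp [AffineMap.homothety_apply, add_comm]⟩
  · intro h
    split_ifs at h with ht
    · obtain ⟨y, hy, rfl⟩ := h
      have : AffineMap.homothety x₀ t y = x₀ + t • (y - x₀) := by
        simp [AffineMap.homothety_apply, add_comm]
      rw [this]
      exact ⟨⟨t, ht, y, hy, rfl⟩, hcone t y hy⟩
    · exact absurd h (notMem_empty _)

/-- The parameter `t` and the base point `y` are recovered measurably from `x`, through the relative
height and the central projection onto the hyperplane. -/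
lemma measurableSet_cone {d : ℕ} {n x₀ : E d} {b : ℝ} (hb : ⟪n, x₀⟫ < b)
    {S : Set (E d)} (hS : S ⊆ {x | ⟪n, x⟫ = b}) (hSm : MeasurableSet S) :
    MeasurableSet (cone x₀ S) := by
  have hD : 0 < b - ⟪n, x₀⟫ := by linarith
  have : cone x₀ S = {x | (⟪n, x⟫ - ⟪n, x₀⟫) / (b - ⟪n, x₀⟫) ∈ Ioc (0 : ℝ) 1} ∩
      (fun x => x₀ + ((⟪n, x⟫ - ⟪n, x₀⟫) / (b - ⟪n, x₀⟫))⁻¹ • (x - x₀)) ⁻¹' S := by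
    ext x
    constructor
    · rintro ⟨t, ht, y, hy, rfl⟩
      have h1 : ⟪n, y⟫ = b := hS hy
      have h2 : (⟪n, x₀ + t • (y - x₀)⟫ - ⟪n, x₀⟫) / (b - ⟪n, x₀⟫) = t := by
        rw [inner_add_right, inner_smul_right, inner_sub_right, h1]
        field_simp
        ring
      refine ⟨by rw [mem_ofPred_eq, h2]; exact ht, ?_⟩
      simp only [mem_preimage, h2, add_sub_cancel_left, smul_smul, inv_mul_cancel₀ ht.1.ne']
      simpa using hy
    · rintro ⟨h1, h2⟩
      refine ⟨_, h1, _, h2, ?_⟩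
      simp only [add_sub_cancel_left, smul_smul, mul_inv_cancel₀ (ne_of_gt h1.1)]
      simp
  rw [this]
  refine MeasurableSet.inter ?_ ?_
  · exact measurableSet_Ioc.preimage (by fun_prop)
  · exact hSm.preimage (by fun_prop)

/-- The volume on a cone in terms of the surface measure on its base. -/
lemma volume_restrict_cone {d : ℕ} (hd : 1 ≤ d) {n x₀ : E d} (hn : ‖n‖ = 1) {b : ℝ}
    (hb : ⟪n, x₀⟫ < b) {S : Set (E d)} (hS : S ⊆ {x | ⟪n, x⟫ = b}) (hSm : MeasurableSet S)
    (hSb : Bornology.IsBounded S) :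
    (volume : Measure (E d)).restrict (cone x₀ S) =
      (coneMeasure (b - ⟪n, x₀⟫) S).map fun p => x₀ + p.1 • (p.2 - x₀) := by
  have hD : 0 < b - ⟪n, x₀⟫ := by linarith
  have hn0 : n ≠ 0 := by rintro rfl; simp at hn
  have hfin : Fact (Measure.euclideanHausdorffMeasure (d - 1) S < ⊤) :=
    ⟨surface_lt_top hd hn hS hSb⟩
  have hm : Measurable fun p : ℝ × E d => x₀ + p.1 • (p.2 - x₀) := by fun_prop
  ext A hA
  rw [Measure.restrict_apply hA, Measure.map_apply hm hA, coneMeasure,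
    Measure.prod_apply (hA.preimage hm),
    lintegral_withDensity_eq_lintegral_mul₀ (by fun_prop)
      (measurable_measure_prodMk_left (hA.preimage hm)).aemeasurable]
  have hvol : (volume : Measure (E d)) = Measure.euclideanHausdorffMeasure (finrank ℝ (E d)) :=
    InnerProductSpace.euclideanHausdorffMeasure_eq_volume.symm
  -- Slicing along this multiple of `n`, not along `n` itself, makes the slicing variable coincide
  -- with the cone parameter; its norm is the factor `D` of `coneMeasure`. The factor `t ^ (d - 1)`
  -- comes from the homothety.
  have hv : (b - ⟪n, x₀⟫) • n ≠ 0 := smul_ne_zero hD.ne' hn0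
  rw [hvol, EuclideanGeometry.euclideanHausdorffMeasure_eq_lintegral x₀ hv
    (hA.inter (measurableSet_cone hb hS hSm)), ← lintegral_indicator measurableSet_Ioc,
    ← lintegral_const_mul']
  swap
  · simp
  congr 1
  ext t
  rw [inter_assoc, cone_inter_slice hn hb hS, finrank_euclideanSpace_fin]
  by_cases ht : t ∈ Ioc (0 : ℝ) 1
  · rw [if_pos ht, indicator_of_mem ht]
    have himg : A ∩ AffineMap.homothety x₀ t '' S =
        AffineMap.homothety x₀ t '' (((fun y => x₀ + t • (y - x₀)) ⁻¹' A) ∩ S) := by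
      have : (fun y => x₀ + t • (y - x₀)) = AffineMap.homothety x₀ t := by
        ext y; simp [AffineMap.homothety_apply, add_comm]
      rw [this, image_preimage_inter]
    rw [himg, euclideanHausdorffMeasure_homothety_image _ _ ht.1.ne']
    simp only [Pi.mul_apply, ENNReal.smul_def, smul_eq_mul, preimage_preimage]
    rw [Measure.restrict_apply (hA.preimage (by fun_prop)), ← mul_assoc]
    congr 1
    rw [ENNReal.ofReal_mul hD.le, enorm_smul, ENNReal.ofReal_pow ht.1.le]
    have h1 : ‖n‖ₑ = 1 := by rw [← ofReal_norm, hn, ENNReal.ofReal_one]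
    have h2 : ‖b - ⟪n, x₀⟫‖ₑ = ENNReal.ofReal (b - ⟪n, x₀⟫) := Real.enorm_of_nonneg hD.le
    have h3 : ((‖t‖₊ : NNReal) : ENNReal) = ENNReal.ofReal t := Real.enorm_of_nonneg ht.1.le
    rw [h1, h2, mul_one, ENNReal.coe_pow, h3]
  · rw [if_neg ht, indicator_of_notMem ht]
    simp

lemma cone_subset {d : ℕ} {K S : Set (E d)} (hK : Convex ℝ K) {x₀ : E d} (hx₀ : x₀ ∈ K)
    (hS : S ⊆ K) : cone x₀ S ⊆ K := by
  rintro _ ⟨t, ht, y, hy, rfl⟩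
  exact hK.add_smul_sub_mem hx₀ (hS hy) ⟨ht.1.le, ht.2⟩

/-- Data of a subset of a hyperplane together with the apex of a cone. -/
structure ConeBase {d : ℕ} (x₀ : E d) (S : Set (E d)) (n : E d) (b : ℝ) : Prop where
  pos_dim : 1 ≤ d
  norm_eq : ‖n‖ = 1
  apex_lt : ⟪n, x₀⟫ < b
  subset : S ⊆ {x | ⟪n, x⟫ = b}
  compact : IsCompact S

namespace ConeBase

variable {d : ℕ} {x₀ : E d} {S : Set (E d)} {n : E d} {b : ℝ}

lemma surface_lt_top (h : ConeBase x₀ S n b) :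
    Measure.euclideanHausdorffMeasure (d - 1) S < ⊤ :=
  DGOldroyd.surface_lt_top h.pos_dim h.norm_eq h.subset h.compact.isBounded

lemma measurableSet_cone (h : ConeBase x₀ S n b) : MeasurableSet (cone x₀ S) :=
  DGOldroyd.measurableSet_cone h.apex_lt h.subset h.compact.measurableSet

lemma restrict_cone (h : ConeBase x₀ S n b) :
    (volume : Measure (E d)).restrict (cone x₀ S) =
      (coneMeasure (b - ⟪n, x₀⟫) S).map fun p => x₀ + p.1 • (p.2 - x₀) :=
  volume_restrict_cone h.pos_dim h.norm_eq h.apex_lt h.subset h.compact.measurableSet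
    h.compact.isBounded

lemma integrableOn_cone (h : ConeBase x₀ S n b) {G : E d → ℝ} (hG : Continuous G) :
    IntegrableOn G (cone x₀ S) := by
  have hc : IsCompact ((fun p : ℝ × E d => x₀ + p.1 • (p.2 - x₀)) '' (Icc (0 : ℝ) 1 ×ˢ S)) :=
    (isCompact_Icc.prod h.compact).image (by fun_prop)
  refine (hG.continuousOn.integrableOn_compact hc).mono_set ?_
  rintro _ ⟨t, ht, y, hy, rfl⟩
  exact ⟨(t, y), ⟨⟨ht.1.le, ht.2⟩, hy⟩, rfl⟩

lemma integrable_comp (h : ConeBase x₀ S n b) {G : E d → ℝ} (hG : Continuous G) :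
    Integrable (fun p : ℝ × E d => G (x₀ + p.1 • (p.2 - x₀))) (coneMeasure (b - ⟪n, x₀⟫) S) := by
  have := h.integrableOn_cone hG
  rw [IntegrableOn, h.restrict_cone, integrable_map_measure hG.aestronglyMeasurable
    (by fun_prop)] at this
  exact this

lemma integral_density (h : ConeBase x₀ S n b) (f : ℝ → ℝ) :
    ∫ t, f t ∂((volume.restrict (Ioc (0 : ℝ) 1)).withDensity
      fun t => ENNReal.ofReal ((b - ⟪n, x₀⟫) * t ^ (d - 1))) =
      (b - ⟪n, x₀⟫) * ∫ t in (0 : ℝ)..1, t ^ (d - 1) * f t := by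
  have hD : 0 < b - ⟪n, x₀⟫ := by linarith [h.apex_lt]
  rw [integral_withDensity_eq_integral_toReal_smul (by fun_prop) (by simp),
    intervalIntegral.integral_of_le zero_le_one, ← integral_const_mul]
  refine setIntegral_congr_fun measurableSet_Ioc fun t ht => ?_
  have : 0 ≤ (b - ⟪n, x₀⟫) * t ^ (d - 1) := mul_nonneg hD.le (pow_nonneg ht.1.le _)
  simp [ENNReal.toReal_ofReal this, mul_assoc]

/-- Integration over a cone along the rays from the apex. -/
lemma setIntegral_cone (h : ConeBase x₀ S n b) {G : E d → ℝ} (hG : Continuous G) :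
    ∫ x in cone x₀ S, G x = (b - ⟪n, x₀⟫) *
      surfInt S (fun y => ∫ t in (0 : ℝ)..1, t ^ (d - 1) * G (x₀ + t • (y - x₀))) := by
  have : Fact (Measure.euclideanHausdorffMeasure (d - 1) S < ⊤) := ⟨h.surface_lt_top⟩
  rw [h.restrict_cone, integral_map (by fun_prop) hG.aestronglyMeasurable, coneMeasure,
    integral_prod_symm _ (h.integrable_comp hG), surfInt, ← integral_const_mul]
  congr 1
  ext y
  exact h.integral_density fun t => G (x₀ + t • (y - x₀))

/-- Integrability of the inner integral in Fubini's theorem, with the positive factor `b - ⟪n, x₀⟫`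
divided out. -/
lemma integrableOn_ray (h : ConeBase x₀ S n b) {G : E d → ℝ} (hG : Continuous G) :
    IntegrableOn (fun y => ∫ t in (0 : ℝ)..1, t ^ (d - 1) * G (x₀ + t • (y - x₀))) S
      (Measure.euclideanHausdorffMeasure (d - 1)) := by
  have : Fact (Measure.euclideanHausdorffMeasure (d - 1) S < ⊤) := ⟨h.surface_lt_top⟩
  have hi := (h.integrable_comp hG).integral_prod_right
  have hD : b - ⟪n, x₀⟫ ≠ 0 := by linarith [h.apex_lt]
  have heq := fun y => h.integral_density fun t => G (x₀ + t • (y - x₀))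
  simp only [heq] at hi
  have := hi.const_mul (b - ⟪n, x₀⟫)⁻¹
  simp only [← mul_assoc, inv_mul_cancel₀ hD, one_mul] at this
  exact this

end ConeBase

/-! ### Decomposition of a polytope into cones over its facets -/

lemma IsConvexPolytope.isClosed {d : ℕ} {K : Set (E d)} (hK : IsConvexPolytope K) :
    IsClosed K := by
  obtain ⟨-, T, rfl⟩ := hK
  simp only [ofPred_forall]
  exact isClosed_iInter fun s => isClosed_iInter fun _ =>
    isClosed_le (by fun_prop) continuous_const

lemma IsConvexPolytope.isCompact {d : ℕ} {K : Set (E d)} (hK : IsConvexPolytope K) :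
    IsCompact K :=
  Metric.isCompact_of_isClosed_isBounded hK.isClosed hK.1

lemma IsConvexPolytope.convex {d : ℕ} {K : Set (E d)} (hK : IsConvexPolytope K) :
    Convex ℝ K := by
  obtain ⟨-, T, rfl⟩ := hK
  simp only [ofPred_forall]
  exact convex_iInter fun s => convex_iInter fun _ =>
    convex_halfSpace_le (innerSL ℝ s.1).toLinearMap.isLinear _

/-- The farthest point of the ball in direction `n` still satisfies the constraint. Hence the apex
keeps at least the distance `r` from every facet hyperplane, which is what the trace inequality
uses. -/
lemma add_radius_le {d : ℕ} {K : Set (E d)} {x₀ n : E d} (hn : ‖n‖ = 1) {r b : ℝ} (hr : 0 ≤ r)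
    (hball : Metric.closedBall x₀ r ⊆ K) (hb : ∀ x ∈ K, ⟪n, x⟫ ≤ b) : ⟪n, x₀⟫ + r ≤ b := by
  have : x₀ + r • n ∈ K := hball (by simp [norm_smul, hn, abs_of_nonneg hr])
  simpa [inner_add_right, inner_smul_right, hn] using hb _ this

lemma inner_lt_of_mem_interior {d : ℕ} {K : Set (E d)} {x₀ n : E d} (hn : n ≠ 0) {b : ℝ}
    (hx₀ : x₀ ∈ interior K) (hb : ∀ x ∈ K, ⟪n, x⟫ ≤ b) : ⟪n, x₀⟫ < b := by
  obtain ⟨r, hr, hball⟩ := Metric.nhds_basis_closedBall.mem_iff.1 (mem_interior_iff_mem_nhds.1 hx₀)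
  have hn' : 0 < ‖n‖ := norm_pos_iff.2 hn
  have h := add_radius_le (n := ‖n‖⁻¹ • n) (b := ‖n‖⁻¹ * b)
    (by rw [norm_smul, norm_inv, norm_norm, inv_mul_cancel₀ hn'.ne']) hr.le hball fun x hx => by
      rw [real_inner_smul_left]
      exact mul_le_mul_of_nonneg_left (hb x hx) (by positivity)
  rw [real_inner_smul_left] at h
  have : ‖n‖⁻¹ * ⟪n, x₀⟫ < ‖n‖⁻¹ * b := by linarith
  exact lt_of_mul_lt_mul_left this (by positivity)

/-- Every point of a polytope other than the apex lies on a ray that leaves the polytope through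
a nontrivial active constraint. -/
lemma exists_active_constraint {d : ℕ} {T : Finset (E d × ℝ)} {x₀ x : E d}
    (hK : Bornology.IsBounded {x | ∀ s ∈ T, ⟪s.1, x⟫ ≤ s.2})
    (hx : ∀ s ∈ T, ⟪s.1, x⟫ ≤ s.2) (hne : x ≠ x₀) :
    ∃ s ∈ T, s.1 ≠ 0 ∧ x ∈ cone x₀ {y | (∀ s ∈ T, ⟪s.1, y⟫ ≤ s.2) ∧ ⟪s.1, y⟫ = s.2} := by
  set K := {x | ∀ s ∈ T, ⟪s.1, x⟫ ≤ s.2} with hKdef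
  have hKp : IsConvexPolytope K := ⟨hK, T, rfl⟩
  -- `A` collects the parameters for which the ray from `x₀` through `x` (reached at `t = 1`) stays
  -- in the polytope. At its supremum some constraint must be active, or the ray could be prolonged.
  set A := (fun t : ℝ => x₀ + t • (x - x₀)) ⁻¹' K with hA
  have hAcl : IsClosed A := hKp.isClosed.preimage (by fun_prop)
  have h1A : (1 : ℝ) ∈ A := by
    rw [hA, mem_preimage, one_smul, add_sub_cancel]
    exact hx
  have hAb : BddAbove A := by
    obtain ⟨R, hR⟩ := hK.subset_closedBall x₀
    refine ⟨R / ‖x - x₀‖, fun t ht => ?_⟩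
    have h0 : 0 < ‖x - x₀‖ := norm_pos_iff.2 (sub_ne_zero.2 hne)
    rw [le_div_iff₀ h0]
    have := hR ht
    simp only [Metric.mem_closedBall, dist_self_add_left, norm_smul, Real.norm_eq_abs] at this
    exact (mul_le_mul_of_nonneg_right (le_abs_self t) h0.le).trans this
  have hmem : sSup A ∈ A := hAcl.csSup_mem ⟨1, h1A⟩ hAb
  have hone : 1 ≤ sSup A := le_csSup hAb h1A
  have hact : ∃ s ∈ T, s.1 ≠ 0 ∧ ⟪s.1, x₀ + sSup A • (x - x₀)⟫ = s.2 := by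
    by_contra! hcon
    have hev : ∀ s ∈ T, ∀ᶠ t in nhds (sSup A), ⟪s.1, x₀ + t • (x - x₀)⟫ ≤ s.2 := by
      intro s hs
      by_cases hs0 : s.1 = 0
      -- A constraint with zero normal does not depend on the point and never stops the ray.
      · have := hx s hs
        simp only [hs0, inner_zero_left] at this ⊢
        exact Filter.Eventually.of_forall fun _ => this
      · have hlt : ⟪s.1, x₀ + sSup A • (x - x₀)⟫ < s.2 := lt_of_le_of_ne (hmem s hs) (hcon s hs hs0)
        have hc : Continuous fun t : ℝ => ⟪s.1, x₀ + t • (x - x₀)⟫ := by fun_prop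
        filter_upwards [hc.continuousAt.eventually_lt_const hlt] with t ht using ht.le
    have hev' : ∀ᶠ t in nhds (sSup A), t ∈ A := (Filter.eventually_all_finset T).2 hev
    obtain ⟨δ, hδ, hball⟩ := Metric.eventually_nhds_iff.1 hev'
    have : sSup A + δ / 2 ∈ A := hball (by simp [abs_of_pos hδ]; linarith)
    linarith [le_csSup hAb this]
  obtain ⟨s, hs, hs0, heq⟩ := hact
  have hpos : 0 < sSup A := by linarith
  refine ⟨s, hs, hs0, (sSup A)⁻¹, ⟨by positivity, inv_le_one_of_one_le₀ hone⟩, _, ⟨hmem, heq⟩, ?_⟩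
  simp [smul_smul, hpos.ne']

/-- The cone lies in the affine span of `S` and the apex, whose dimension exceeds that of `S` by at
most one and so stays below `d`. -/
lemma volume_cone_eq_zero {d : ℕ} {S : Set (E d)} (x₀ : E d)
    (hdim : finrank ℝ (vectorSpan ℝ S) + 1 < d) : volume (cone x₀ S) = 0 := by
  have hsub : cone x₀ S ⊆ affineSpan ℝ (insert x₀ S) := by
    rintro _ ⟨t, -, y, hy, rfl⟩
    have h := AffineMap.lineMap_mem t (subset_affineSpan ℝ _ (mem_insert x₀ S))
      (subset_affineSpan ℝ _ (mem_insert_of_mem x₀ hy))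
    simpa [AffineMap.lineMap_apply, add_comm] using h
  refine measure_mono_null hsub (Measure.addHaar_affineSubspace _ _ fun htop => ?_)
  have h1 := finrank_vectorSpan_insert_le_set ℝ S x₀
  rw [← direction_affineSpan, htop, AffineSubspace.direction_top, finrank_top,
    finrank_euclideanSpace_fin] at h1
  omega

lemma volume_hyperplane {d : ℕ} {a : E d} (ha : a ≠ 0) (x₀ : E d) :
    volume {x : E d | ⟪a, x - x₀⟫ = 0} = 0 := by
  have : {x : E d | ⟪a, x - x₀⟫ = 0} = AffineSubspace.mk' x₀ (ℝ ∙ a)ᗮ := by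
    ext x
    simp [AffineSubspace.mem_mk', Submodule.mem_orthogonal_singleton_iff_inner_right]
  rw [this]
  refine Measure.addHaar_affineSubspace _ _ fun htop => ?_
  have h := congrArg AffineSubspace.direction htop
  rw [AffineSubspace.direction_mk', AffineSubspace.direction_top,
    Submodule.orthogonal_eq_top_iff, Submodule.span_singleton_eq_bot] at h
  exact ha h

/-- An active constraint whose face has codimension one yields a facet; the other faces span
lower-dimensional spaces. -/
lemma isFacet_or_finrank_lt {d : ℕ} {K : Set (E d)} {a : E d} (ha : a ≠ 0) {c : ℝ}
    (hc : ∀ x ∈ K, ⟪a, x⟫ ≤ c) :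
    IsFacet K {x ∈ K | ⟪a, x⟫ = c} (‖a‖⁻¹ • a) ∨
      finrank ℝ (vectorSpan ℝ {x ∈ K | ⟪a, x⟫ = c}) + 1 < d := by
  have ha' : 0 < ‖a‖ := norm_pos_iff.2 ha
  have hd : d ≠ 0 := by
    rintro rfl
    exact ha (Subsingleton.elim _ _)
  by_cases hfr : finrank ℝ (vectorSpan ℝ {x ∈ K | ⟪a, x⟫ = c}) + 1 = d
  · left
    refine ⟨by rw [norm_smul, norm_inv, norm_norm, inv_mul_cancel₀ ha'.ne'], hfr, ‖a‖⁻¹ * c,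
      fun x hx => ?_, ?_⟩
    · rw [real_inner_smul_left]
      exact mul_le_mul_of_nonneg_left (hc x hx) (by positivity)
    · ext x
      simp only [mem_ofPred_eq, real_inner_smul_left, mul_right_inj' (inv_ne_zero ha'.ne')]
  · right
    -- The face lies in a hyperplane, so its dimension is at most `d - 1`; if it is not `d - 1`, it
    -- is smaller.
    have hle : vectorSpan ℝ {x ∈ K | ⟪a, x⟫ = c} ≤ (ℝ ∙ a)ᗮ := by
      rw [vectorSpan_def, Submodule.span_le]
      rintro _ ⟨x, hx, y, hy, rfl⟩
      rw [SetLike.mem_coe, Submodule.mem_orthogonal_singleton_iff_inner_right]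
      simp [inner_sub_right, hx.2, hy.2]
    have : Fact (finrank ℝ (E d) = (d - 1) + 1) := ⟨by simp; omega⟩
    have h1 := Submodule.finrank_mono hle
    rw [Submodule.finrank_orthogonal_span_singleton (n := d - 1) ha] at h1
    omega

/-- A complete list of the facets of a polytope, with outward unit normals and offsets. -/
structure FacetList {d : ℕ} (K : Set (E d)) {I : Type*} (S : I → Set (E d)) (n : I → E d)
    (b : I → ℝ) : Prop where
  polytope : IsConvexPolytope K
  norm_eq : ∀ i, ‖n i‖ = 1
  finrank_eq : ∀ i, finrank ℝ (vectorSpan ℝ (S i)) + 1 = d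
  le : ∀ i, ∀ x ∈ K, ⟪n i, x⟫ ≤ b i
  eq : ∀ i, S i = {x ∈ K | ⟪n i, x⟫ = b i}
  injective : Function.Injective S
  complete : ∀ S' n', IsFacet K S' n' → ∃ i, S i = S'

namespace FacetList

variable {d : ℕ} {K : Set (E d)} {I : Type*} {S : I → Set (E d)} {n : I → E d} {b : I → ℝ}

lemma apex_lt (h : FacetList K S n b) {x₀ : E d} (hx₀ : x₀ ∈ interior K) (i : I) :
    ⟪n i, x₀⟫ < b i :=
  inner_lt_of_mem_interior (by intro h0; simpa [h0] using h.norm_eq i) hx₀ (h.le i)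

lemma subset (h : FacetList K S n b) (i : I) : S i ⊆ K := by
  rw [h.eq i]; exact sep_subset _ _

lemma coneBase (h : FacetList K S n b) {x₀ : E d} (hx₀ : x₀ ∈ interior K) (i : I) :
    ConeBase x₀ (S i) (n i) (b i) where
  pos_dim := by have := h.finrank_eq i; omega
  norm_eq := h.norm_eq i
  apex_lt := h.apex_lt hx₀ i
  subset := by rw [h.eq i]; exact fun x hx => hx.2
  compact := by
    rw [h.eq i]
    exact h.polytope.isCompact.inter_right (isClosed_eq (by fun_prop) continuous_const)

/-- Each point other than the apex lies in the cone over the face of some active constraint. If that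
face is not a facet, its cone is null, and there are finitely many constraints. -/
lemma ae_eq_iUnion_cone (h : FacetList K S n b) {x₀ : E d} (hx₀ : x₀ ∈ interior K) (hd : 1 ≤ d) :
    K =ᵐ[volume] ⋃ i, cone x₀ (S i) := by
  have hsub : (⋃ i, cone x₀ (S i)) ⊆ K :=
    iUnion_subset fun i => cone_subset h.polytope.convex (interior_subset hx₀) (h.subset i)
  refine Filter.EventuallyLE.antisymm ?_ hsub.eventuallyLE
  obtain ⟨hbd, T, hT⟩ := h.polytope
  have hle : ∀ s ∈ T, ∀ x ∈ K, ⟪s.1, x⟫ ≤ s.2 := fun s hs x hx => (hT ▸ hx) s hs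
  rw [ae_le_set]
  have hnull : volume ({x₀} ∪ ⋃ s ∈ {s | s ∈ T ∧ finrank ℝ (vectorSpan ℝ {x ∈ K | ⟪s.1, x⟫ = s.2}) + 1
      < d}, cone x₀ {x ∈ K | ⟪s.1, x⟫ = s.2}) = 0 := by
    have : Nontrivial (E d) := by
      have : Nonempty (Fin d) := ⟨⟨0, hd⟩⟩
      infer_instance
    refine measure_union_null (by simp) ?_
    rw [measure_biUnion_null_iff (T.finite_toSet.subset fun s hs => hs.1).countable]
    exact fun s hs => volume_cone_eq_zero x₀ hs.2
  refine measure_mono_null ?_ hnull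
  rintro x ⟨hxK, hxU⟩
  by_cases hxx : x = x₀
  · exact Or.inl hxx
  right
  obtain ⟨s, hs, hs0, hxc⟩ := exists_active_constraint (x₀ := x₀) (hT ▸ hbd)
    (fun s hs => hle s hs x hxK) hxx
  have hset : {y | (∀ s ∈ T, ⟪s.1, y⟫ ≤ s.2) ∧ ⟪s.1, y⟫ = s.2} = {y ∈ K | ⟪s.1, y⟫ = s.2} := by
    rw [hT]; rfl
  rw [hset] at hxc
  rcases isFacet_or_finrank_lt hs0 (hle s hs) with hf | hlt
  · obtain ⟨i, hi⟩ := h.complete _ _ hf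
    exact absurd (mem_iUnion.2 ⟨i, hi ▸ hxc⟩) hxU
  · exact mem_biUnion (x := s) ⟨hs, hlt⟩ hxc

/-- With `ℓ i x = ⟪n i, x - x₀⟫ / (b i - ⟪n i, x₀⟫)`, a point of two cones has the same cone
parameter in both, so `ℓ i` and `ℓ j` agree there. These functionals differ for distinct facets, so
the overlap lies in a hyperplane. -/
lemma aedisjoint_cone (h : FacetList K S n b) {x₀ : E d} (hx₀ : x₀ ∈ interior K) :
    Pairwise (Function.onFun (AEDisjoint volume) fun i => cone x₀ (S i)) := by
  intro i j hij
  have hD : ∀ i, 0 < b i - ⟪n i, x₀⟫ := fun i => by linarith [h.apex_lt hx₀ i]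
  set a := (b i - ⟪n i, x₀⟫)⁻¹ • n i - (b j - ⟪n j, x₀⟫)⁻¹ • n j with ha
  have hSeq : ∀ i, S i = {x ∈ K | ⟪(b i - ⟪n i, x₀⟫)⁻¹ • n i, x - x₀⟫ = 1} := by
    intro i
    rw [h.eq i]
    ext x
    have := (hD i).ne'
    simp only [mem_ofPred_eq, real_inner_smul_left]
    rw [inner_sub_right, inv_mul_eq_iff_eq_mul₀ this, mul_one, sub_left_inj]
  have ha0 : a ≠ 0 := by
    intro h0
    apply hij
    apply h.injective
    rw [hSeq i, hSeq j, sub_eq_zero.1 h0]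
  refine measure_mono_null ?_ (volume_hyperplane ha0 x₀)
  -- The base point `y` on facet `i` satisfies constraint `j`, while `y'` makes it an equality;
  -- evaluating `n j` on the common vector compares the parameters.
  have key : ∀ i j, ∀ t t' : ℝ, 0 < t → ∀ y ∈ S i, ∀ y' ∈ S j, t • (y - x₀) = t' • (y' - x₀) →
      t' ≤ t := by
    intro i j t t' ht y hy y' hy' heq
    have h1 : ⟪n j, t • (y - x₀)⟫ ≤ t * (b j - ⟪n j, x₀⟫) := by
      rw [real_inner_smul_right, inner_sub_right]
      exact mul_le_mul_of_nonneg_left (by linarith [h.le j y (h.subset i hy)]) ht.le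
    have h2 : ⟪n j, y'⟫ = b j := (h.coneBase hx₀ j).subset hy'
    rw [heq, real_inner_smul_right, inner_sub_right, h2] at h1
    exact le_of_mul_le_mul_right h1 (hD j)
  rintro x ⟨⟨t, ht, y, hy, rfl⟩, ⟨t', ht', y', hy', heq⟩⟩
  replace heq := add_left_cancel heq
  have htt : t = t' :=
    le_antisymm (key j i t' t ht'.1 y' hy' y hy heq.symm) (key i j t t' ht.1 y hy y' hy' heq)
  rw [hSeq i] at hy
  rw [hSeq j] at hy'
  show ⟪a, x₀ + t • (y - x₀) - x₀⟫ = 0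
  rw [ha, add_sub_cancel_left, inner_sub_left, real_inner_smul_right, hy.2, heq,
    real_inner_smul_right, hy'.2, htt, sub_self]

/-- Integration over a polytope along the rays from an interior point. -/
lemma setIntegral_eq_sum [Fintype I] (h : FacetList K S n b) {x₀ : E d} (hx₀ : x₀ ∈ interior K)
    (hd : 1 ≤ d) {G : E d → ℝ} (hG : Continuous G) :
    ∫ x in K, G x = ∑ i, (b i - ⟪n i, x₀⟫) *
      surfInt (S i) (fun y => ∫ t in (0 : ℝ)..1, t ^ (d - 1) * G (x₀ + t • (y - x₀))) := by
  rw [Measure.restrict_congr_set (h.ae_eq_iUnion_cone hx₀ hd),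
    Measure.restrict_iUnion_ae (h.aedisjoint_cone hx₀)
      (fun i => (h.coneBase hx₀ i).measurableSet_cone.nullMeasurableSet),
    Measure.sum_fintype,
    integral_finsetSum_measure fun i _ => (h.coneBase hx₀ i).integrableOn_cone hG]
  exact Finset.sum_congr rfl fun i _ => (h.coneBase hx₀ i).setIntegral_cone hG

/-- Along a ray the integrand weighted by `t ^ (d - 1)` is the derivative of `t ^ d * g (x₀ + t • (y
- x₀))`, so the inner integral is `g y`. -/
lemma setIntegral_radial [Fintype I] (h : FacetList K S n b) {x₀ : E d} (hx₀ : x₀ ∈ interior K)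
    (hd : 1 ≤ d) {g : E d → ℝ} (hg : ContDiff ℝ 1 g) :
    ∫ x in K, (d * g x + fderiv ℝ g x (x - x₀)) =
      ∑ i, (b i - ⟪n i, x₀⟫) * surfInt (S i) g := by
  have hg' : Continuous (fderiv ℝ g) := hg.continuous_fderiv one_ne_zero
  have hgc : Continuous g := hg.continuous
  rw [h.setIntegral_eq_sum hx₀ hd (by fun_prop)]
  refine Finset.sum_congr rfl fun i _ => ?_
  congr 2
  ext y
  have hderiv : ∀ t ∈ uIcc (0 : ℝ) 1, HasDerivAt (fun t : ℝ => t ^ d * g (x₀ + t • (y - x₀)))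
      (t ^ (d - 1) * (d * g (x₀ + t • (y - x₀)) +
        fderiv ℝ g (x₀ + t • (y - x₀)) (x₀ + t • (y - x₀) - x₀))) t := by
    intro t _
    have h1 : HasDerivAt (fun t : ℝ => x₀ + t • (y - x₀)) (y - x₀) t := by
      simpa using ((hasDerivAt_id t).smul_const (y - x₀)).const_add x₀
    have h2 := ((hg.differentiable one_ne_zero _).hasFDerivAt (x := x₀ + t • (y - x₀))).comp_hasDerivAt
      t h1
    have h3 := (hasDerivAt_pow d t).mul h2
    refine h3.congr_deriv ?_
    have hpow : t ^ d = t ^ (d - 1) * t := by rw [← pow_succ, Nat.sub_add_cancel hd]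
    rw [add_sub_cancel_left, map_smul, smul_eq_mul, hpow, Function.comp_apply]
    ring
  rw [intervalIntegral.integral_eq_sub_of_hasDerivAt hderiv
    (Continuous.intervalIntegrable (by fun_prop) _ _)]
  simp [show d ≠ 0 by omega]

/-- The divergence theorem on a polytope. -/
theorem setIntegral_fderiv [Fintype I] (h : FacetList K S n b) (hK : (interior K).Nonempty)
    (hd : 1 ≤ d) {g : E d → ℝ} (hg : ContDiff ℝ 1 g) (v : E d) :
    ∫ x in K, fderiv ℝ g x v = ∑ i, ⟪n i, v⟫ * surfInt (S i) g := by
  obtain ⟨x₀, hx₀⟩ := hK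
  have hg' : Continuous (fderiv ℝ g) := hg.continuous_fderiv one_ne_zero
  have hgc : Continuous g := hg.continuous
  have hev : ∀ᶠ s in nhds (0 : ℝ), x₀ + s • v ∈ interior K := by
    have hc : ContinuousAt (fun s : ℝ => x₀ + s • v) 0 := by fun_prop
    exact hc.eventually_mem (isOpen_interior.mem_nhds (by simpa using hx₀))
  -- A second admissible apex `x₀ + s • v` with `s ≠ 0`. Subtracting the two radial formulas leaves
  -- `s` times the divergence theorem in direction `v`.
  obtain ⟨s, hs, hs0⟩ : ∃ s : ℝ, x₀ + s • v ∈ interior K ∧ s ≠ 0 := by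
    have := (hev.filter_mono nhdsWithin_le_nhds).and (self_mem_nhdsWithin (s := {(0 : ℝ)}ᶜ))
    exact this.exists
  have h1 := h.setIntegral_radial hx₀ hd hg
  have h2 := h.setIntegral_radial hs hd hg
  have hint : ∀ x₁ : E d, IntegrableOn (fun x => d * g x + fderiv ℝ g x (x - x₁)) K := fun x₁ =>
    (Continuous.continuousOn (by fun_prop)).integrableOn_compact h.polytope.isCompact
  have h3 : ∫ x in K, s * fderiv ℝ g x v = s * ∑ i, ⟪n i, v⟫ * surfInt (S i) g := by
    have : (fun x => s * fderiv ℝ g x v) = fun x => (d * g x + fderiv ℝ g x (x - x₀)) -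
        (d * g x + fderiv ℝ g x (x - (x₀ + s • v))) := by
      ext x
      simp only [map_sub, map_add, map_smul, smul_eq_mul]
      ring
    rw [this, integral_sub (hint _) (hint _), h1, h2, ← Finset.sum_sub_distrib, Finset.mul_sum]
    refine Finset.sum_congr rfl fun i _ => ?_
    rw [inner_add_right, real_inner_smul_right]
    ring
  rw [integral_const_mul] at h3
  exact mul_left_cancel₀ hs0 h3

end FacetList

/-! ### Linear algebra -/

/-- A bilinear form on a finite-dimensional space that vanishes on no nonzero diagonal element
represents every linear functional uniquely. -/
lemma existsUnique_riesz {V : Type*} [AddCommGroup V] [Module ℝ V] [FiniteDimensional ℝ V]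
    (B : V →ₗ[ℝ] V →ₗ[ℝ] ℝ) (hB : ∀ v, B v v = 0 → v = 0) (l : V →ₗ[ℝ] ℝ) :
    ∃! u, ∀ v, B u v = l v := by
  have hinj : Function.Injective B := by
    rw [← LinearMap.ker_eq_bot, LinearMap.ker_eq_bot']
    intro v hv
    exact hB v (by rw [hv]; rfl)
  -- Definiteness makes `B` an injective map into the dual space, which has the same finite
  -- dimension.
  have hsurj : Function.Surjective B :=
    (LinearMap.injective_iff_surjective_of_finrank_eq_finrank
      (Subspace.dual_finrank_eq (K := ℝ) (V := V)).symm).1 hinj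
  obtain ⟨u, hu⟩ := hsurj l
  refine ⟨u, fun v => by rw [hu], fun u' hu' => hinj ?_⟩
  ext v
  rw [hu' v, hu]

/-- The integrand vanishes almost everywhere on `U`; on the open set `interior U` continuity
upgrades this to every point, because open sets are charged. -/
lemma eq_zero_of_setIntegral_eq_zero {X : Type*} [TopologicalSpace X] [MeasurableSpace X]
    [BorelSpace X] {μ : Measure X} [μ.IsOpenPosMeasure] {U : Set X} {f : X → ℝ}
    (hf : Continuous f) (h0 : ∀ x, x ∈ U → 0 ≤ f x) (hU : MeasurableSet U) (hi : IntegrableOn f U μ)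
    (h : ∫ x in U, f x ∂μ = 0) {x : X} (hx : x ∈ interior U) : f x = 0 := by
  rw [setIntegral_eq_zero_iff_of_nonneg_ae ((ae_restrict_iff' hU).2 (ae_of_all _ h0)) hi] at h
  have h' : f =ᵐ[μ.restrict (interior U)] 0 :=
    Filter.EventuallyEq.filter_mono h (ae_mono (Measure.restrict_mono interior_subset le_rfl))
  exact Measure.eqOn_open_of_ae_eq h' isOpen_interior hf.continuousOn continuousOn_const hx

/-! ### Polynomials in one variable -/

/-- The form `∫₀¹ t^k P Q dt`. -/
def weightedForm (k : ℕ) : Polynomial ℝ →ₗ[ℝ] Polynomial ℝ →ₗ[ℝ] ℝ :=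
  LinearMap.mk₂ ℝ (fun P Q => ∫ t in (0 : ℝ)..1, t ^ k * (P.eval t * Q.eval t))
    (fun P P' Q => by
      rw [← intervalIntegral.integral_add (Continuous.intervalIntegrable (by fun_prop) _ _)
        (Continuous.intervalIntegrable (by fun_prop) _ _)]
      congr 1; ext t; simp only [Polynomial.eval_add]; ring)
    (fun c P Q => by
      rw [smul_eq_mul, ← intervalIntegral.integral_const_mul]
      congr 1; ext t; simp only [Polynomial.eval_smul, smul_eq_mul]; ring)
    (fun P Q Q' => by
      rw [← intervalIntegral.integral_add (Continuous.intervalIntegrable (by fun_prop) _ _)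
        (Continuous.intervalIntegrable (by fun_prop) _ _)]
      congr 1; ext t; simp only [Polynomial.eval_add]; ring)
    (fun c P Q => by
      rw [smul_eq_mul, ← intervalIntegral.integral_const_mul]
      congr 1; ext t; simp only [Polynomial.eval_smul, smul_eq_mul]; ring)

lemma weightedForm_apply (k : ℕ) (P Q : Polynomial ℝ) :
    weightedForm k P Q = ∫ t in (0 : ℝ)..1, t ^ k * (P.eval t * Q.eval t) := rfl

lemma weightedForm_self_nonneg (k : ℕ) (P : Polynomial ℝ) : 0 ≤ weightedForm k P P :=
  intervalIntegral.integral_nonneg zero_le_one fun _ ht =>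
    mul_nonneg (pow_nonneg ht.1 _) (mul_self_nonneg _)

lemma eq_zero_of_weightedForm_self {k : ℕ} {P : Polynomial ℝ} (h : weightedForm k P P = 0) :
    P = 0 := by
  rw [weightedForm_apply, intervalIntegral.integral_of_le zero_le_one] at h
  have hc : Continuous fun t : ℝ => t ^ k * (P.eval t * P.eval t) := by fun_prop
  refine Polynomial.eq_zero_of_infinite_isRoot P ((Ioo_infinite (zero_lt_one' ℝ)).mono ?_)
  intro t ht
  have := eq_zero_of_setIntegral_eq_zero hc
    (fun t ht => mul_nonneg (pow_nonneg ht.1.le _) (mul_self_nonneg _)) measurableSet_Ioc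
    ((hc.continuousOn.integrableOn_compact isCompact_Icc).mono_set Ioc_subset_Icc_self) h
    (x := t) (by rwa [interior_Ioc])
  have h2 : t ^ k ≠ 0 := (pow_pos ht.1 k).ne'
  simpa [h2] using this

/-- The value of a polynomial at the end point is bounded by its weighted `L²` norm. -/
lemma exists_eval_one_sq_le (k r : ℕ) : ∃ C > 0, ∀ P : Polynomial ℝ, P.natDegree ≤ r →
    P.eval 1 ^ 2 ≤ C * ∫ t in (0 : ℝ)..1, t ^ k * P.eval t ^ 2 := by
  let V := Polynomial.degreeLT ℝ (r + 1)
  let B : V →ₗ[ℝ] V →ₗ[ℝ] ℝ := (weightedForm k).compl₁₂ V.subtype V.subtype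
  have hB : ∀ v : V, B v v = 0 → v = 0 := fun v hv => Subtype.ext (eq_zero_of_weightedForm_self hv)
  have : FiniteDimensional ℝ V := Module.Finite.equiv (Polynomial.degreeLTEquiv ℝ (r + 1)).symm
  -- `q` represents evaluation at `1`, so Cauchy–Schwarz gives the bound with constant `B q q`. The
  -- summand `1` only makes the constant visibly positive.
  obtain ⟨q, hq, -⟩ := existsUnique_riesz B hB ((Polynomial.leval 1).comp V.subtype)
  refine ⟨B q q + 1, by have := weightedForm_self_nonneg k (q : Polynomial ℝ);
                        have h2 : B q q = weightedForm k q q := rfl; linarith, fun P hP => ?_⟩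
  have hmem : P ∈ V := by
    rw [Polynomial.mem_degreeLT]
    exact (Polynomial.degree_le_of_natDegree_le hP).trans_lt (by exact_mod_cast Nat.lt_succ_self r)
  have hnn : ∀ x, 0 ≤ B x x := fun x => weightedForm_self_nonneg k _
  have hcs := LinearMap.BilinForm.apply_mul_apply_le_of_forall_zero_le B hnn q ⟨P, hmem⟩
  have hsymm : B ⟨P, hmem⟩ q = B q ⟨P, hmem⟩ := by
    show weightedForm k _ _ = weightedForm k _ _
    simp only [weightedForm_apply]
    congr 1; ext t; simp [mul_comm]
  have heq : B ⟨P, hmem⟩ ⟨P, hmem⟩ = ∫ t in (0 : ℝ)..1, t ^ k * P.eval t ^ 2 := by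
    show weightedForm k _ _ = _
    simp only [weightedForm_apply, sq]
    rfl
  rw [hsymm, hq, heq] at hcs
  have h1 : (Polynomial.leval (R := ℝ) 1 ∘ₗ V.subtype) ⟨P, hmem⟩ = P.eval 1 := rfl
  rw [h1] at hcs
  have h0 := hnn ⟨P, hmem⟩
  rw [heq] at h0
  nlinarith

/-! ### Polynomial functions on `ℝ^d` -/

section polyFun

variable {d r : ℕ}

lemma hasFDerivAt_eval (q : MvPolynomial (Fin d) ℝ) (x : E d) :
    HasFDerivAt (fun x : E d => MvPolynomial.eval (fun i => x i) q)
      (∑ i, MvPolynomial.eval (fun i => x i) (MvPolynomial.pderiv i q) •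
        (EuclideanSpace.proj i : E d →L[ℝ] ℝ)) x := by
  induction q using MvPolynomial.induction_on with
  | C a => simpa using hasFDerivAt_const a x
  | add p q hp hq =>
    simp only [map_add, add_smul, Finset.sum_add_distrib]
    exact hp.add hq
  | mul_X p j hp =>
    have h := hp.mul ((EuclideanSpace.proj j : E d →L[ℝ] ℝ).hasFDerivAt (x := x))
    simp only [map_mul, MvPolynomial.eval_X]
    refine h.congr_fderiv ?_
    simp only [Derivation.leibniz, MvPolynomial.pderiv_X, map_add, smul_eq_mul, map_mul,
      MvPolynomial.eval_X, add_smul, Finset.sum_add_distrib, mul_smul, Finset.smul_sum]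
    congr 1
    rw [Finset.sum_eq_single j]
    · simp
    · intro i _ hij
      simp [hij]
    · simp

lemma totalDegree_pderiv_le (i : Fin d) (q : MvPolynomial (Fin d) ℝ) :
    (MvPolynomial.pderiv i q).totalDegree ≤ q.totalDegree := by
  conv_lhs => rw [q.as_sum, map_sum]
  refine MvPolynomial.totalDegree_finsetSum_le fun s hs => ?_
  rw [MvPolynomial.pderiv_monomial]
  refine (MvPolynomial.totalDegree_monomial_le _ _).trans ?_
  refine le_trans ?_ (MvPolynomial.le_totalDegree hs)
  exact Finsupp.degree_mono (tsub_le_self)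

lemma polyFun_contDiff {g : E d → ℝ} (hg : g ∈ polyFun d r) : ContDiff ℝ 1 g := by
  obtain ⟨q, -, hq⟩ := hg
  have : g = fun x => MvPolynomial.eval (fun i => x i) q := funext hq
  rw [this, contDiff_one_iff_fderiv]
  refine ⟨fun x => (hasFDerivAt_eval q x).differentiableAt, ?_⟩
  have h2 : fderiv ℝ (fun x : E d => MvPolynomial.eval (fun i => x i) q) = fun x =>
      ∑ i, MvPolynomial.eval (fun i => x i) (MvPolynomial.pderiv i q) •
        (EuclideanSpace.proj i : E d →L[ℝ] ℝ) := by
    ext1 x; exact (hasFDerivAt_eval q x).fderiv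
  rw [h2]
  refine continuous_finsetSum _ fun i _ => ?_
  refine Continuous.fun_smul ?_ continuous_const
  exact continuous_iff_continuousAt.2 fun x => (hasFDerivAt_eval _ x).continuousAt

lemma polyFun_fderiv {g : E d → ℝ} (hg : g ∈ polyFun d r) (v : E d) :
    (fun x => fderiv ℝ g x v) ∈ polyFun d r := by
  obtain ⟨q, hqd, hq⟩ := hg
  have : g = fun x => MvPolynomial.eval (fun i => x i) q := funext hq
  have h2 : (fun x => fderiv ℝ g x v) =
      ∑ i, v i • fun x => MvPolynomial.eval (fun i => x i) (MvPolynomial.pderiv i q) := by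
    ext x
    rw [this, (hasFDerivAt_eval q x).fderiv]
    simp [mul_comm]
  rw [h2]
  refine Submodule.sum_mem _ fun i _ => Submodule.smul_mem _ _ ?_
  exact ⟨_, (totalDegree_pderiv_le i q).trans hqd, fun x => rfl⟩

/-- Restriction to lines reduces two questions to one variable: the trace inequality along rays and
the vanishing of polynomials that are zero on an open set. -/
lemma polyFun_line {g : E d → ℝ} (hg : g ∈ polyFun d r) (x₀ v : E d) :
    ∃ P : Polynomial ℝ, P.natDegree ≤ r ∧ ∀ t, g (x₀ + t • v) = P.eval t := by
  obtain ⟨q, hqd, hq⟩ := hg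
  refine ⟨MvPolynomial.aeval (fun i => Polynomial.C (x₀ i) + Polynomial.C (v i) * Polynomial.X) q,
    ?_, fun t => ?_⟩
  · have := MvPolynomial.aeval_natDegree_le q hqd
      (fun i => Polynomial.C (x₀ i) + Polynomial.C (v i) * Polynomial.X) (n := 1) (fun i => by
        compute_degree)
    simpa using this
  · have hi : (fun i => (x₀ + t • v) i) = fun i => Polynomial.aeval t
        (Polynomial.C (x₀ i) + Polynomial.C (v i) * Polynomial.X) := by
      ext i
      simp only [PiLp.add_apply, PiLp.smul_apply, smul_eq_mul, map_add, map_mul,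
        Polynomial.aeval_C, Polynomial.aeval_X, Algebra.algebraMap_self, RingHom.id_apply]
      ring
    rw [hq, ← Polynomial.coe_aeval_eq_eval, ← AlgHom.comp_apply, MvPolynomial.comp_aeval,
      MvPolynomial.aeval_eq_eval, hi]

/-- On the line from an interior zero `x₀` to an arbitrary `x`, the restricted polynomial has
infinitely many roots near `t = 0`; its value at `t = 1` is `g x`. -/
lemma polyFun_eq_zero {g : E d → ℝ} (hg : g ∈ polyFun d r) {U : Set (E d)}
    (hU : (interior U).Nonempty) (h : ∀ x ∈ interior U, g x = 0) : g = 0 := by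
  obtain ⟨x₀, hx₀⟩ := hU
  ext x
  obtain ⟨P, -, hP⟩ := polyFun_line hg x₀ (x - x₀)
  have hev : ∀ᶠ t in nhds (0 : ℝ), x₀ + t • (x - x₀) ∈ interior U := by
    have hc : ContinuousAt (fun s : ℝ => x₀ + s • (x - x₀)) 0 := by fun_prop
    exact hc.eventually_mem (isOpen_interior.mem_nhds (by simpa using hx₀))
  have hP0 : P = 0 := by
    refine Polynomial.eq_zero_of_infinite_isRoot P ((infinite_of_mem_nhds (0 : ℝ) hev).mono ?_)
    intro t ht
    show P.eval t = 0
    rw [← hP, h _ ht]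
  have := hP 1
  rw [hP0, one_smul, add_sub_cancel, Polynomial.eval_zero] at this
  exact this

instance polyFun_finite : FiniteDimensional ℝ (polyFun d r) := by
  have : polyFun d r = (MvPolynomial.restrictTotalDegree (Fin d) ℝ r).map
      ({ toFun := fun q x => MvPolynomial.eval (fun i => x i) q
         map_add' := fun _ _ => by ext; simp
         map_smul' := fun _ _ => by ext; simp } :
        MvPolynomial (Fin d) ℝ →ₗ[ℝ] (E d → ℝ)) := by
    ext g
    constructor
    · rintro ⟨q, hq, h⟩
      exact ⟨q, (MvPolynomial.mem_restrictTotalDegree _ _ _).2 hq, (funext h).symm⟩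
    · rintro ⟨q, hq, rfl⟩
      exact ⟨q, (MvPolynomial.mem_restrictTotalDegree _ _ _).1 hq, fun x => rfl⟩
  rw [this]
  infer_instance

end polyFun

/-! ### The discrete trace inequality on a polytope -/

/-- The surface measure is in general not locally finite on `ℝ^d`, so the criterion for compact sets
is applied to its restriction to `S`, which is finite. -/
lemma integrableOn_of_isCompact {X V : Type*} [TopologicalSpace X] [T2Space X] [MeasurableSpace X]
    [OpensMeasurableSpace X] [NormedAddCommGroup V] {μ : Measure X} {S : Set X}
    (hS : IsCompact S) (hμ : μ S < ⊤) {g : X → V} (hg : Continuous g) : IntegrableOn g S μ := by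
  have : Fact (μ S < ⊤) := ⟨hμ⟩
  have h : IntegrableOn g S (μ.restrict S) := hg.continuousOn.integrableOn_compact hS
  rwa [IntegrableOn, Measure.restrict_restrict hS.measurableSet, inter_self] at h

/-- Continuous functions are integrable on facets. -/
lemma ConeBase.integrableOn {d : ℕ} {x₀ : E d} {S : Set (E d)} {n : E d} {b : ℝ}
    (h : ConeBase x₀ S n b) {V : Type*} [NormedAddCommGroup V] {g : E d → V} (hg : Continuous g) :
    IntegrableOn g S (Measure.euclideanHausdorffMeasure (d - 1)) :=
  integrableOn_of_isCompact h.compact h.surface_lt_top hg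

/-- The one-variable bound at the end point `t = 1` of each ray is integrated over the facet. The
cone formula carries the factor `b i - ⟪n i, x₀⟫`, which is at least the radius `δ` of the inscribed
ball. -/
lemma FacetList.trace_le {d r : ℕ} {K : Set (E d)} {I : Type*} [Fintype I] {S : I → Set (E d)}
    {n : I → E d} {b : I → ℝ} (h : FacetList K S n b) (hd : 1 ≤ d) {C : ℝ}
    (hCP : ∀ P : Polynomial ℝ, P.natDegree ≤ r →
      P.eval 1 ^ 2 ≤ C * ∫ t in (0 : ℝ)..1, t ^ (d - 1) * P.eval t ^ 2)
    {x₀ : E d} {δ : ℝ} (hδ : 0 < δ) (hball : Metric.closedBall x₀ δ ⊆ K) {g : E d → ℝ}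
    (hg : g ∈ polyFun d r) :
    δ * ∑ i, surfInt (S i) (fun x => g x ^ 2) ≤ C * ∫ x in K, g x ^ 2 := by
  have hgc : Continuous g := (polyFun_contDiff hg).continuous
  have hx₀ : x₀ ∈ interior K := mem_interior.2
    ⟨_, Metric.ball_subset_closedBall.trans hball, Metric.isOpen_ball, Metric.mem_ball_self hδ⟩
  have hc2 : Continuous fun x => g x ^ 2 := by fun_prop
  rw [h.setIntegral_eq_sum hx₀ hd hc2, Finset.mul_sum, Finset.mul_sum]
  refine Finset.sum_le_sum fun i _ => ?_
  have hcb := h.coneBase hx₀ i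
  have hδi : δ ≤ b i - ⟪n i, x₀⟫ := by
    linarith [add_radius_le (h.norm_eq i) hδ.le hball (h.le i)]
  have hle : surfInt (S i) (fun x => g x ^ 2) ≤ C * surfInt (S i) (fun y =>
      ∫ t in (0 : ℝ)..1, t ^ (d - 1) * g (x₀ + t • (y - x₀)) ^ 2) := by
    rw [surfInt, surfInt, ← integral_const_mul]
    refine setIntegral_mono (hcb.integrableOn hc2) ((hcb.integrableOn_ray hc2).const_mul C)
      fun y => ?_
    obtain ⟨P, hPd, hP⟩ := polyFun_line hg x₀ (y - x₀)
    have h1 := hP 1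
    rw [one_smul, add_sub_cancel] at h1
    simp only [h1, hP]
    exact hCP P hPd
  have hnn : 0 ≤ surfInt (S i) (fun x => g x ^ 2) := integral_nonneg fun x => sq_nonneg _
  calc δ * surfInt (S i) (fun x => g x ^ 2)
      ≤ (b i - ⟪n i, x₀⟫) * surfInt (S i) (fun x => g x ^ 2) :=
        mul_le_mul_of_nonneg_right hδi hnn
    _ ≤ (b i - ⟪n i, x₀⟫) * (C * surfInt (S i) (fun y =>
      ∫ t in (0 : ℝ)..1, t ^ (d - 1) * g (x₀ + t • (y - x₀)) ^ 2)) :=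
        mul_le_mul_of_nonneg_left hle (hδ.le.trans hδi)
    _ = _ := by ring

namespace Mesh

variable {d : ℕ} {O : Set (E d)} (m : Mesh O)

/-! ### Cells and faces -/

lemma isCompact_cell (K : m.Cell) : IsCompact (m.cell K) := (m.cell_polytope K).isCompact

lemma convex_cell (K : m.Cell) : Convex ℝ (m.cell K) := (m.cell_polytope K).convex

lemma integrableOn_cell (K : m.Cell) {V : Type*} [NormedAddCommGroup V] {g : E d → V}
    (hg : Continuous g) : IntegrableOn g (m.cell K) :=
  hg.continuousOn.integrableOn_compact (m.isCompact_cell K)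

lemma isCompact_face (F : m.Face) : IsCompact (m.face F) := by
  obtain ⟨-, -, b, -, hS⟩ := m.fst_facet F
  rw [hS]
  exact (m.isCompact_cell _).inter_right (isClosed_eq (by fun_prop) continuous_const)

lemma one_le_dim (F : m.Face) : 1 ≤ d := by
  have := (m.fst_facet F).2.1
  omega

lemma surface_face_lt_top (F : m.Face) :
    Measure.euclideanHausdorffMeasure (d - 1) (m.face F) < ⊤ := by
  obtain ⟨hn, -, b, -, hS⟩ := m.fst_facet F
  exact surface_lt_top (m.one_le_dim F) hn (b := b) (by rw [hS]; exact fun x hx => hx.2)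
    (m.isCompact_face F).isBounded

lemma surface_face_pos (hd : 2 ≤ d) (F : m.Face) :
    0 < Measure.euclideanHausdorffMeasure (d - 1) (m.face F) := by
  obtain ⟨hn, hdim, b, -, hS⟩ := m.fst_facet F
  refine surface_pos hd hn (b := b) (by rw [hS]; exact fun x hx => hx.2) ?_ hdim
  rw [hS]
  exact (m.convex_cell _).inter
    (convex_hyperplane (innerSL ℝ (m.normal F)).toLinearMap.isLinear _)

lemma integrableOn_face (F : m.Face) {V : Type*} [NormedAddCommGroup V] {g : E d → V}
    (hg : Continuous g) :
    IntegrableOn g (m.face F) (Measure.euclideanHausdorffMeasure (d - 1)) :=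
  integrableOn_of_isCompact (m.isCompact_face F) (m.surface_face_lt_top F) hg

lemma face_nonempty (hd : 2 ≤ d) (F : m.Face) : (m.face F).Nonempty :=
  nonempty_of_measure_ne_zero (m.surface_face_pos hd F).ne'

lemma hF_pos (hd : 2 ≤ d) (F : m.Face) : 0 < m.hF F :=
  Real.rpow_pos_of_pos
    (ENNReal.toReal_pos (m.surface_face_pos hd F).ne' (m.surface_face_lt_top F).ne) _

/-- Otherwise one cell would lie on both sides of the hyperplane of `F`, contrary to its having
interior points. -/
lemma snd_ne_fst (hd : 2 ≤ d) (F : m.Face) : m.snd F ≠ some (m.fst F) := by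
  intro h
  obtain ⟨hn, -, b, hb, hS⟩ := m.fst_facet F
  obtain ⟨-, -, b', hb', hS'⟩ := m.snd_facet F _ h
  obtain ⟨y, hy⟩ := m.face_nonempty hd F
  have h1 : ⟪m.normal F, y⟫ = b := by rw [hS] at hy; exact hy.2
  have h2 : ⟪-m.normal F, y⟫ = b' := by rw [hS'] at hy; exact hy.2
  obtain ⟨x, hx⟩ := m.cell_interior (m.fst F)
  have h3 := inner_lt_of_mem_interior (by intro h0; simp [h0] at hn) hx hb
  have h4 := hb' x (interior_subset hx)
  rw [inner_neg_left] at h2 h4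
  linarith

/-- The outward normal of the cell `K` on its face `F`. -/
def outNormal (K : m.Cell) (F : m.Face) : E d :=
  open Classical in if m.fst F = K then m.normal F else -m.normal F

lemma isFacet_outNormal (K : m.Cell) {F : m.Face} (hF : m.fst F = K ∨ m.snd F = some K) :
    IsFacet (m.cell K) (m.face F) (m.outNormal K F) := by
  unfold outNormal
  split_ifs with h
  · exact h ▸ m.fst_facet F
  · exact m.snd_facet F K (hF.resolve_left h)

/-- The faces of a cell. -/
abbrev FaceOf (K : m.Cell) := {F // m.fst F = K ∨ m.snd F = some K}

instance (K : m.Cell) : Fintype (m.FaceOf K) := Fintype.ofFinite _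

/-- The facets of a cell are its faces. -/
lemma exists_facetList (K : m.Cell) : ∃ b : m.FaceOf K → ℝ,
    FacetList (m.cell K) (fun F : m.FaceOf K => m.face F)
      (fun F => m.outNormal K F) b := by
  choose b hb using fun F : m.FaceOf K =>
    (m.isFacet_outNormal K F.2).2.2
  exact ⟨b, {
    polytope := m.cell_polytope K
    norm_eq := fun F => (m.isFacet_outNormal K F.2).1
    finrank_eq := fun F => (m.isFacet_outNormal K F.2).2.1
    le := fun F => (hb F).1
    eq := fun F => (hb F).2
    injective := fun F G h => Subtype.ext (m.face_injective h)
    complete := fun S n h => by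
      obtain ⟨F, hF, hK⟩ := m.facet_mem K S n h
      exact ⟨⟨F, hK⟩, hF⟩ }⟩

open Classical in
/-- A sum over all faces of all cells counts each face once from each side. -/
lemma sum_cells_faces (hd : 2 ≤ d) (φ : m.Cell → m.Face → ℝ) :
    ∑ K, ∑ F : m.FaceOf K, φ K F =
      ∑ F, (φ (m.fst F) F + (m.snd F).elim 0 fun K => φ K F) := by
  have h1 : ∀ K, ∑ F : m.FaceOf K, φ K F =
      ∑ F, ((if m.fst F = K then φ K F else 0) + if m.snd F = some K then φ K F else 0) := by
    intro K
    rw [← Finset.sum_subtype (Finset.univ.filter fun F => m.fst F = K ∨ m.snd F = some K)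
      (by simp) (φ K), Finset.sum_filter]
    refine Finset.sum_congr rfl fun F _ => ?_
    have hne := m.snd_ne_fst hd F
    by_cases h1 : m.fst F = K
    · have h2 : m.snd F ≠ some K := by rwa [← h1]
      simp [h1, h2]
    · simp [h1]
  simp_rw [h1]
  rw [Finset.sum_comm]
  refine Finset.sum_congr rfl fun F _ => ?_
  rw [Finset.sum_add_distrib]
  congr 1
  · simp
  · cases h : m.snd F with
    | none => simp
    | some L => simp

lemma continuous_outer {V : Type*} [NormedAddCommGroup V] [Module ℝ V]
    {w : m.Cell → E d → V} (hw : ∀ K, Continuous (w K)) (F : m.Face) :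
    Continuous (m.outer w F) := by
  unfold outer
  cases m.snd F with
  | none => exact continuous_const
  | some K => exact hw K

lemma continuous_jump {V : Type*} [NormedAddCommGroup V] [Module ℝ V]
    {w : m.Cell → E d → V} (hw : ∀ K, Continuous (w K)) (F : m.Face) :
    Continuous (m.jump w F) :=
  (hw _).sub (m.continuous_outer hw F)

lemma continuous_avg {V : Type*} [NormedAddCommGroup V] [NormedSpace ℝ V]
    {w : m.Cell → E d → V} (hw : ∀ K, Continuous (w K)) (F : m.Face) :
    Continuous (m.avg w F) := by
  unfold avg
  cases m.snd F with
  | none => exact hw _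
  | some K => exact ((hw _).add (hw K)).const_smul (1 / 2 : ℝ)

/-- The divergence theorem, summed over all cells. -/
lemma sum_setIntegral_fderiv (hd : 2 ≤ d) {g : m.Scal} (hg : ∀ K, ContDiff ℝ 1 (g K)) (v : E d) :
    ∑ K, ∫ x in m.cell K, fderiv ℝ (g K) x v =
      ∑ F, ⟪m.normal F, v⟫ * surfInt (m.face F) (m.jump g F) := by
  have h1 : ∀ K, ∫ x in m.cell K, fderiv ℝ (g K) x v =
      ∑ F : m.FaceOf K,
        ⟪m.outNormal K F, v⟫ * surfInt (m.face F) (g K) := by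
    intro K
    obtain ⟨b, hb⟩ := m.exists_facetList K
    exact hb.setIntegral_fderiv (m.cell_interior K) (by omega) (hg K) v
  simp_rw [h1]
  rw [m.sum_cells_faces hd fun K F => ⟪m.outNormal K F, v⟫ * surfInt (m.face F) (g K)]
  refine Finset.sum_congr rfl fun F _ => ?_
  have hgc : ∀ K, Continuous (g K) := fun K => (hg K).continuous
  have hj : surfInt (m.face F) (m.jump g F) =
      surfInt (m.face F) (g (m.fst F)) - surfInt (m.face F) (m.outer g F) :=
    integral_sub (m.integrableOn_face F (hgc _)) (m.integrableOn_face F (m.continuous_outer hgc F))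
  rw [hj]
  have h2 : m.outNormal (m.fst F) F = m.normal F := if_pos rfl
  have h3 : ((m.snd F).elim 0 fun K => ⟪m.outNormal K F, v⟫ * surfInt (m.face F) (g K)) =
      -(⟪m.normal F, v⟫ * surfInt (m.face F) (m.outer g F)) := by
    have hne := m.snd_ne_fst hd F
    unfold outer
    cases h : m.snd F with
    | none => simp [surfInt]
    | some K =>
      have : m.outNormal K F = -m.normal F := if_neg fun h' => hne (by rw [h, h'])
      simp [this, inner_neg_left]
  rw [h2, h3]
  ring

/-! ### Trace inequality on shape-regular meshes -/

/-- The face lies in a ball of radius `diam K` in its hyperplane; the `(d - 1)`-th root of the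
resulting measure bound gives the claim. -/
lemma hF_le {F : m.Face} (hd : 2 ≤ d) {K : m.Cell} (hF : m.fst F = K ∨ m.snd F = some K) :
    m.hF F ≤ Metric.diam (m.cell K) *
      (volume.real (Metric.closedBall (0 : E (d - 1)) 1)) ^ (1 / ((d : ℝ) - 1)) := by
  obtain ⟨hn, -, b, -, hS⟩ := m.isFacet_outNormal K hF
  have hsub : m.face F ⊆ m.cell K := by rw [hS]; exact sep_subset _ _
  have hle := surface_le (by omega) hn (b := b) (S := m.face F)
    (by rw [hS]; exact fun x hx => hx.2) (m.isCompact_face F).isBounded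
  have hd1 : (0 : ℝ) < (d : ℝ) - 1 := by
    have : (2 : ℝ) ≤ d := by exact_mod_cast hd
    linarith
  have hreal : (Measure.euclideanHausdorffMeasure (d - 1) : Measure (E d)).real (m.face F) ≤
      Metric.diam (m.cell K) ^ (d - 1) * volume.real (Metric.closedBall (0 : E (d - 1)) 1) := by
    refine (ENNReal.toReal_mono (ENNReal.mul_lt_top ENNReal.ofReal_lt_top
      (isCompact_closedBall _ _).measure_lt_top).ne hle).trans ?_
    rw [ENNReal.toReal_mul, ENNReal.toReal_ofReal (pow_nonneg Metric.diam_nonneg _)]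
    refine mul_le_mul_of_nonneg_right (pow_le_pow_left₀ Metric.diam_nonneg ?_ _) (by positivity)
    exact Metric.diam_mono hsub (m.isCompact_cell K).isBounded
  refine (Real.rpow_le_rpow (by positivity) hreal (by positivity)).trans_eq ?_
  rw [Real.mul_rpow (pow_nonneg Metric.diam_nonneg _) (by positivity)]
  congr 1
  have : ((d - 1 : ℕ) : ℝ) = (d : ℝ) - 1 := by
    rw [Nat.cast_sub (by omega)]; simp
  rw [← Real.rpow_natCast, ← Real.rpow_mul Metric.diam_nonneg, this, mul_one_div_cancel hd1.ne',
    Real.rpow_one]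

/-- A cell of a shape-regular mesh contains a ball of comparable size. -/
lemma exists_closedBall_subset (hd : 2 ≤ d) {ρ : ℝ} (hm : m.ShapeRegular ρ)
    (K : m.Cell) : ∃ x₀ : E d, ∃ δ > 0, Metric.closedBall x₀ δ ⊆ m.cell K ∧
      Metric.diam (m.cell K) ≤ 2 * ρ * δ := by
  have hbdd : BddAbove {r : ℝ | 0 ≤ r ∧ ∃ x, Metric.closedBall x r ⊆ m.cell K} := by
    refine ⟨Metric.diam (m.cell K), ?_⟩
    rintro r ⟨hr, x, hx⟩
    let e : E d := EuclideanSpace.single ⟨0, by omega⟩ 1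
    have he : ‖e‖ = 1 := by simp [e]
    have h1 : x + r • e ∈ m.cell K := hx (by simp [norm_smul, he, abs_of_nonneg hr])
    have h2 : x ∈ m.cell K := hx (Metric.mem_closedBall_self hr)
    have := Metric.dist_le_diam_of_mem (m.isCompact_cell K).isBounded h1 h2
    simpa [norm_smul, he, abs_of_nonneg hr] using this
  have hpos : 0 < inradius (m.cell K) := by
    obtain ⟨x, hx⟩ := m.cell_interior K
    obtain ⟨r, hr, hball⟩ :=
      Metric.nhds_basis_closedBall.mem_iff.1 (mem_interior_iff_mem_nhds.1 hx)
    exact hr.trans_le (le_csSup hbdd ⟨hr.le, x, hball⟩)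
  obtain ⟨x, hx⟩ := m.cell_interior K
  have hne : {r : ℝ | 0 ≤ r ∧ ∃ x, Metric.closedBall x r ⊆ m.cell K}.Nonempty :=
    ⟨0, le_rfl, x, by simpa using interior_subset hx⟩
  -- Half the inradius is used so that the supremum need not be attained; this is the source of the
  -- factor `2` in `2 * ρ * δ`.
  obtain ⟨r, ⟨-, x₀, hball⟩, hr⟩ := exists_lt_of_lt_csSup hne (half_lt_self hpos)
  refine ⟨x₀, inradius (m.cell K) / 2, by positivity,
    (Metric.closedBall_subset_closedBall hr.le).trans hball, ?_⟩
  have := hm K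
  rw [div_le_iff₀ hpos] at this
  linarith

end Mesh

/-- The discrete trace inequality, summed over all faces of a shape-regular mesh. -/
lemma exists_trace_constant {d : ℕ} (hd : 2 ≤ d) (r : ℕ) {ρ : ℝ} (hρ : 0 < ρ) :
    ∃ C > 0, ∀ (O : Set (E d)) (m : Mesh O), m.ShapeRegular ρ → ∀ g ∈ m.Ph r,
      ∑ F, m.hF F * (surfInt (m.face F) (fun x => g (m.fst F) x ^ 2) +
        surfInt (m.face F) fun x => m.outer g F x ^ 2) ≤
      C * ∑ K, ∫ x in m.cell K, g K x ^ 2 := by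
  obtain ⟨C₁, hC₁, hP⟩ := exists_eval_one_sq_le (d - 1) r
  set c := (volume.real (Metric.closedBall (0 : E (d - 1)) 1)) ^ (1 / ((d : ℝ) - 1)) with hc
  have hc0 : 0 < c := Real.rpow_pos_of_pos (ENNReal.toReal_pos
    (Metric.measure_closedBall_pos _ _ one_pos).ne' (isCompact_closedBall _ _).measure_lt_top.ne) _
  -- `hF ≤ c * diam K ≤ 2 * ρ * c * δ` for a ball of radius `δ` inside `K`, and `C₁` is the
  -- one-variable constant.
  refine ⟨2 * ρ * c * C₁, by positivity, fun O m hm g hg => ?_⟩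
  have hsum := m.sum_cells_faces hd fun K F => m.hF F * surfInt (m.face F) fun x => g K x ^ 2
  have hlhs : ∑ F, m.hF F * (surfInt (m.face F) (fun x => g (m.fst F) x ^ 2) +
        surfInt (m.face F) fun x => m.outer g F x ^ 2) =
      ∑ F, ((m.hF F * surfInt (m.face F) fun x => g (m.fst F) x ^ 2) +
        (m.snd F).elim 0 fun K => m.hF F * surfInt (m.face F) fun x => g K x ^ 2) := by
    refine Finset.sum_congr rfl fun F _ => ?_
    rw [mul_add]
    congr 1
    unfold Mesh.outer
    cases m.snd F with
    | none => simp [surfInt]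
    | some K => rfl
  rw [hlhs, ← hsum, Finset.mul_sum]
  refine Finset.sum_le_sum fun K _ => ?_
  obtain ⟨b, hb⟩ := m.exists_facetList K
  obtain ⟨x₀, δ, hδ, hball, hdiam⟩ := m.exists_closedBall_subset hd hm K
  have htr := hb.trace_le (by omega) hP hδ hball (hg K)
  calc ∑ F : m.FaceOf K,
        m.hF F * surfInt (m.face F) (fun x => g K x ^ 2)
      ≤ ∑ F : m.FaceOf K,
        (2 * ρ * c) * (δ * surfInt (m.face F) (fun x => g K x ^ 2)) := by
        refine Finset.sum_le_sum fun F _ => ?_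
        rw [← mul_assoc]
        refine mul_le_mul_of_nonneg_right ?_ (integral_nonneg fun x => sq_nonneg _)
        refine (m.hF_le hd F.2).trans ?_
        rw [← hc]
        nlinarith
    _ = 2 * ρ * c * (δ * ∑ F : m.FaceOf K,
          surfInt (m.face F) (fun x => g K x ^ 2)) := by
        rw [Finset.mul_sum, Finset.mul_sum]
    _ ≤ 2 * ρ * c * (C₁ * ∫ x in m.cell K, g K x ^ 2) :=
        mul_le_mul_of_nonneg_left htr (by positivity)
    _ = _ := by ring

namespace Mesh

variable {d : ℕ} {O : Set (E d)} (m : Mesh O) {r : ℕ}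

/-! ### Regularity of discrete functions -/

variable {m} in
lemma contDiff_of_mem_Mh {w : m.Vec} (hw : w ∈ m.Mh r) (K : m.Cell) : ContDiff ℝ 1 (w K) :=
  contDiff_euclidean.2 fun i => polyFun_contDiff (hw K i)

variable {m} in
lemma contDiff_of_mem_Ph {g : m.Scal} (hg : g ∈ m.Ph r) (K : m.Cell) : ContDiff ℝ 1 (g K) :=
  polyFun_contDiff (hg K)

variable {m} in
lemma continuous_of_mem_Mh {w : m.Vec} (hw : w ∈ m.Mh r) (K : m.Cell) : Continuous (w K) :=
  (contDiff_of_mem_Mh hw K).continuous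

variable {m} in
lemma continuous_of_mem_Ph {g : m.Scal} (hg : g ∈ m.Ph r) (K : m.Cell) : Continuous (g K) :=
  (contDiff_of_mem_Ph hg K).continuous

variable {m} in
lemma differentiable_of_mem_Mh {w : m.Vec} (hw : w ∈ m.Mh r) (K : m.Cell) :
    Differentiable ℝ (w K) :=
  (contDiff_of_mem_Mh hw K).differentiable one_ne_zero

variable {m} in
lemma continuous_jac {w : m.Vec} (hw : w ∈ m.Mh r) (K : m.Cell) : Continuous (m.jac w K) :=
  (contDiff_of_mem_Mh hw K).continuous_fderiv one_ne_zero

variable {m} in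
lemma continuous_grad {g : m.Scal} (hg : g ∈ m.Ph r) (K : m.Cell) : Continuous (m.grad g K) :=
  (InnerProductSpace.toDual ℝ (E d)).symm.continuous.comp
    ((contDiff_of_mem_Ph hg K).continuous_fderiv one_ne_zero)

lemma continuous_div {w : m.Vec} (hw : w ∈ m.Mh r) (K : m.Cell) : Continuous (div (w K)) :=
  continuous_finsetSum _ fun j _ => (EuclideanSpace.proj j : E d →L[ℝ] ℝ).continuous.comp
    ((continuous_jac hw K).clm_apply continuous_const)

lemma _root_.DGOldroyd.fderiv_coord {d : ℕ} {w : E d → E d} (hw : Differentiable ℝ w)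
    (x v : E d) (i : Fin d) : (fderiv ℝ w x v) i = fderiv ℝ (fun y => w y i) x v := by
  have h := (EuclideanSpace.proj i : E d →L[ℝ] ℝ).hasFDerivAt.comp x (hw x).hasFDerivAt
  have h2 : HasFDerivAt (fun y => w y i) _ x := h
  rw [h2.fderiv]
  rfl

variable {m} in
lemma coord_mem_Ph {w : m.Vec} (hw : w ∈ m.Mh r) (i : Fin d) : (fun K x => w K x i) ∈ m.Ph r :=
  fun K => hw K i

variable {m} in
lemma fderiv_mem_Ph {g : m.Scal} (hg : g ∈ m.Ph r) (v : E d) :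
    (fun K x => fderiv ℝ (g K) x v) ∈ m.Ph r :=
  fun K => polyFun_fderiv (hg K) v

variable {m} in
lemma fderiv_coord_mem_Ph {w : m.Vec} (hw : w ∈ m.Mh r) (v : E d) (i : Fin d) :
    (fun K x => (fderiv ℝ (w K) x v) i) ∈ m.Ph r := by
  have h := fderiv_mem_Ph (coord_mem_Ph hw i) v
  have h2 : (fun K x => (fderiv ℝ (w K) x v) i) =
      fun K x => fderiv ℝ (fun y => w K y i) x v := by
    ext K x
    exact fderiv_coord (differentiable_of_mem_Mh hw K) x v i
  rw [h2]
  exact h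

/-! ### Coercivity -/

/-- Absorption of the consistency terms on the faces. -/
lemma sum_surfInt_le (hd : 2 ≤ d) {C σ G : ℝ} (hC : 0 < C) (hσ : 4 * C ≤ σ) (hG : 0 ≤ G)
    (s : Finset m.Face) {f A J : m.Face → E d → ℝ} (hfc : ∀ F, Continuous (f F))
    (hAc : ∀ F, Continuous (A F)) (hJc : ∀ F, Continuous (J F)) (hA : ∀ F x, 0 ≤ A F x)
    (hJ : ∀ F x, 0 ≤ J F x) (hf : ∀ F x, f F x ^ 2 ≤ A F x * J F x)
    (htr : ∑ F ∈ s, m.hF F * surfInt (m.face F) (A F) ≤ C * G) :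
    ∑ F ∈ s, surfInt (m.face F) (f F) ≤
      1 / 4 * (G + ∑ F ∈ s, σ / m.hF F * surfInt (m.face F) (J F)) := by
  have hσ0 : 0 < σ := by linarith
  -- Young's inequality with weights balanced so that the jump part costs a quarter of the penalty
  -- term; the trace part then costs a quarter of `G` because `4 * C ≤ σ`.
  have h1 : ∀ F, surfInt (m.face F) (f F) ≤ σ⁻¹ * (m.hF F * surfInt (m.face F) (A F)) +
      1 / 4 * (σ / m.hF F * surfInt (m.face F) (J F)) := by
    intro F
    have hh := m.hF_pos hd F
    have : σ⁻¹ * (m.hF F * surfInt (m.face F) (A F)) +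
      1 / 4 * (σ / m.hF F * surfInt (m.face F) (J F)) =
      ∫ x in m.face F, (σ⁻¹ * m.hF F * A F x + 1 / 4 * (σ / m.hF F) * J F x)
        ∂(Measure.euclideanHausdorffMeasure (d - 1)) := by
      rw [integral_add ((m.integrableOn_face F (hAc F)).const_mul _)
        ((m.integrableOn_face F (hJc F)).const_mul _), integral_const_mul, integral_const_mul]
      simp only [surfInt]
      ring
    rw [this]
    refine setIntegral_mono (m.integrableOn_face F (hfc F))
      (m.integrableOn_face F (((hAc F).const_mul _).add ((hJc F).const_mul _))) fun x => ?_
    have e1 : 0 ≤ σ⁻¹ * m.hF F * A F x := mul_nonneg (by positivity) (hA F x)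
    have e2 : 0 ≤ 1 / 4 * (σ / m.hF F) * J F x := mul_nonneg (by positivity) (hJ F x)
    -- With `a` and `b` the two weighted terms, `f² ≤ A * J = 4 * a * b ≤ (a + b)²`.
    have e3 : (σ⁻¹ * m.hF F * A F x) * (1 / 4 * (σ / m.hF F) * J F x) =
        1 / 4 * (A F x * J F x) := by
      field_simp
    refine abs_le_of_sq_le_sq' ?_ (add_nonneg e1 e2) |>.2
    nlinarith [hf F x, sq_nonneg (σ⁻¹ * m.hF F * A F x - 1 / 4 * (σ / m.hF F) * J F x)]
  refine (Finset.sum_le_sum fun F _ => h1 F).trans ?_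
  rw [Finset.sum_add_distrib, ← Finset.mul_sum, ← Finset.mul_sum, mul_add]
  have h2 : σ⁻¹ * ∑ F ∈ s, m.hF F * surfInt (m.face F) (A F) ≤ 1 / 4 * G := by
    rw [inv_mul_le_iff₀ hσ0]
    nlinarith
  linarith

lemma _root_.DGOldroyd.norm_sq_apply_le {d : ℕ} (A : E d →L[ℝ] E d) {n : E d} (hn : ‖n‖ = 1) :
    ‖A n‖ ^ 2 ≤ ∑ j, ∑ i, (A (EuclideanSpace.single j 1) i) ^ 2 := by
  have hsum : n = ∑ j, n j • EuclideanSpace.single j (1 : ℝ) := by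
    simpa using ((EuclideanSpace.basisFun (Fin d) ℝ).sum_repr n).symm
  have hn2 : ∑ j, n j ^ 2 = 1 := by
    rw [← EuclideanSpace.real_norm_sq_eq, hn, one_pow]
  rw [EuclideanSpace.real_norm_sq_eq, Finset.sum_comm]
  refine Finset.sum_le_sum fun i _ => ?_
  have : A n i = ∑ j, n j * A (EuclideanSpace.single j 1) i := by
    conv_lhs => rw [hsum]
    simp
  rw [this]
  refine (Finset.sum_mul_sq_le_sq_mul_sq _ _ _).trans ?_
  rw [hn2, one_mul]

lemma _root_.DGOldroyd.gradDot_self {d : ℕ} (w : E d → E d) (x : E d) :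
    gradDot w w x = ∑ j, ∑ i, (fderiv ℝ w x (EuclideanSpace.single j 1) i) ^ 2 := by
  unfold gradDot
  simp [EuclideanSpace.real_norm_sq_eq]

/-- The operator norm is bounded by the Frobenius norm, and the square of an average by the sum of
squares. Since `outer` vanishes on boundary faces, one bound covers both kinds of face. -/
lemma norm_sq_avg_jac_le (w : m.Vec) (F : m.Face) (x : E d) :
    ‖m.avg (m.jac w) F x (m.normal F)‖ ^ 2 ≤ ∑ j, ∑ i,
      ((fderiv ℝ (w (m.fst F)) x (EuclideanSpace.single j 1) i) ^ 2 +
        m.outer (fun K x => (fderiv ℝ (w K) x (EuclideanSpace.single j 1)) i) F x ^ 2) := by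
  have hn := (m.fst_facet F).1
  simp only [Finset.sum_add_distrib]
  have h1 := norm_sq_apply_le (fderiv ℝ (w (m.fst F)) x) hn
  unfold avg outer jac
  cases m.snd F with
  | none => simpa using h1
  | some K =>
    have h2 := norm_sq_apply_le (fderiv ℝ (w K) x) hn
    simp only [Option.elim_some, smul_apply, add_apply,
      norm_smul]
    have h3 := norm_add_le (fderiv ℝ (w (m.fst F)) x (m.normal F)) (fderiv ℝ (w K) x (m.normal F))
    have h4 : ‖(1 / 2 : ℝ)‖ = 1 / 2 := by norm_num
    rw [h4, mul_pow]
    nlinarith [norm_nonneg (fderiv ℝ (w (m.fst F)) x (m.normal F) + fderiv ℝ (w K) x (m.normal F)),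
      sq_nonneg (‖fderiv ℝ (w (m.fst F)) x (m.normal F)‖ - ‖fderiv ℝ (w K) x (m.normal F)‖),
      norm_nonneg (fderiv ℝ (w (m.fst F)) x (m.normal F)),
      norm_nonneg (fderiv ℝ (w K) x (m.normal F))]

lemma inner_gradient_eq (g : E d → ℝ) (x v : E d) : ⟪gradient g x, v⟫ = fderiv ℝ g x v := by
  simp [gradient]

lemma norm_sq_gradient (g : E d → ℝ) (x : E d) :
    ‖gradient g x‖ ^ 2 = ∑ j, (fderiv ℝ g x (EuclideanSpace.single j 1)) ^ 2 := by
  rw [EuclideanSpace.real_norm_sq_eq]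
  refine Finset.sum_congr rfl fun j _ => ?_
  rw [← inner_gradient_eq, EuclideanSpace.inner_single_right]
  simp

lemma sq_avg_grad_le (g : m.Scal) (F : m.Face) (x : E d) :
    ⟪m.avg (m.grad g) F x, m.normal F⟫ ^ 2 ≤ ∑ j,
      ((fderiv ℝ (g (m.fst F)) x (EuclideanSpace.single j 1)) ^ 2 +
        m.outer (fun K x => fderiv ℝ (g K) x (EuclideanSpace.single j 1)) F x ^ 2) := by
  have hn := (m.fst_facet F).1
  have key : ∀ g : E d → ℝ, ⟪gradient g x, m.normal F⟫ ^ 2 ≤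
      ∑ j, (fderiv ℝ g x (EuclideanSpace.single j 1)) ^ 2 := by
    intro g
    rw [← norm_sq_gradient, ← sq_abs]
    have := abs_real_inner_le_norm (gradient g x) (m.normal F)
    rw [hn, mul_one] at this
    exact pow_le_pow_left₀ (abs_nonneg _) this 2
  simp only [Finset.sum_add_distrib]
  have h1 := key (g (m.fst F))
  unfold avg outer grad
  cases m.snd F with
  | none => simpa using h1
  | some K =>
    have h2 := key (g K)
    simp only [Option.elim_some, inner_smul_left, inner_add_left]
    have h4 : (starRingEnd ℝ) (1 / 2 : ℝ) = 1 / 2 := rfl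
    rw [h4, mul_pow]
    nlinarith [sq_nonneg (⟪gradient (g (m.fst F)) x, m.normal F⟫ - ⟪gradient (g K) x, m.normal F⟫),
      sq_nonneg ⟪gradient (g (m.fst F)) x, m.normal F⟫, sq_nonneg ⟪gradient (g K) x, m.normal F⟫]

lemma surfInt_sq_add {g : m.Scal} (hg : g ∈ m.Ph r) (F : m.Face) :
    surfInt (m.face F) (fun x => g (m.fst F) x ^ 2 + m.outer g F x ^ 2) =
      surfInt (m.face F) (fun x => g (m.fst F) x ^ 2) +
        surfInt (m.face F) fun x => m.outer g F x ^ 2 :=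
  integral_add (m.integrableOn_face F ((continuous_of_mem_Ph hg _).pow 2))
    (m.integrableOn_face F ((m.continuous_outer (continuous_of_mem_Ph hg) F).pow 2))

lemma normSqVec_nonneg (hd : 2 ≤ d) {σ : ℝ} (hσ : 0 < σ) (w : m.Vec) : 0 ≤ m.normSqVec σ w := by
  refine add_nonneg (Finset.sum_nonneg fun K _ => integral_nonneg fun x => ?_)
    (Finset.sum_nonneg fun F _ => mul_nonneg (div_pos hσ (m.hF_pos hd F)).le
      (integral_nonneg fun x => sq_nonneg _))
  rw [gradDot_self]
  exact Finset.sum_nonneg fun j _ => Finset.sum_nonneg fun i _ => sq_nonneg _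

/-- For `ε = 1` the consistency terms cancel and coercivity is an identity; otherwise the factor `1
- ε` is `1` or `2`, and a quarter of the norm squared may be lost each time. -/
lemma Aeps_self (ε σ : ℝ) (w : m.Vec) : m.Aeps ε σ w w = m.normSqVec σ w - (1 - ε) *
    ∑ F, surfInt (m.face F) fun x => ⟪m.avg (m.jac w) F x (m.normal F), m.jump w F x⟫ := by
  unfold Aeps normSqVec
  simp only [real_inner_self_eq_norm_sq]
  ring

lemma Asip_self (σ : ℝ) (g : m.Scal) : m.Asip σ g g = m.normSqScal σ g - 2 *
    ∑ F ∈ m.intFaces, surfInt (m.face F) fun x =>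
      ⟪m.avg (m.grad g) F x, m.normal F⟫ * m.jump g F x := by
  unfold Asip normSqScal
  simp only [real_inner_self_eq_norm_sq, sq]
  ring

end Mesh

/-- Coercivity of the interior penalty form of the velocity. -/
theorem exists_coerciveVel {d : ℕ} (hd : 2 ≤ d) (r : ℕ) {ρ : ℝ} (hρ : 0 < ρ) :
    ∃ σ₀ > 0, ∀ (O : Set (E d)) (m : Mesh O), m.ShapeRegular ρ →
      ∀ ε, ε = -1 ∨ ε = 0 → ∀ σ ≥ σ₀, m.CoerciveVel r ε σ := by
  obtain ⟨C, hC, htr⟩ := exists_trace_constant hd r hρ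
  refine ⟨4 * C, by positivity, fun O m hm ε hε σ hσ w hw => ?_⟩
  have hσ0 : 0 < σ := by linarith
  have hω : omega ε = 1 / 2 := by
    rw [omega, if_neg]
    rcases hε with rfl | rfl <;> norm_num
  -- The entries of the broken Jacobian are scalar piecewise polynomials, so the scalar trace
  -- inequality applies entrywise.
  let g : Fin d → Fin d → m.Scal := fun j i K x =>
    fderiv ℝ (w K) x (EuclideanSpace.single j 1) i
  have hg : ∀ j i, g j i ∈ m.Ph r := fun j i => Mesh.fderiv_coord_mem_Ph hw _ i
  have hgc := fun j i => Mesh.continuous_of_mem_Ph (hg j i)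
  have hGeq : ∑ K, ∫ x in m.cell K, gradDot (w K) (w K) x =
      ∑ j, ∑ i, ∑ K, ∫ x in m.cell K, g j i K x ^ 2 := by
    rw [Finset.sum_congr rfl fun j _ => Finset.sum_comm, Finset.sum_comm]
    refine Finset.sum_congr rfl fun K _ => ?_
    simp only [gradDot_self]
    rw [integral_finsetSum _ fun j _ => ?_]
    · refine Finset.sum_congr rfl fun j _ => ?_
      rw [integral_finsetSum _ fun i _ => ?_]
      exact m.integrableOn_cell K ((hgc j i K).pow 2)
    · exact m.integrableOn_cell K (continuous_finsetSum _ fun i _ => (hgc j i K).pow 2)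
  have hG0 : 0 ≤ ∑ K, ∫ x in m.cell K, gradDot (w K) (w K) x := by
    rw [hGeq]
    exact Finset.sum_nonneg fun j _ => Finset.sum_nonneg fun i _ => Finset.sum_nonneg fun K _ =>
      integral_nonneg fun x => sq_nonneg _
  have hwc := Mesh.continuous_of_mem_Mh hw
  have hjc := fun F => m.continuous_jump hwc F
  have hac := fun F => m.continuous_avg (Mesh.continuous_jac hw) F
  have hcA : ∀ F j i, Continuous fun x => g j i (m.fst F) x ^ 2 + m.outer (g j i) F x ^ 2 :=
    fun F j i => ((hgc j i _).pow 2).add ((m.continuous_outer (hgc j i) F).pow 2)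
  have hA : ∀ F x, 0 ≤ ∑ j, ∑ i, (g j i (m.fst F) x ^ 2 + m.outer (g j i) F x ^ 2) := fun F x =>
    Finset.sum_nonneg fun j _ => Finset.sum_nonneg fun i _ => by positivity
  have hS := m.sum_surfInt_le hd hC hσ hG0 Finset.univ
    (f := fun F x => ⟪m.avg (m.jac w) F x (m.normal F), m.jump w F x⟫)
    (A := fun F x => ∑ j, ∑ i, (g j i (m.fst F) x ^ 2 + m.outer (g j i) F x ^ 2))
    (J := fun F x => ‖m.jump w F x‖ ^ 2)
    (fun F => ((hac F).clm_apply continuous_const).inner (hjc F))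
    (fun F => continuous_finsetSum _ fun j _ => continuous_finsetSum _ fun i _ => hcA F j i)
    (fun F => (hjc F).norm.pow 2) hA (fun F x => sq_nonneg _) (fun F x => ?_) ?_
  · rw [hω, m.Aeps_self]
    have hN := m.normSqVec_nonneg hd hσ0 w
    change _ ≤ 1 / 4 * m.normSqVec σ w at hS
    -- For `ε = -1` exactly half the norm squared remains; for `ε = 0` three quarters remain, and
    -- nonnegativity of the norm reduces this to one half.
    rcases hε with rfl | rfl <;> linarith
  · refine le_trans ?_ (mul_le_mul_of_nonneg_right (m.norm_sq_avg_jac_le w F x) (sq_nonneg _))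
    rw [← mul_pow, ← sq_abs]
    exact pow_le_pow_left₀ (abs_nonneg _) (abs_real_inner_le_norm _ _) 2
  · have h1 : ∀ F, surfInt (m.face F) (fun x =>
        ∑ j, ∑ i, (g j i (m.fst F) x ^ 2 + m.outer (g j i) F x ^ 2)) =
        ∑ j, ∑ i, (surfInt (m.face F) (fun x => g j i (m.fst F) x ^ 2) +
          surfInt (m.face F) fun x => m.outer (g j i) F x ^ 2) := by
      intro F
      simp only [← m.surfInt_sq_add (hg _ _)]
      unfold surfInt
      rw [integral_finsetSum _ fun j _ => ?_]
      · refine Finset.sum_congr rfl fun j _ => ?_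
        rw [integral_finsetSum _ fun i _ => ?_]
        exact m.integrableOn_face F (hcA F j i)
      · exact m.integrableOn_face F (continuous_finsetSum _ fun i _ => hcA F j i)
    simp only [h1, Finset.mul_sum, hGeq]
    rw [Finset.sum_comm]
    refine Finset.sum_le_sum fun j _ => ?_
    rw [Finset.sum_comm]
    refine Finset.sum_le_sum fun i _ => ?_
    rw [← Finset.mul_sum]
    exact htr O m hm (g j i) (hg j i)

/-- Coercivity of the interior penalty form of the pressure. -/
theorem exists_coerciveSip {d : ℕ} (hd : 2 ≤ d) (r : ℕ) {ρ : ℝ} (hρ : 0 < ρ) :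
    ∃ σ₀ > 0, ∀ (O : Set (E d)) (m : Mesh O), m.ShapeRegular ρ →
      ∀ σ ≥ σ₀, m.CoerciveSip r σ := by
  obtain ⟨C, hC, htr⟩ := exists_trace_constant hd r hρ
  refine ⟨4 * C, by positivity, fun O m hm σ hσ p hp => ?_⟩
  let g : Fin d → m.Scal := fun j K x => fderiv ℝ (p K) x (EuclideanSpace.single j 1)
  have hg : ∀ j, g j ∈ m.Ph r := fun j => Mesh.fderiv_mem_Ph hp _
  have hgc := fun j => Mesh.continuous_of_mem_Ph (hg j)
  have hGeq : ∑ K, ∫ x in m.cell K, ‖m.grad p K x‖ ^ 2 =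
      ∑ j, ∑ K, ∫ x in m.cell K, g j K x ^ 2 := by
    rw [Finset.sum_comm]
    refine Finset.sum_congr rfl fun K _ => ?_
    simp only [Mesh.grad, Mesh.norm_sq_gradient]
    rw [integral_finsetSum _ fun j _ => ?_]
    exact m.integrableOn_cell K ((hgc j K).pow 2)
  have hG0 : 0 ≤ ∑ K, ∫ x in m.cell K, ‖m.grad p K x‖ ^ 2 :=
    Finset.sum_nonneg fun K _ => integral_nonneg fun x => sq_nonneg _
  have hpc := Mesh.continuous_of_mem_Ph hp
  have hjc := fun F => m.continuous_jump hpc F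
  have hac := fun F => m.continuous_avg (Mesh.continuous_grad hp) F
  have hcA : ∀ F j, Continuous fun x => g j (m.fst F) x ^ 2 + m.outer (g j) F x ^ 2 :=
    fun F j => ((hgc j _).pow 2).add ((m.continuous_outer (hgc j) F).pow 2)
  have hA : ∀ F x, 0 ≤ ∑ j, (g j (m.fst F) x ^ 2 + m.outer (g j) F x ^ 2) := fun F x =>
    Finset.sum_nonneg fun j _ => by positivity
  have hS := m.sum_surfInt_le hd hC hσ hG0 m.intFaces
    (f := fun F x => ⟪m.avg (m.grad p) F x, m.normal F⟫ * m.jump p F x)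
    (A := fun F x => ∑ j, (g j (m.fst F) x ^ 2 + m.outer (g j) F x ^ 2))
    (J := fun F x => m.jump p F x ^ 2)
    (fun F => ((hac F).inner continuous_const).mul (hjc F))
    (fun F => continuous_finsetSum _ fun j _ => hcA F j)
    (fun F => (hjc F).pow 2) hA (fun F x => sq_nonneg _) (fun F x => ?_) ?_
  · rw [m.Asip_self]
    change _ ≤ 1 / 4 * m.normSqScal σ p at hS
    linarith
  · rw [mul_pow]
    exact mul_le_mul_of_nonneg_right (m.sq_avg_grad_le p F x) (sq_nonneg _)
  · have h1 : ∀ F, surfInt (m.face F) (fun x =>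
        ∑ j, (g j (m.fst F) x ^ 2 + m.outer (g j) F x ^ 2)) =
        ∑ j, (surfInt (m.face F) (fun x => g j (m.fst F) x ^ 2) +
          surfInt (m.face F) fun x => m.outer (g j) F x ^ 2) := by
      intro F
      simp only [← m.surfInt_sq_add (hg _)]
      unfold surfInt
      rw [integral_finsetSum _ fun j _ => ?_]
      exact m.integrableOn_face F (hcA F j)
    -- The trace inequality sums over all faces; the additional boundary terms are nonnegative.
    have h2 : ∑ F ∈ m.intFaces, m.hF F * surfInt (m.face F) (fun x =>
        ∑ j, (g j (m.fst F) x ^ 2 + m.outer (g j) F x ^ 2)) ≤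
        ∑ F, m.hF F * surfInt (m.face F) (fun x =>
          ∑ j, (g j (m.fst F) x ^ 2 + m.outer (g j) F x ^ 2)) :=
      Finset.sum_le_univ_sum_of_nonneg fun F => mul_nonneg (m.hF_pos hd F).le
        (integral_nonneg (hA F))
    refine h2.trans ?_
    simp only [h1, Finset.mul_sum, hGeq]
    rw [Finset.sum_comm]
    refine Finset.sum_le_sum fun j _ => ?_
    rw [← Finset.mul_sum]
    exact htr O m hm (g j) (hg j)

/-! ### Consequences of the divergence theorem -/

namespace Mesh

variable {d : ℕ} {O : Set (E d)} (m : Mesh O) {r : ℕ}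

lemma outer_coord (W : m.Vec) (F : m.Face) (x : E d) (j : Fin d) :
    m.outer W F x j = m.outer (fun K y => W K y j) F x := by
  unfold outer
  cases m.snd F <;> rfl

/-- The divergence theorem for broken vector fields. -/
lemma sum_setIntegral_div (hd : 2 ≤ d) {W : m.Vec} (hW : ∀ K, ContDiff ℝ 1 (W K)) :
    ∑ K, ∫ x in m.cell K, div (W K) x =
      ∑ F, surfInt (m.face F) fun x => ⟪m.normal F, m.jump W F x⟫ := by
  have hWj : ∀ j K, ContDiff ℝ 1 fun x => W K x j := fun j K => contDiff_euclidean.1 (hW K) j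
  have h1 : ∀ K, ∫ x in m.cell K, div (W K) x =
      ∑ j, ∫ x in m.cell K, fderiv ℝ (fun y => W K y j) x (EuclideanSpace.single j 1) := by
    intro K
    simp only [div, fderiv_coord ((hW K).differentiable one_ne_zero)]
    refine integral_finsetSum _ fun j _ => m.integrableOn_cell K ?_
    exact ((hWj j K).continuous_fderiv one_ne_zero).clm_apply continuous_const
  simp only [h1]
  rw [Finset.sum_comm]
  simp only [fun j => m.sum_setIntegral_fderiv hd (hWj j) (EuclideanSpace.single j 1)]
  rw [Finset.sum_comm]
  refine Finset.sum_congr rfl fun F _ => ?_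
  have hjc : ∀ j, Continuous (m.jump (fun K y => W K y j) F) := fun j =>
    m.continuous_jump (fun K => (hWj j K).continuous) F
  simp only [surfInt, ← integral_const_mul]
  rw [← integral_finsetSum _ fun j _ => (m.integrableOn_face F (hjc j)).const_mul _]
  congr 1
  ext x
  rw [PiLp.inner_apply]
  refine Finset.sum_congr rfl fun j _ => ?_
  simp only [EuclideanSpace.inner_single_right, jump, PiLp.sub_apply, outer_coord]
  simp [mul_comm]

/-- For constant `g` the face terms are precisely the boundary fluxes of the divergence theorem.
This compatibility keeps the mean of the pressure at zero. -/
lemma b_const_one (hd : 2 ≤ d) {w : m.Vec} (hw : w ∈ m.Mh r) : m.b w (fun _ _ => 1) = 0 := by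
  have h := m.sum_setIntegral_div hd (contDiff_of_mem_Mh hw)
  have havg : ∀ F x, m.avg (fun _ _ => (1 : ℝ)) F x = 1 := by
    intro F x
    unfold avg
    cases m.snd F with
    | none => rfl
    | some K => norm_num
  simp only [b, havg, mul_one, one_mul, h, sub_self]

/-! ### Sign of the convection form on the diagonal. -/

/-- The product rule shows that the cell integrand of `A_c(z; z, φ, φ)` is half the divergence of
`|φ|² z`, so the cell terms turn into face terms. -/
lemma _root_.DGOldroyd.div_normSq_smul {d : ℕ} {z φ : E d → E d} (hz : Differentiable ℝ z)
    (hφ : Differentiable ℝ φ) (x : E d) :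
    div (fun y => ⟪φ y, φ y⟫ • z y) x =
      2 * ⟪fderiv ℝ φ x (z x), φ x⟫ + div z x * ⟪φ x, φ x⟫ := by
  have hc : DifferentiableAt ℝ (fun y => ⟪φ y, φ y⟫) x := (hφ x).inner ℝ (hφ x)
  have hsum : z x = ∑ j, z x j • EuclideanSpace.single j (1 : ℝ) := by
    simpa using ((EuclideanSpace.basisFun (Fin d) ℝ).sum_repr (z x)).symm
  have h1 : ⟪fderiv ℝ φ x (z x), φ x⟫ =
      ∑ j, z x j * ⟪fderiv ℝ φ x (EuclideanSpace.single j 1), φ x⟫ := by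
    conv_lhs => rw [hsum]
    simp [sum_inner, inner_smul_left]
  unfold div
  rw [h1, Finset.mul_sum, Finset.sum_mul, ← Finset.sum_add_distrib]
  refine Finset.sum_congr rfl fun j _ => ?_
  rw [fderiv_fun_smul hc (hz x)]
  simp only [add_apply, smul_apply, ContinuousLinearMap.smulRight_apply, PiLp.add_apply,
    PiLp.smul_apply, smul_eq_mul, fderiv_inner_apply ℝ (hφ x) (hφ x)]
  rw [real_inner_comm (φ x) (fderiv ℝ φ x _)]
  ring

lemma surfInt_inflow (θ : m.Vec) (hθ : ∀ K, Continuous (θ K)) (F : m.Face) (s : ℝ)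
    (f : E d → ℝ) : surfInt (m.inflow θ F s) f =
      surfInt (m.face F) ({x | ⟪m.avg θ F x, s • m.normal F⟫ < 0}.indicator f) := by
  have hm : MeasurableSet {x | ⟪m.avg θ F x, s • m.normal F⟫ < 0} :=
    (isOpen_lt ((m.continuous_avg hθ F).inner continuous_const) continuous_const).measurableSet
  unfold surfInt
  rw [setIntegral_indicator hm]
  rfl

lemma integrableOn_indicator_inflow (θ : m.Vec) (hθ : ∀ K, Continuous (θ K)) (F : m.Face) (s : ℝ)
    {f : E d → ℝ} (hf : Continuous f) :
    IntegrableOn ({x | ⟪m.avg θ F x, s • m.normal F⟫ < 0}.indicator f) (m.face F)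
      (Measure.euclideanHausdorffMeasure (d - 1)) :=
  (m.integrableOn_face F hf).indicator
    (isOpen_lt ((m.continuous_avg hθ F).inner continuous_const) continuous_const).measurableSet

/-- Here `α₁, α₂` are the normal components of `z` from both sides, `c₁, c₂` the values of `|φ|²`,
and `p` the product of the two traces of `φ`. With `a` the average of the `α`'s, the first two terms
equal `a (c₁ - c₂) / 2`; the one upwind term that is present completes this to `|a| (c₁ - 2 p + c₂)
/ 2`. -/
lemma _root_.DGOldroyd.upwind_nonneg {α₁ α₂ c₁ c₂ p : ℝ} (h : 0 ≤ c₁ - 2 * p + c₂) :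
    0 ≤ 1 / 2 * (c₁ * α₁ - c₂ * α₂) - 1 / 2 * ((α₁ - α₂) * (1 / 2 * (c₁ + c₂))) +
      (if 1 / 2 * (α₁ + α₂) < 0 then |1 / 2 * (α₁ + α₂)| * (c₁ - p) else 0) +
      if 0 < 1 / 2 * (α₁ + α₂) then |1 / 2 * (α₁ + α₂)| * (c₂ - p) else 0 := by
  have h1 : 1 / 2 * (c₁ * α₁ - c₂ * α₂) - 1 / 2 * ((α₁ - α₂) * (1 / 2 * (c₁ + c₂))) =
      1 / 2 * (1 / 2 * (α₁ + α₂)) * (c₁ - c₂) := by ring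
  rw [h1]
  generalize 1 / 2 * (α₁ + α₂) = a
  rcases lt_trichotomy a 0 with ha | rfl | ha
  · rw [if_pos ha, if_neg ha.not_gt, abs_of_neg ha]
    nlinarith
  · simp
  · rw [if_neg ha.not_gt, if_pos ha, abs_of_pos ha]
    nlinarith

/-- The upwinded convection form is nonnegative on the diagonal. -/
lemma Ac_self_nonneg (hd : 2 ≤ d) {z φ : m.Vec} (hz : z ∈ m.Mh r) (hφ : φ ∈ m.Mh r) :
    0 ≤ m.Ac z z φ φ := by
  have hzc := continuous_of_mem_Mh hz
  have hφc := continuous_of_mem_Mh hφ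
  have hzd := differentiable_of_mem_Mh hz
  have hφd := differentiable_of_mem_Mh hφ
  set c : m.Scal := fun K y => ⟪φ K y, φ K y⟫ with hc
  have hcc : ∀ K, Continuous (c K) := fun K => (hφc K).inner (hφc K)
  set W : m.Vec := fun K y => c K y • z K y with hWdef
  have hW : ∀ K, ContDiff ℝ 1 (W K) := fun K =>
    ((contDiff_of_mem_Mh hφ K).inner ℝ (contDiff_of_mem_Mh hφ K)).smul (contDiff_of_mem_Mh hz K)
  have hWc : ∀ K, Continuous (W K) := fun K => (hW K).continuous
  have hvol : ∑ K, ((∫ x in m.cell K, ⟪fderiv ℝ (φ K) x (z K x), φ K x⟫)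
      + (1 / 2) * ∫ x in m.cell K, div (z K) x * ⟪φ K x, φ K x⟫) =
      1 / 2 * ∑ F, surfInt (m.face F) fun x => ⟪m.normal F, m.jump W F x⟫ := by
    rw [← m.sum_setIntegral_div hd hW, Finset.mul_sum]
    refine Finset.sum_congr rfl fun K _ => ?_
    simp only [hWdef, hc, div_normSq_smul (hzd K) (hφd K)]
    rw [integral_add, integral_const_mul]
    · ring
    · exact m.integrableOn_cell K
        ((((continuous_jac hφ K).clm_apply (hzc K)).inner (hφc K)).const_mul 2)
    · exact m.integrableOn_cell K ((m.continuous_div hz K).mul (hcc K))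
  unfold Ac
  rw [hvol]
  have hint : ∀ f : m.Face → ℝ, ∑ F ∈ m.intFaces, f F =
      ∑ F, if (m.snd F).isSome then f F else 0 := fun f => by
    rw [intFaces, Finset.sum_filter]
  rw [hint, Finset.mul_sum, Finset.mul_sum, ← Finset.sum_sub_distrib, ← Finset.sum_add_distrib,
    ← Finset.sum_add_distrib]
  refine Finset.sum_nonneg fun F _ => ?_
  rw [m.surfInt_inflow z hzc, m.surfInt_inflow z hzc]
  have hjW := m.continuous_jump hWc F
  have hjz := m.continuous_jump hzc F
  have haz := m.continuous_avg hzc F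
  have hac := m.continuous_avg hcc F
  have hoφ := m.continuous_outer hφc F
  have i1 := m.integrableOn_face F (g := fun x => ⟪m.normal F, m.jump W F x⟫)
    (continuous_const.inner hjW)
  have i2 := m.integrableOn_face F (g := fun x => ⟪m.jump z F x, m.normal F⟫ * m.avg c F x)
    ((hjz.inner continuous_const).mul hac)
  have i3 := m.integrableOn_indicator_inflow z hzc F 1
    (f := fun x => |⟪m.avg z F x, m.normal F⟫| *
      ⟪φ (m.fst F) x - m.outer φ F x, φ (m.fst F) x⟫)
    ((haz.inner continuous_const).abs.mul (((hφc _).sub hoφ).inner (hφc _)))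
  have i4 := m.integrableOn_indicator_inflow z hzc F (-1)
    (f := fun x => |⟪m.avg z F x, m.normal F⟫| *
      ⟪m.outer φ F x - φ (m.fst F) x, m.outer φ F x⟫)
    ((haz.inner continuous_const).abs.mul ((hoφ.sub (hφc _)).inner hoφ))
  set f3 := {x | ⟪m.avg z F x, (1 : ℝ) • m.normal F⟫ < 0}.indicator fun x =>
    |⟪m.avg z F x, m.normal F⟫| * ⟪φ (m.fst F) x - m.outer φ F x, φ (m.fst F) x⟫ with hf3
  set f4 := {x | ⟪m.avg z F x, (-1 : ℝ) • m.normal F⟫ < 0}.indicator fun x =>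
    |⟪m.avg z F x, m.normal F⟫| * ⟪m.outer φ F x - φ (m.fst F) x, m.outer φ F x⟫ with hf4
  have hsum : (1 / 2 * surfInt (m.face F) fun x => ⟪m.normal F, m.jump W F x⟫) -
      (1 / 2 * surfInt (m.face F) fun x => ⟪m.jump z F x, m.normal F⟫ * m.avg c F x) +
      surfInt (m.face F) f3 + surfInt (m.face F) f4 =
      surfInt (m.face F) fun x => 1 / 2 * ⟪m.normal F, m.jump W F x⟫ -
        1 / 2 * (⟪m.jump z F x, m.normal F⟫ * m.avg c F x) + f3 x + f4 x := by
    have i5 : IntegrableOn (fun x => 1 / 2 * ⟪m.normal F, m.jump W F x⟫ -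
        1 / 2 * (⟪m.jump z F x, m.normal F⟫ * m.avg c F x)) (m.face F)
        (Measure.euclideanHausdorffMeasure (d - 1)) := (i1.const_mul _).sub (i2.const_mul _)
    have i6 : IntegrableOn (fun x => 1 / 2 * ⟪m.normal F, m.jump W F x⟫ -
        1 / 2 * (⟪m.jump z F x, m.normal F⟫ * m.avg c F x) + f3 x) (m.face F)
        (Measure.euclideanHausdorffMeasure (d - 1)) := i5.add i3
    simp only [surfInt]
    rw [integral_add i6 i4, integral_add i5 i3,
      integral_sub (i1.const_mul _) (i2.const_mul _), integral_const_mul, integral_const_mul]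
  -- The outer trace of `φ` is zero on boundary faces, so the term seen from the other side may be
  -- included on every face.
  have hf4z : m.snd F = none → surfInt (m.face F) f4 = 0 := by
    intro h
    have : f4 = 0 := by
      ext x
      simp [hf4, outer, h]
    rw [this]
    simp [surfInt]
  have hgoal : 0 ≤ surfInt (m.face F) fun x => 1 / 2 * ⟪m.normal F, m.jump W F x⟫ -
        1 / 2 * (⟪m.jump z F x, m.normal F⟫ * m.avg c F x) + f3 x + f4 x := by
    refine integral_nonneg fun x => ?_
    show 0 ≤ 1 / 2 * ⟪m.normal F, m.jump W F x⟫ -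
        1 / 2 * (⟪m.jump z F x, m.normal F⟫ * m.avg c F x) + f3 x + f4 x
    simp only [hf3, hf4, indicator_apply, mem_ofPred_eq, one_smul, neg_smul, inner_neg_right,
      neg_lt_zero]
    cases h : m.snd F with
    | none =>
      -- On a boundary face the flux and the jump correction cancel, leaving `|z · n| |φ|²` on the
      -- inflow part.
      simp only [jump, avg, outer, h, Option.elim_none, sub_zero, hWdef, hc, inner_zero_right,
        inner_smul_right, mul_zero, ite_self, add_zero, real_inner_comm]
      rw [real_inner_comm (z (m.fst F) x) (m.normal F)]
      split_ifs
      · rw [real_inner_self_eq_norm_sq]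
        nlinarith [mul_nonneg (abs_nonneg ⟪z (m.fst F) x, m.normal F⟫)
          (sq_nonneg ‖φ (m.fst F) x‖)]
      · linarith
    | some K =>
      simp only [jump, avg, outer, h, Option.elim_some, hWdef, hc, inner_sub_right,
        inner_sub_left, inner_add_left, real_inner_smul_left, real_inner_smul_right, smul_eq_mul]
      rw [real_inner_comm (z (m.fst F) x) (m.normal F), real_inner_comm (z K x) (m.normal F),
        real_inner_comm (φ (m.fst F) x) (φ K x)]
      refine upwind_nonneg ?_
      have := real_inner_self_nonneg (x := φ (m.fst F) x - φ K x)
      rw [real_inner_sub_sub_self] at this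
      exact this
  cases h : m.snd F with
  | none =>
    rw [hf4z h] at hsum
    rw [← hsum] at hgoal
    simpa only [Option.isSome_none, Bool.false_eq_true, if_false] using hgoal
  | some K =>
    rw [← hsum] at hgoal
    simpa only [Option.isSome_some, if_true] using hgoal

/-! ### Connectedness of the mesh -/

/-- An open convex set is the interior of its closure. -/
lemma interior_cell_subset (hO : IsConvexPolyhedralDomain O) (K : m.Cell) :
    interior (m.cell K) ⊆ O := by
  have h1 : interior (m.cell K) ⊆ interior (closure O) :=
    interior_mono (m.cover ▸ subset_iUnion _ K)
  rwa [hO.convex.interior_closure_eq_interior_of_nonempty_interior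
    (by rw [hO.isOpen.interior_eq]; exact hO.nonempty), hO.isOpen.interior_eq] at h1

/-- A cell is the closure of its interior, and an open set that misses a set also misses its
closure. -/
lemma disjoint_interior_cell {K L : m.Cell} (h : K ≠ L) :
    Disjoint (interior (m.cell K)) (m.cell L) := by
  have h1 := (m.disjoint K L h).closure_right isOpen_interior
  rw [(m.convex_cell L).closure_interior_eq_closure_of_nonempty_interior (m.cell_interior L)] at h1
  exact h1.mono_right subset_closure

lemma exists_closedBall_subset_interior (K : m.Cell) :
    ∃ x : E d, ∃ R > 0, Metric.closedBall x R ⊆ interior (m.cell K) := by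
  obtain ⟨x, hx⟩ := m.cell_interior K
  obtain ⟨R, hR, hball⟩ :=
    Metric.nhds_basis_closedBall.mem_iff.1 (isOpen_interior.mem_nhds hx)
  exact ⟨x, R, hR, hball⟩

/-- A bump supported inside one cell sees only the value of the piecewise constant function there.
-/
lemma sum_mul_setIntegral_bump {K : m.Cell} {x : E d} {η : ContDiffBump (0 : E d)}
    (hball : Metric.closedBall x η.rOut ⊆ interior (m.cell K)) (g : m.Cell → ℝ) :
    ∑ L, g L * ∫ y in m.cell L, η (y - x) = g K * ∫ y, η y := by
  have hzero : ∀ y, y ∉ interior (m.cell K) → η (y - x) = 0 := by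
    intro y hy
    refine η.zero_of_le_dist ?_
    rw [dist_zero_right, ← dist_eq_norm]
    by_contra h
    exact hy (hball (Metric.mem_closedBall.2 (not_le.1 h).le))
  rw [Finset.sum_eq_single K]
  · rw [setIntegral_eq_integral_of_forall_compl_eq_zero fun y hy =>
      hzero y fun h => hy (interior_subset h), integral_sub_right_eq_self fun y => η y]
  · intro L _ hL
    rw [setIntegral_eq_zero_of_forall_eq_zero, mul_zero]
    intro y hy
    exact hzero y fun h => (m.disjoint_interior_cell hL.symm).notMem_of_mem_left h hy
  · simp

lemma integrable_fderiv_translate {A : Set (E d)} (hA : IsCompact A) {η : E d → ℝ}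
    (hη : ContDiff ℝ 1 η) (x e : E d) :
    Integrable (Function.uncurry fun (s : ℝ) y => -fderiv ℝ η (y - (x + s • e)) e)
      ((volume.restrict (Ioc (0 : ℝ) 1)).prod (volume.restrict A)) := by
  have hη' : Continuous (fderiv ℝ η) := hη.continuous_fderiv one_ne_zero
  rw [Measure.prod_restrict]
  have hc : Continuous (Function.uncurry fun (s : ℝ) y => -fderiv ℝ η (y - (x + s • e)) e) := by
    unfold Function.uncurry
    fun_prop
  exact (hc.continuousOn.integrableOn_compact (isCompact_Icc.prod hA)).mono_set
    (prod_mono_left Ioc_subset_Icc_self)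

/-- The fundamental theorem of calculus in the translation parameter, followed by Fubini's theorem.
It measures the change of a local average as the bump slides by `e`. -/
lemma setIntegral_translate_sub {A : Set (E d)} (hA : IsCompact A) {η : E d → ℝ}
    (hη : ContDiff ℝ 1 η) (x e : E d) :
    (∫ y in A, η (y - (x + e))) - ∫ y in A, η (y - x) =
      ∫ s in (0 : ℝ)..1, ∫ y in A, -fderiv ℝ η (y - (x + s • e)) e := by
  have hη' : Continuous (fderiv ℝ η) := hη.continuous_fderiv one_ne_zero
  have hηc : Continuous η := hη.continuous
  rw [intervalIntegral.integral_of_le zero_le_one,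
    integral_integral_swap (integrable_fderiv_translate hA hη x e), ← integral_sub]
  · congr 1
    ext y
    rw [← intervalIntegral.integral_of_le zero_le_one,
      intervalIntegral.integral_eq_sub_of_hasDerivAt (f := fun s : ℝ => η (y - (x + s • e)))]
    · simp
    · intro s _
      have h1 : HasDerivAt (fun s : ℝ => y - (x + s • e)) (-e) s := by
        simpa using (((hasDerivAt_id s).smul_const e).const_add x).const_sub y
      have h2 := ((hη.differentiable one_ne_zero _).hasFDerivAt
        (x := y - (x + s • e))).comp_hasDerivAt s h1
      rw [map_neg] at h2
      exact h2
    · exact Continuous.intervalIntegrable (by fun_prop) _ _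
  · exact (Continuous.continuousOn (by fun_prop)).integrableOn_compact hA
  · exact (Continuous.continuousOn (by fun_prop)).integrableOn_compact hA

/-- A broken constant without interior jumps is constant. -/
lemma eq_of_forall_jump_eq_zero (hd : 2 ≤ d) (hO : IsConvexPolyhedralDomain O) {g : m.Cell → ℝ}
    (hg : ∀ F K, m.snd F = some K → g (m.fst F) = g K) (K L : m.Cell) : g K = g L := by
  obtain ⟨x, R₁, hR₁, hb₁⟩ := m.exists_closedBall_subset_interior K
  obtain ⟨y, R₂, hR₂, hb₂⟩ := m.exists_closedBall_subset_interior L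
  set R := min R₁ R₂
  have hR0 : 0 < R := lt_min hR₁ hR₂
  let η : ContDiffBump (0 : E d) := ⟨R / 2, R, by positivity, by linarith⟩
  replace hb₁ : Metric.closedBall x η.rOut ⊆ interior (m.cell K) :=
    (Metric.closedBall_subset_closedBall (min_le_left _ _)).trans hb₁
  replace hb₂ : Metric.closedBall y η.rOut ⊆ interior (m.cell L) :=
    (Metric.closedBall_subset_closedBall (min_le_right _ _)).trans hb₂
  have hη : ContDiff ℝ 1 (η : E d → ℝ) := η.contDiff
  -- The bump never reaches `∂O`: a point where the translate is nonzero is a convex combination of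
  -- equally shifted points near `x` and `y`, both in `O`, and the open set `O` misses its frontier.
  have hzero : ∀ s ∈ Icc (0 : ℝ) 1, ∀ z ∈ frontier O, η (z - (x + s • (y - x))) = 0 := by
    intro s hs z hz
    refine η.zero_of_le_dist ?_
    by_contra! hlt
    rw [dist_zero_right] at hlt
    have h1 : x + (z - (x + s • (y - x))) ∈ O :=
      m.interior_cell_subset hO K (hb₁ (by simpa using hlt.le))
    have h2 : y + (z - (x + s • (y - x))) ∈ O :=
      m.interior_cell_subset hO L (hb₂ (by simpa using hlt.le))
    have h3 := hO.convex.add_smul_sub_mem h1 h2 hs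
    have h4 : x + (z - (x + s • (y - x))) + s • (y + (z - (x + s • (y - x))) -
        (x + (z - (x + s • (y - x))))) = z := by
      rw [add_sub_add_right_eq_sub]
      abel
    rw [h4] at h3
    rw [hO.isOpen.frontier_eq] at hz
    exact hz.2 h3
  -- By the divergence theorem the derivative of the weighted average in `s` is a sum of jump
  -- integrals of `g η`. These vanish on interior faces by hypothesis and on boundary faces by
  -- `hzero`.
  have hflux : ∀ s ∈ Icc (0 : ℝ) 1,
      ∑ J, g J * ∫ z in m.cell J, fderiv ℝ η (z - (x + s • (y - x))) (y - x) = 0 := by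
    intro s hs
    have hcd : ∀ J, ContDiff ℝ 1 fun z => g J * η (z - (x + s • (y - x))) := fun J =>
      contDiff_const.mul (hη.comp (contDiff_id.sub contDiff_const))
    have h1 := m.sum_setIntegral_fderiv hd hcd (y - x)
    have h2 : ∀ J, ∫ z in m.cell J, fderiv ℝ (fun z => g J * η (z - (x + s • (y - x)))) z (y - x) =
        g J * ∫ z in m.cell J, fderiv ℝ η (z - (x + s • (y - x))) (y - x) := by
      intro J
      rw [← integral_const_mul]
      congr 1
      ext z
      have hdiff : DifferentiableAt ℝ (fun z => η (z - (x + s • (y - x)))) z :=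
        (hη.comp (contDiff_id.sub contDiff_const)).differentiable one_ne_zero z
      rw [fderiv_const_mul hdiff, fderiv_comp_sub]
      rfl
    simp only [h2] at h1
    rw [h1]
    refine Finset.sum_eq_zero fun F _ => ?_
    have h3 : surfInt (m.face F) (m.jump (fun J z => g J * η (z - (x + s • (y - x)))) F) = 0 := by
      refine setIntegral_eq_zero_of_forall_eq_zero fun z hz => ?_
      unfold jump outer
      cases h : m.snd F with
      | none => simp [hzero s hs z (m.boundary F h hz)]
      | some J => simp [hg F J h]
    rw [h3, mul_zero]
  have hdiff : ∑ J, g J * ∫ z in m.cell J, η (z - y) = ∑ J, g J * ∫ z in m.cell J, η (z - x) := by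
    rw [← sub_eq_zero, ← Finset.sum_sub_distrib]
    have h1 : ∀ J, g J * (∫ z in m.cell J, η (z - y)) - g J * ∫ z in m.cell J, η (z - x) =
        ∫ s in (0 : ℝ)..1, g J * ∫ z in m.cell J, -fderiv ℝ η (z - (x + s • (y - x))) (y - x) := by
      intro J
      rw [intervalIntegral.integral_const_mul, ← setIntegral_translate_sub (m.isCompact_cell J)
        hη x (y - x), add_sub_cancel, mul_sub]
    simp only [h1]
    rw [← intervalIntegral.integral_finsetSum]
    · rw [intervalIntegral.integral_congr (g := fun _ => (0 : ℝ)), intervalIntegral.integral_zero]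
      intro s hs
      rw [uIcc_of_le zero_le_one] at hs
      simp only [integral_neg, mul_neg, Finset.sum_neg_distrib, hflux s hs, neg_zero]
    · intro J _
      rw [intervalIntegrable_iff_integrableOn_Ioc_of_le zero_le_one]
      exact ((integrable_fderiv_translate (m.isCompact_cell J) hη x
        (y - x)).integral_prod_left).const_mul _
  rw [m.sum_mul_setIntegral_bump hb₁, m.sum_mul_setIntegral_bump hb₂] at hdiff
  exact (mul_right_cancel₀ (η.integral_pos (μ := volume)).ne' hdiff).symm

end Mesh

/-! ### Maps that are linear or bilinear on submodules -/

section bilinear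

variable {X Y Z Z' : Type*} [AddCommGroup X] [Module ℝ X] [AddCommGroup Y] [Module ℝ Y]
  [AddCommGroup Z] [Module ℝ Z] [AddCommGroup Z'] [Module ℝ Z']

/-- `T` is linear on the submodule `U`. -/
structure IsLinOn (U : Submodule ℝ X) (T : X → Z) : Prop where
  add : ∀ u ∈ U, ∀ u' ∈ U, T (u + u') = T u + T u'
  smul : ∀ c : ℝ, ∀ u ∈ U, T (c • u) = c • T u

/-- `f` is bilinear on the submodules `U` and `V`. -/
structure IsBilinOn (U : Submodule ℝ X) (V : Submodule ℝ Y) (f : X → Y → Z) : Prop where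
  left : ∀ w ∈ V, IsLinOn U fun u => f u w
  right : ∀ u ∈ U, IsLinOn V fun w => f u w

variable {U : Submodule ℝ X} {V : Submodule ℝ Y}

namespace IsLinOn

/-- The linear map on the submodule. -/
def toLinearMap {T : X → Z} (h : IsLinOn U T) : U →ₗ[ℝ] Z where
  toFun u := T u
  map_add' u u' := h.add u u.2 u' u'.2
  map_smul' c u := h.smul c u u.2

lemma comp {T : X → Z} (hT : IsLinOn U T) (L : Z →ₗ[ℝ] Z') : IsLinOn U fun u => L (T u) :=
  ⟨fun u hu u' hu' => by rw [hT.add u hu u' hu', map_add],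
    fun c u hu => by rw [hT.smul c u hu, map_smul]⟩

lemma fun_zero : IsLinOn U (fun _ => (0 : Z)) :=
  ⟨fun _ _ _ _ => (add_zero 0).symm, fun c _ _ => (smul_zero c).symm⟩

lemma fun_add {T T' : X → Z} (hT : IsLinOn U T) (hT' : IsLinOn U T') :
    IsLinOn U fun u => T u + T' u :=
  ⟨fun u hu u' hu' => by rw [hT.add u hu u' hu', hT'.add u hu u' hu']; abel,
    fun c u hu => by rw [hT.smul c u hu, hT'.smul c u hu, smul_add]⟩

lemma fun_sub {T T' : X → Z} (hT : IsLinOn U T) (hT' : IsLinOn U T') :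
    IsLinOn U fun u => T u - T' u :=
  ⟨fun u hu u' hu' => by rw [hT.add u hu u' hu', hT'.add u hu u' hu']; abel,
    fun c u hu => by rw [hT.smul c u hu, hT'.smul c u hu, smul_sub]⟩

lemma const_smul {T : X → Z} (hT : IsLinOn U T) (a : ℝ) : IsLinOn U fun u => a • T u :=
  ⟨fun u hu u' hu' => by rw [hT.add u hu u' hu', smul_add],
    fun c u hu => by rw [hT.smul c u hu, smul_comm]⟩

lemma const_mul {T : X → ℝ} (hT : IsLinOn U T) (a : ℝ) : IsLinOn U fun u => a * T u :=
  hT.const_smul a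

lemma sum {ι : Type*} {s : Finset ι} {T : ι → X → Z} (hT : ∀ i, IsLinOn U (T i)) :
    IsLinOn U fun u => ∑ i ∈ s, T i u :=
  ⟨fun u hu u' hu' => by simp only [(hT _).add u hu u' hu', Finset.sum_add_distrib],
    fun c u hu => by simp only [(hT _).smul c u hu, Finset.smul_sum]⟩

/-- The forms are defined on all broken functions, but the integral is additive only on integrable
ones; this is why linearity is stated relative to a submodule. -/
lemma integral {α : Type*} [MeasurableSpace α] {μ : Measure α} {T : X → α → ℝ}
    (hT : ∀ a, IsLinOn U fun u => T u a) (hi : ∀ u ∈ U, Integrable (T u) μ) :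
    IsLinOn U fun u => ∫ a, T u a ∂μ :=
  ⟨fun u hu u' hu' => by
      simp only [(hT _).add u hu u' hu']
      exact integral_add (hi u hu) (hi u' hu'),
    fun c u hu => by
      simp only [(hT _).smul c u hu]
      exact integral_smul c _⟩

end IsLinOn

namespace IsBilinOn

/-- The bilinear form on the submodules. -/
def toBilin {f : X → Y → ℝ} (h : IsBilinOn U V f) : U →ₗ[ℝ] V →ₗ[ℝ] ℝ :=
  LinearMap.mk₂ ℝ (fun u w => f u w)
    (fun u u' w => (h.left w w.2).add u u.2 u' u'.2) (fun c u w => (h.left w w.2).smul c u u.2)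
    (fun u w w' => (h.right u u.2).add w w.2 w' w'.2) (fun c u w => (h.right u u.2).smul c w w.2)

lemma mono {U' : Submodule ℝ X} {V' : Submodule ℝ Y} {f : X → Y → ℝ} (h : IsBilinOn U V f)
    (hU : U' ≤ U) (hV : V' ≤ V) : IsBilinOn U' V' f where
  left w hw := ⟨fun u hu u' hu' => (h.left w (hV hw)).add u (hU hu) u' (hU hu'),
    fun c u hu => (h.left w (hV hw)).smul c u (hU hu)⟩
  right u hu := ⟨fun w hw w' hw' => (h.right u (hU hu)).add w (hV hw) w' (hV hw'),
    fun c w hw => (h.right u (hU hu)).smul c w (hV hw)⟩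

lemma swap {f : Y → X → ℝ} (h : IsBilinOn V U f) : IsBilinOn U V fun u w => f w u :=
  ⟨h.right, h.left⟩

lemma of_comp {T : X → Z} {T' : Y → Z'} (hT : IsLinOn U T) (hT' : IsLinOn V T')
    (B : Z →ₗ[ℝ] Z' →ₗ[ℝ] ℝ) : IsBilinOn U V fun u w => B (T u) (T' w) :=
  ⟨fun w _ => hT.comp (B.flip (T' w)), fun u _ => hT'.comp (B (T u))⟩

lemma inner {H : Type*} [NormedAddCommGroup H] [InnerProductSpace ℝ H] {T : X → H} {T' : Y → H}
    (hT : IsLinOn U T) (hT' : IsLinOn V T') : IsBilinOn U V fun u w => ⟪T u, T' w⟫ :=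
  of_comp hT hT' (innerₗ H)

lemma mul {T : X → ℝ} {T' : Y → ℝ} (hT : IsLinOn U T) (hT' : IsLinOn V T') :
    IsBilinOn U V fun u w => T u * T' w :=
  of_comp hT hT' (LinearMap.mul ℝ ℝ)

lemma fun_add {f f' : X → Y → Z} (h : IsBilinOn U V f) (h' : IsBilinOn U V f') :
    IsBilinOn U V fun u w => f u w + f' u w :=
  ⟨fun w hw => (h.left w hw).fun_add (h'.left w hw),
    fun u hu => (h.right u hu).fun_add (h'.right u hu)⟩

lemma fun_sub {f f' : X → Y → Z} (h : IsBilinOn U V f) (h' : IsBilinOn U V f') :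
    IsBilinOn U V fun u w => f u w - f' u w :=
  ⟨fun w hw => (h.left w hw).fun_sub (h'.left w hw),
    fun u hu => (h.right u hu).fun_sub (h'.right u hu)⟩

lemma const_mul {f : X → Y → ℝ} (h : IsBilinOn U V f) (a : ℝ) :
    IsBilinOn U V fun u w => a * f u w :=
  ⟨fun w hw => (h.left w hw).const_mul a, fun u hu => (h.right u hu).const_mul a⟩

lemma sum {ι : Type*} {s : Finset ι} {f : ι → X → Y → Z} (h : ∀ i, IsBilinOn U V (f i)) :
    IsBilinOn U V fun u w => ∑ i ∈ s, f i u w :=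
  ⟨fun w hw => .sum fun i => (h i).left w hw, fun u hu => .sum fun i => (h i).right u hu⟩

lemma integral {α : Type*} [MeasurableSpace α] {μ : Measure α} {f : X → Y → α → ℝ}
    (h : ∀ a, IsBilinOn U V fun u w => f u w a)
    (hi : ∀ u ∈ U, ∀ w ∈ V, Integrable (f u w) μ) : IsBilinOn U V fun u w => ∫ a, f u w a ∂μ :=
  ⟨fun w hw => .integral (fun a => (h a).left w hw) fun u hu => hi u hu w hw,
    fun u hu => .integral (fun a => (h a).right u hu) fun w hw => hi u hu w hw⟩

end IsBilinOn

end bilinear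

namespace Mesh

variable {d : ℕ} {O : Set (E d)} (m : Mesh O) {r r' : ℕ}

/-! ### Finite-dimensionality and definiteness -/

instance finite_Ph : FiniteDimensional ℝ (m.Ph r) := by
  let f : m.Ph r →ₗ[ℝ] (m.Cell → polyFun d r) :=
    { toFun := fun g K => ⟨g.1 K, g.2 K⟩
      map_add' := fun _ _ => rfl
      map_smul' := fun _ _ => rfl }
  refine Module.Finite.of_injective f fun g g' h => ?_
  ext K x
  exact congrFun (congrArg Subtype.val (congrFun h K)) x

instance finite_Mh : FiniteDimensional ℝ (m.Mh r) := by
  let f : m.Mh r →ₗ[ℝ] (m.Cell → Fin d → polyFun d r) :=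
    { toFun := fun w K i => ⟨fun x => w.1 K x i, w.2 K i⟩
      map_add' := fun _ _ => rfl
      map_smul' := fun _ _ => rfl }
  refine Module.Finite.of_injective f fun g g' h => ?_
  ext K x i
  exact congrFun (congrArg Subtype.val (congrFun (congrFun h K) i)) x

variable {m} in
lemma eq_zero_of_sum_setIntegral {f : m.Scal} (hf : ∀ K, Continuous (f K))
    (h0 : ∀ K x, 0 ≤ f K x) (h : ∑ K, ∫ x in m.cell K, f K x ≤ 0) (K : m.Cell) {x : E d}
    (hx : x ∈ interior (m.cell K)) : f K x = 0 := by
  have hnn : ∀ K, 0 ≤ ∫ x in m.cell K, f K x := fun K => integral_nonneg (h0 K)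
  have hz := (Finset.sum_eq_zero_iff_of_nonneg fun K _ => hnn K).1
    (le_antisymm h (Finset.sum_nonneg fun K _ => hnn K)) K (Finset.mem_univ K)
  exact eq_zero_of_setIntegral_eq_zero (hf K) (fun x _ => h0 K x)
    (m.isCompact_cell K).measurableSet (m.integrableOn_cell K (hf K)) hz hx

variable {m} in
lemma eq_zero_of_innerVec_self {w : m.Vec} (hw : w ∈ m.Mh r) (h : m.innerVec w w ≤ 0) :
    w = 0 := by
  have hz := eq_zero_of_sum_setIntegral (f := fun K x => ⟪w K x, w K x⟫)
    (fun K => (continuous_of_mem_Mh hw K).inner (continuous_of_mem_Mh hw K))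
    (fun K x => real_inner_self_nonneg) h
  ext K x i
  have := polyFun_eq_zero (hw K i) (m.cell_interior K) fun x hx => by
    rw [inner_self_eq_zero.1 (hz K hx)]; rfl
  exact congrFun this x

variable {m} in
lemma eq_zero_of_innerScal_self {g : m.Scal} (hg : g ∈ m.Ph r) (h : m.innerScal g g ≤ 0) :
    g = 0 := by
  have hz := eq_zero_of_sum_setIntegral (f := fun K x => g K x * g K x)
    (fun K => (continuous_of_mem_Ph hg K).mul (continuous_of_mem_Ph hg K))
    (fun K x => mul_self_nonneg _) h
  ext K x
  have := polyFun_eq_zero (hg K) (m.cell_interior K) fun x hx => mul_self_eq_zero.1 (hz K hx)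
  exact congrFun this x

/-- The functions of mean zero in `P_h`. -/
def Ph0Sub (r : ℕ) : Submodule ℝ m.Scal where
  carrier := m.Ph0 r
  zero_mem' := ⟨(m.Ph r).zero_mem, by simp⟩
  add_mem' := by
    rintro g g' ⟨hg, h⟩ ⟨hg', h'⟩
    refine ⟨(m.Ph r).add_mem hg hg', ?_⟩
    have hadd : ∀ K, ∫ x in m.cell K, (g + g') K x =
        (∫ x in m.cell K, g K x) + ∫ x in m.cell K, g' K x := fun K =>
      integral_add (m.integrableOn_cell K (continuous_of_mem_Ph hg K))
        (m.integrableOn_cell K (continuous_of_mem_Ph hg' K))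
    simp only [hadd, Finset.sum_add_distrib, h, h', add_zero]
  smul_mem' := by
    rintro c g ⟨hg, h⟩
    refine ⟨(m.Ph r).smul_mem c hg, ?_⟩
    have : ∀ K, ∫ x in m.cell K, (c • g) K x = c * ∫ x in m.cell K, g K x := fun K =>
      integral_const_mul c _
    simp only [this, ← Finset.mul_sum, h, mul_zero]

lemma Ph0Sub_le (r : ℕ) : m.Ph0Sub r ≤ m.Ph r := fun _ h => h.1

instance finite_Ph0Sub : FiniteDimensional ℝ (m.Ph0Sub r) :=
  Submodule.finiteDimensional_of_le (m.Ph0Sub_le r)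

variable {m} in
/-- The seminorm of the pressure space is definite on functions of mean zero. -/
lemma eq_zero_of_normSqScal (hd : 2 ≤ d) (hO : IsConvexPolyhedralDomain O) {σ : ℝ} (hσ : 0 < σ)
    {g : m.Scal} (hg : g ∈ m.Ph0 r) (h : m.normSqScal σ g ≤ 0) : g = 0 := by
  have hgc := continuous_of_mem_Ph hg.1
  have hterm : ∀ F, 0 ≤ σ / m.hF F * surfInt (m.face F) fun x => m.jump g F x ^ 2 := fun F =>
    mul_nonneg (div_pos hσ (m.hF_pos hd F)).le (integral_nonneg fun x => sq_nonneg _)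
  have h1 : 0 ≤ ∑ K, ∫ x in m.cell K, ‖m.grad g K x‖ ^ 2 :=
    Finset.sum_nonneg fun K _ => integral_nonneg fun x => sq_nonneg _
  have h2 : 0 ≤ ∑ F ∈ m.intFaces, σ / m.hF F * surfInt (m.face F) fun x => m.jump g F x ^ 2 :=
    Finset.sum_nonneg fun F _ => hterm F
  have hz := eq_zero_of_sum_setIntegral (f := fun K x => ‖m.grad g K x‖ ^ 2)
    (fun K => (continuous_grad hg.1 K).norm.pow 2) (fun K x => sq_nonneg _)
    (by unfold normSqScal at h; linarith)
  -- The gradient vanishes inside the cell, and its directional derivatives are polynomials, so they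
  -- vanish on all of `ℝ^d`. Hence `g K` is constant, and its value may be read off at `0` even if
  -- `0` is outside the cell.
  have hfd : ∀ K x, fderiv ℝ (g K) x = 0 := by
    intro K x
    ext v
    have := polyFun_eq_zero (polyFun_fderiv (hg.1 K) v) (m.cell_interior K) fun x hx => by
      rw [← inner_gradient_eq]
      have : gradient (g K) x = 0 := by simpa [grad] using hz K hx
      rw [this, inner_zero_left]
    exact congrFun this x
  have hconst : ∀ K x, g K x = g K 0 := fun K x =>
    is_const_of_fderiv_eq_zero ((contDiff_of_mem_Ph hg.1 K).differentiable one_ne_zero)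
      (hfd K) x 0
  have hjump : ∀ F K, m.snd F = some K → g (m.fst F) 0 = g K 0 := by
    intro F K hF
    have hs : ∑ F ∈ m.intFaces, σ / m.hF F * surfInt (m.face F) (fun x => m.jump g F x ^ 2) = 0 :=
      le_antisymm (by unfold normSqScal at h; linarith) h2
    have hz := (Finset.sum_eq_zero_iff_of_nonneg fun F _ => hterm F).1 hs F
      (by simp [intFaces, hF])
    have hj : ∀ x, m.jump g F x ^ 2 = (g (m.fst F) 0 - g K 0) ^ 2 := by
      intro x
      simp only [jump, outer, hF, Option.elim_some]
      rw [hconst (m.fst F) x, hconst K x]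
    rw [mul_eq_zero] at hz
    replace hz := hz.resolve_left (div_pos hσ (m.hF_pos hd F)).ne'
    simp only [surfInt, hj, setIntegral_const, smul_eq_mul, mul_eq_zero] at hz
    have hpos := ENNReal.toReal_pos (m.surface_face_pos hd F).ne' (m.surface_face_lt_top F).ne
    exact sub_eq_zero.1 (pow_eq_zero_iff two_ne_zero |>.1 (hz.resolve_left hpos.ne'))
  have heq := m.eq_of_forall_jump_eq_zero hd hO (g := fun K => g K 0) hjump
  ext K x
  rw [hconst K x]
  have hint := hg.2
  have hc : ∀ L, ∫ y in m.cell L, g L y = volume.real (m.cell L) * g K 0 := by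
    intro L
    simp only [hconst L]
    rw [setIntegral_const, smul_eq_mul, heq L K]
  simp only [hc, ← Finset.sum_mul, mul_eq_zero] at hint
  refine hint.resolve_left (ne_of_gt ?_)
  have hpos : ∀ L, 0 < volume.real (m.cell L) := fun L =>
    ENNReal.toReal_pos (((isOpen_interior.measure_pos volume (m.cell_interior L)).trans_le
      (measure_mono interior_subset)).ne') (m.isCompact_cell L).measure_lt_top.ne
  exact Finset.sum_pos (fun L _ => hpos L) ⟨K, Finset.mem_univ K⟩

/-! ### Bilinearity of the discrete forms -/

section linearity

variable {X Y : Type*} [AddCommGroup X] [Module ℝ X] {U : Submodule ℝ X}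
  [AddCommGroup Y] [Module ℝ Y] {W : Submodule ℝ Y}
  {V : Type*} [AddCommGroup V] [Module ℝ V]

variable {m} in
lemma isLinOn_outer {Φ : X → m.Cell → E d → V} (hΦ : ∀ K x, IsLinOn U fun u => Φ u K x)
    (F : m.Face) (x : E d) : IsLinOn U fun u => m.outer (Φ u) F x := by
  unfold outer
  cases m.snd F with
  | none => exact .fun_zero
  | some K => exact hΦ K x

variable {m} in
lemma isLinOn_jump {Φ : X → m.Cell → E d → V} (hΦ : ∀ K x, IsLinOn U fun u => Φ u K x)
    (F : m.Face) (x : E d) : IsLinOn U fun u => m.jump (Φ u) F x :=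
  (hΦ _ x).fun_sub (isLinOn_outer hΦ F x)

variable {m} in
lemma isLinOn_avg {Φ : X → m.Cell → E d → V} (hΦ : ∀ K x, IsLinOn U fun u => Φ u K x)
    (F : m.Face) (x : E d) : IsLinOn U fun u => m.avg (Φ u) F x := by
  unfold avg
  cases m.snd F with
  | none => exact hΦ _ x
  | some K => exact ((hΦ _ x).fun_add (hΦ K x)).const_smul _

variable {m} in
lemma isBilinOn_avg {Φ : X → Y → m.Cell → E d → V}
    (hΦ : ∀ K x, IsBilinOn U W fun u w => Φ u w K x) (F : m.Face) (x : E d) :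
    IsBilinOn U W fun u w => m.avg (Φ u w) F x :=
  ⟨fun w hw => isLinOn_avg (fun K x => (hΦ K x).left w hw) F x,
    fun u hu => isLinOn_avg (fun K x => (hΦ K x).right u hu) F x⟩

end linearity

lemma isLinOn_eval {V : Type*} [AddCommGroup V] [Module ℝ V] (U : Submodule ℝ (m.Cell → E d → V))
    (K : m.Cell) (x : E d) : IsLinOn U fun w => w K x :=
  ⟨fun _ _ _ _ => rfl, fun _ _ _ => rfl⟩

lemma isLinOn_jac (K : m.Cell) (x : E d) : IsLinOn (m.Mh r) fun w => m.jac w K x :=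
  ⟨fun _ hu _ hu' => fderiv_add (differentiable_of_mem_Mh hu K x)
      (differentiable_of_mem_Mh hu' K x),
    fun c _ hu => fderiv_const_smul (differentiable_of_mem_Mh hu K x) c⟩

lemma isLinOn_grad (K : m.Cell) (x : E d) : IsLinOn (m.Ph r) fun g => m.grad g K x := by
  have hd : ∀ u ∈ m.Ph r, DifferentiableAt ℝ (u K) x := fun u hu =>
    (contDiff_of_mem_Ph hu K).differentiable one_ne_zero x
  constructor
  · intro u hu u' hu'
    have : fderiv ℝ ((u + u') K) x = fderiv ℝ (u K) x + fderiv ℝ (u' K) x :=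
      fderiv_add (hd u hu) (hd u' hu')
    simp only [grad, gradient, this, map_add]
  · intro c u hu
    have : fderiv ℝ ((c • u) K) x = c • fderiv ℝ (u K) x := fderiv_const_smul (hd u hu) c
    simp only [grad, gradient, this, map_smul]

/-- Evaluation of linear maps at a vector. -/
def _root_.DGOldroyd.applyAt {d : ℕ} (v : E d) : (E d →L[ℝ] E d) →ₗ[ℝ] E d where
  toFun A := A v
  map_add' _ _ := rfl
  map_smul' _ _ := rfl

lemma isLinOn_jac_apply (K : m.Cell) (x v : E d) :
    IsLinOn (m.Mh r) fun w => fderiv ℝ (w K) x v :=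
  (m.isLinOn_jac K x).comp (applyAt v)

lemma isLinOn_div (K : m.Cell) (x : E d) : IsLinOn (m.Mh r) fun w => div (w K) x :=
  .sum fun j => (m.isLinOn_jac_apply K x _).comp (EuclideanSpace.proj j : E d →L[ℝ] ℝ).toLinearMap

lemma isBilinOn_innerVec : IsBilinOn (m.Mh r) (m.Mh r') m.innerVec :=
  .sum fun K => .integral (fun x => .inner (m.isLinOn_eval _ K x) (m.isLinOn_eval _ K x))
    fun _ hu _ hw => m.integrableOn_cell K
      ((continuous_of_mem_Mh hu K).inner (continuous_of_mem_Mh hw K))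

lemma isBilinOn_innerScal : IsBilinOn (m.Ph r) (m.Ph r') m.innerScal :=
  .sum fun K => .integral (fun x => .mul (m.isLinOn_eval _ K x) (m.isLinOn_eval _ K x))
    fun _ hu _ hw => m.integrableOn_cell K
      ((continuous_of_mem_Ph hu K).mul (continuous_of_mem_Ph hw K))

lemma isBilinOn_b : IsBilinOn (m.Mh r) (m.Ph r') m.b := by
  refine .fun_sub (.sum fun K => .integral (fun x => .mul (m.isLinOn_div K x)
    (m.isLinOn_eval _ K x)) fun u hu w hw => m.integrableOn_cell K
      ((m.continuous_div hu K).mul (continuous_of_mem_Ph hw K))) (.sum fun F => ?_)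
  refine .integral (fun x => .swap (.mul (isLinOn_avg (m.isLinOn_eval _) F x)
    ((isLinOn_jump (m.isLinOn_eval _) F x).comp (innerₗ (E d) (m.normal F)))))
    fun u hu w hw => m.integrableOn_face F ?_
  exact (m.continuous_avg (continuous_of_mem_Ph hw) F).mul
    (continuous_const.inner (m.continuous_jump (continuous_of_mem_Mh hu) F))

lemma isBilinOn_consistency : IsBilinOn (m.Mh r) (m.Mh r') fun u w =>
    ∑ F, surfInt (m.face F) fun x => ⟪m.avg (m.jac u) F x (m.normal F), m.jump w F x⟫ := by
  refine .sum fun F => .integral (fun x => .inner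
    ((isLinOn_avg m.isLinOn_jac F x).comp (applyAt (m.normal F)))
    (isLinOn_jump (m.isLinOn_eval _) F x)) fun u hu w hw => m.integrableOn_face F ?_
  exact ((m.continuous_avg (continuous_jac hu) F).clm_apply continuous_const).inner
    (m.continuous_jump (continuous_of_mem_Mh hw) F)

lemma isBilinOn_Aeps (ε σ : ℝ) : IsBilinOn (m.Mh r) (m.Mh r') (m.Aeps ε σ) := by
  refine .fun_add (.fun_add (.fun_sub ?_ m.isBilinOn_consistency)
    (.const_mul (.swap m.isBilinOn_consistency) ε)) ?_
  · refine .sum fun K => .integral (fun x => .sum fun j => .inner (m.isLinOn_jac_apply K x _)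
      (m.isLinOn_jac_apply K x _)) fun u hu w hw => m.integrableOn_cell K ?_
    exact continuous_finsetSum _ fun j _ => ((continuous_jac hu K).clm_apply continuous_const).inner
      ((continuous_jac hw K).clm_apply continuous_const)
  · refine .sum fun F => .const_mul (.integral (fun x => .inner
      (isLinOn_jump (m.isLinOn_eval _) F x) (isLinOn_jump (m.isLinOn_eval _) F x))
      fun u hu w hw => m.integrableOn_face F ?_) _
    exact (m.continuous_jump (continuous_of_mem_Mh hu) F).inner
      (m.continuous_jump (continuous_of_mem_Mh hw) F)

lemma isBilinOn_Asip (σ : ℝ) : IsBilinOn (m.Ph r) (m.Ph r') (m.Asip σ) := by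
  have hcons : ∀ s s', IsBilinOn (m.Ph s) (m.Ph s') fun v g => ∑ F ∈ m.intFaces,
      surfInt (m.face F) fun x => ⟪m.avg (m.grad v) F x, m.normal F⟫ * m.jump g F x := by
    intro s s'
    refine .sum fun F => .integral (fun x => .mul
      ((isLinOn_avg m.isLinOn_grad F x).comp ((innerₗ (E d)).flip (m.normal F)))
      (isLinOn_jump (m.isLinOn_eval _) F x)) fun u hu w hw => m.integrableOn_face F ?_
    exact ((m.continuous_avg (continuous_grad hu) F).inner continuous_const).mul
      (m.continuous_jump (continuous_of_mem_Ph hw) F)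
  refine .fun_add (.fun_sub (.fun_sub ?_ (hcons r r')) (.swap (hcons r' r))) ?_
  · refine .sum fun K => .integral (fun x => .inner (m.isLinOn_grad K x)
      (m.isLinOn_grad K x)) fun u hu w hw => m.integrableOn_cell K ?_
    exact (continuous_grad hu K).inner (continuous_grad hw K)
  · refine .sum fun F => .const_mul (.integral (fun x => .mul
      (isLinOn_jump (m.isLinOn_eval _) F x) (isLinOn_jump (m.isLinOn_eval _) F x))
      fun u hu w hw => m.integrableOn_face F ?_) _
    exact (m.continuous_jump (continuous_of_mem_Ph hu) F).mul
      (m.continuous_jump (continuous_of_mem_Ph hw) F)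

lemma isBilinOn_Ac {θ z : m.Vec} (hz : z ∈ m.Mh r) :
    IsBilinOn (m.Mh r) (m.Mh r') (m.Ac θ z) := by
  have hzc := continuous_of_mem_Mh hz
  have hin : ∀ F s, m.inflow θ F s ⊆ m.face F := fun F s => sep_subset _ _
  refine .fun_add (.fun_add (.fun_sub (.sum fun K => .fun_add ?_ (.const_mul ?_ _))
    (.const_mul (.sum fun F => ?_) _)) (.sum fun F => ?_)) (.sum fun F => ?_)
  · refine .integral (fun x => .inner (m.isLinOn_jac_apply K x _) (m.isLinOn_eval _ K x))
      fun u hu w hw => m.integrableOn_cell K ?_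
    exact ((continuous_jac hu K).clm_apply (hzc K)).inner (continuous_of_mem_Mh hw K)
  · refine .integral (fun x => .const_mul (.inner (m.isLinOn_eval _ K x) (m.isLinOn_eval _ K x)) _)
      fun u hu w hw => m.integrableOn_cell K ?_
    exact (m.continuous_div hz K).mul
      ((continuous_of_mem_Mh hu K).inner (continuous_of_mem_Mh hw K))
  · refine .integral (fun x => .const_mul (isBilinOn_avg (fun K y =>
      .inner (m.isLinOn_eval _ K y) (m.isLinOn_eval _ K y)) F x) _)
      fun u hu w hw => m.integrableOn_face F ?_
    exact ((m.continuous_jump hzc F).inner continuous_const).mul (m.continuous_avg (fun K =>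
      (continuous_of_mem_Mh hu K).inner (continuous_of_mem_Mh hw K)) F)
  · refine .integral (fun x => .const_mul (.inner
      (isLinOn_jump (m.isLinOn_eval _) F x) (m.isLinOn_eval _ _ x)) _)
      fun u hu w hw => (m.integrableOn_face F ?_).mono_set (hin F 1)
    exact ((m.continuous_avg hzc F).inner continuous_const).abs.mul
      ((m.continuous_jump (continuous_of_mem_Mh hu) F).inner (continuous_of_mem_Mh hw _))
  · refine .integral (fun x => .const_mul (.inner ((isLinOn_outer (m.isLinOn_eval _) F x).fun_sub
      (m.isLinOn_eval _ _ x)) (isLinOn_outer (m.isLinOn_eval _) F x)) _)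
      fun u hu w hw => (m.integrableOn_face F ?_).mono_set (hin F (-1))
    exact ((m.continuous_avg hzc F).inner continuous_const).abs.mul
      (((m.continuous_outer (continuous_of_mem_Mh hu) F).sub (continuous_of_mem_Mh hu _)).inner
        (m.continuous_outer (continuous_of_mem_Mh hw) F))

/-- The cells cover `closure O`, while `f` is controlled on `O`; the frontier of a convex set is
null. On a cell `f` is then integrable and the polynomial test function bounded. -/
lemma isLinOn_source (hO : IsConvexPolyhedralDomain O) {f : E d → E d}
    (hf : MemLp f 2 (volume.restrict O)) :
    IsLinOn (m.Mh r) fun w => m.innerVec (fun _ => f) w := by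
  refine .sum fun K => .integral (fun x => (m.isLinOn_eval _ K x).comp (innerₗ (E d) (f x)))
    fun w hw => ?_
  have hcl : closure O =ᵐ[volume] O := by
    refine (ae_eq_set).2 ⟨?_, by rw [sdiff_eq_empty.2 subset_closure]; simp⟩
    have := hO.convex.addHaar_frontier volume
    rwa [hO.isOpen.frontier_eq] at this
  have hf' : MemLp f 2 (volume.restrict (m.cell K)) := by
    rw [← Measure.restrict_congr_set hcl] at hf
    exact hf.mono_measure (Measure.restrict_mono (m.cover ▸ subset_iUnion m.cell K) le_rfl)
  have hfi : IntegrableOn f (m.cell K) := by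
    have : IsFiniteMeasure (volume.restrict (m.cell K)) :=
      isFiniteMeasure_restrict.2 (m.isCompact_cell K).measure_lt_top.ne
    exact hf'.integrable one_le_two
  obtain ⟨C, hC⟩ := (m.isCompact_cell K).exists_bound_of_continuousOn
    (continuous_of_mem_Mh hw K).continuousOn
  refine Integrable.mono' (hfi.norm.mul_const C)
    (hfi.aestronglyMeasurable.inner (continuous_of_mem_Mh hw K).aestronglyMeasurable)
    ((ae_restrict_iff' (m.isCompact_cell K).measurableSet).2 (ae_of_all _ fun x hx => ?_))
  exact (norm_inner_le_norm _ _).trans (mul_le_mul_of_nonneg_left (hC x hx) (norm_nonneg _))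

end Mesh

variable {d : ℕ} {O : Set (E d)}

/-! ### Solvability of one step -/

/-- The newest node has weight `β 0 = γ`, and all other nodes are data. The memory term thus adds `τ
γ` to the viscosity `μ` and moves the rest to the right-hand side. -/
lemma Params.quad_update (q : Params) (τ : ℝ) {n : ℕ} (hn : 1 ≤ n) (m : Mesh O) {r : ℕ}
    (hist : ℕ → m.Mh r) (u : m.Mh r) :
    (q.quad τ n m fun j => Function.update hist n u j) =
      ((τ • ∑ j ∈ Finset.Icc 1 (n - 1), q.β (n * τ - j * τ) • hist j : m.Mh r) : m.Vec) +
        (τ * q.γ) • (u : m.Vec) := by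
  obtain ⟨k, rfl⟩ : ∃ k, n = k + 1 := ⟨n - 1, by omega⟩
  unfold Params.quad
  rw [Finset.sum_Icc_succ_top (by omega), smul_add, Nat.add_sub_cancel]
  congr 1
  · rw [Submodule.coe_smul, Submodule.coe_sum]
    congr 1
    refine Finset.sum_congr rfl fun j hj => ?_
    have : j ≠ k + 1 := by have := (Finset.mem_Icc.1 hj).2; omega
    simp only [Function.update_of_ne this, Submodule.coe_smul]
  · simp [Params.β, smul_smul]

lemma omega_nonneg (ε : ℝ) : 0 ≤ omega ε := by
  unfold omega
  split_ifs <;> norm_num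

/-- Under the coercivity requirements, every step is uniquely solvable. -/
theorem uniquelySolvable_of_coercive (hd : 2 ≤ d) (hO : IsConvexPolyhedralDomain O) (m : Mesh O)
    {r₁ r₂ : ℕ} (q : Params) {ε : ℝ} (hvel : m.CoerciveVel r₁ ε q.σ)
    (hsip : m.CoerciveSip r₂ q.σ') {τ : ℝ} (hτ : 0 < τ) {n : ℕ} (hn : 1 ≤ n) :
    UniquelySolvable m r₁ r₂ q ε τ n := by
  intro f hf hist u0 p0
  set qh : m.Mh r₁ := τ • ∑ j ∈ Finset.Icc 1 (n - 1), q.β (n * τ - j * τ) • hist j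
  have hquad : ∀ u : m.Mh r₁, (q.quad τ n m fun j => Function.update hist n u j) =
      (qh : m.Vec) + (τ * q.γ) • (u : m.Vec) := fun u => q.quad_update τ hn m hist u
  have hAeps := m.isBilinOn_Aeps (r := r₁) (r' := r₁) ε q.σ
  have hb := m.isBilinOn_b (r := r₁) (r' := r₂)
  have hμ := q.μ_pos
  have hγ := q.γ_pos
  -- the intermediate velocity
  have hB₁ := ((m.isBilinOn_innerVec (r := r₁) (r' := r₁)).fun_add
    ((m.isBilinOn_Ac (r := r₁) (r' := r₁) (θ := u0) u0.2).const_mul τ)).fun_add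
    (hAeps.const_mul (τ * (q.μ + τ * q.γ)))
  -- All three contributions are nonnegative on the diagonal, so the mass term must vanish.
  -- Convection is tested with `θ = z = u0`, the case in which upwinding gives the sign.
  have hB₁pos : ∀ v : m.Mh r₁, hB₁.toBilin v v = 0 → v = 0 := by
    intro v hv
    have hv' : m.innerVec v v + τ * m.Ac u0 u0 v v +
      τ * (q.μ + τ * q.γ) * m.Aeps ε q.σ v v = 0 := hv
    have h1 := m.Ac_self_nonneg hd u0.2 v.2
    have h2 : 0 ≤ m.Aeps ε q.σ v v := (mul_nonneg (omega_nonneg ε)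
      (m.normSqVec_nonneg hd q.σ_pos v)).trans (hvel v v.2)
    refine Subtype.ext (Mesh.eq_zero_of_innerVec_self v.2 ?_)
    have h3 : 0 ≤ τ * m.Ac u0 u0 v v := mul_nonneg hτ.le h1
    have h4 : 0 ≤ τ * (q.μ + τ * q.γ) * m.Aeps ε q.σ v v := mul_nonneg (by positivity) h2
    linarith
  have hl₁ : IsLinOn (m.Mh r₁) fun w => m.innerVec u0 w + τ * m.b w p0 +
      τ * m.innerVec (fun _ => f) w - τ * m.Aeps ε q.σ qh w :=
    ((((m.isBilinOn_innerVec (r := r₁)).right u0 u0.2).fun_add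
      ((hb.left p0 p0.2.1).const_mul τ)).fun_add ((m.isLinOn_source hO hf).const_mul τ)).fun_sub
      ((hAeps.right qh qh.2).const_mul τ)
  obtain ⟨ut, hut, hut'⟩ := existsUnique_riesz hB₁.toBilin hB₁pos hl₁.toLinearMap
  have hvelocity : ∀ u : m.Mh r₁, (∀ w ∈ m.Mh r₁,
      m.innerVec u w + τ * m.Ac u0 u0 u w + τ * q.μ * m.Aeps ε q.σ u w
        + τ * m.Aeps ε q.σ (q.quad τ n m fun j => Function.update hist n u j) w
      = m.innerVec u0 w + τ * m.b w p0 + τ * m.innerVec (fun _ => f) w) ↔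
      ∀ w, hB₁.toBilin u w = hl₁.toLinearMap w := by
    intro u
    rw [hquad]
    have key : ∀ w ∈ m.Mh r₁, m.Aeps ε q.σ ((qh : m.Vec) + (τ * q.γ) • (u : m.Vec)) w =
        m.Aeps ε q.σ qh w + (τ * q.γ) * m.Aeps ε q.σ u w := by
      intro w hw
      rw [(hAeps.left w hw).add _ qh.2 _ ((m.Mh r₁).smul_mem _ u.2),
        (hAeps.left w hw).smul _ _ u.2]
      rfl
    constructor
    · intro h w
      have h1 := h w w.2
      rw [key w w.2] at h1
      show m.innerVec u w + τ * m.Ac u0 u0 u w + τ * (q.μ + τ * q.γ) * m.Aeps ε q.σ u w =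
        m.innerVec u0 w + τ * m.b w p0 + τ * m.innerVec (fun _ => f) w - τ * m.Aeps ε q.σ qh w
      linarith
    · intro h w hw
      have h1 : m.innerVec u w + τ * m.Ac u0 u0 u w + τ * (q.μ + τ * q.γ) * m.Aeps ε q.σ u w =
        m.innerVec u0 w + τ * m.b w p0 + τ * m.innerVec (fun _ => f) w -
          τ * m.Aeps ε q.σ qh w := h ⟨w, hw⟩
      rw [key w hw]
      linarith
  -- the potential
  have hB₂ := (m.isBilinOn_Asip (r := r₂) (r' := r₂) q.σ').mono (m.Ph0Sub_le r₂) (m.Ph0Sub_le r₂)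
  have hB₂pos : ∀ g : m.Ph0Sub r₂, hB₂.toBilin g g = 0 → g = 0 := by
    intro g hg
    have hg' : m.Asip q.σ' g g = 0 := hg
    have := hsip g g.2.1
    exact Subtype.ext (Mesh.eq_zero_of_normSqScal hd hO q.σ'_pos g.2 (by linarith))
  have hl₂ : IsLinOn (m.Ph0Sub r₂) fun g => -(1 / τ) * m.b ut g :=
    ((hb.mono le_rfl (m.Ph0Sub_le r₂)).right ut ut.2).const_mul _
  obtain ⟨v, hv, hv'⟩ := existsUnique_riesz hB₂.toBilin hB₂pos hl₂.toLinearMap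
  -- the pressure
  have hB₃ := m.isBilinOn_innerScal (r := r₂) (r' := r₂)
  have hB₃pos : ∀ g : m.Ph r₂, hB₃.toBilin g g = 0 → g = 0 := fun g hg =>
    Subtype.ext (Mesh.eq_zero_of_innerScal_self g.2 (le_of_eq hg))
  set Q : m.Vec := q.quad τ n m fun j => Function.update hist n ut j with hQ
  have hQmem : Q ∈ m.Mh r₁ := by
    rw [hQ, hquad]
    exact (m.Mh r₁).add_mem qh.2 ((m.Mh r₁).smul_mem _ ut.2)
  have hl₃ : IsLinOn (m.Ph r₂) fun g => m.innerScal p0 g + m.innerScal v g -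
      q.δ * q.μ * m.b ut g - q.δ * m.b Q g :=
    (((hB₃.right p0 p0.2.1).fun_add (hB₃.right v v.2.1)).fun_sub
      ((hb.right ut ut.2).const_mul _)).fun_sub ((hb.right Q hQmem).const_mul _)
  obtain ⟨p, hp, hp'⟩ := existsUnique_riesz hB₃.toBilin hB₃pos hl₃.toLinearMap
  -- The pressure was found in `P_h`; testing its equation with the constant `1` shows that its mean
  -- is zero.
  have hone : (fun _ _ => 1 : m.Scal) ∈ m.Ph r₂ := fun K => ⟨1, by simp, fun x => by simp⟩
  have hpmean : (p : m.Scal) ∈ m.Ph0 r₂ := by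
    refine ⟨p.2, ?_⟩
    have h1 : m.innerScal p (fun _ _ => 1) = m.innerScal p0 (fun _ _ => 1) +
      m.innerScal v (fun _ _ => 1) - q.δ * q.μ * m.b ut (fun _ _ => 1) -
      q.δ * m.b Q (fun _ _ => 1) := hp ⟨_, hone⟩
    rw [m.b_const_one hd ut.2, m.b_const_one hd hQmem] at h1
    have h2 := p0.2.2
    have h3 := v.2.2
    simp only [Mesh.innerScal, mul_one] at h1
    rw [h1, h2, h3]
    simp
  -- the velocity
  have hB₄ := m.isBilinOn_innerVec (r := r₁) (r' := r₁)
  have hB₄pos : ∀ w : m.Mh r₁, hB₄.toBilin w w = 0 → w = 0 := fun w hw =>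
    Subtype.ext (Mesh.eq_zero_of_innerVec_self w.2 (le_of_eq hw))
  have hl₄ : IsLinOn (m.Mh r₁) fun w => m.innerVec ut w + τ * m.b w v :=
    (hB₄.right ut ut.2).fun_add ((hb.left v v.2.1).const_mul τ)
  obtain ⟨u, hu, hu'⟩ := existsUnique_riesz hB₄.toBilin hB₄pos hl₄.toLinearMap
  refine ⟨(ut, u, ⟨p, hpmean⟩), ⟨v, ?_⟩, ?_⟩
  · exact
      { velocity := (hvelocity ut).2 hut
        potential := fun g hg => hv ⟨g, hg⟩
        pressure := fun g hg => hp ⟨g, hg⟩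
        correction := fun w hw => hu ⟨w, hw⟩ }
  · rintro ⟨ut₁, u₁, p₁⟩ ⟨v₁, h⟩
    -- Each equation determines its unknown from those already identified, so uniqueness propagates
    -- from `ut` to `v`, and then to `p` and `u`.
    have e1 : ut₁ = ut := hut' ut₁ ((hvelocity ut₁).1 h.velocity)
    subst e1
    have e2 : v₁ = v := hv' v₁ fun g => h.potential g g.2
    subst e2
    have e3 : (⟨p₁, p₁.2.1⟩ : m.Ph r₂) = p := hp' _ fun g => h.pressure g g.2
    have e4 : u₁ = u := hu' u₁ fun w => h.correction w w.2
    subst e4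
    subst e3
    rfl

end DGOldroyd

end

/-! ### Assembly of coercivity and one-step solvability. -/

open DGOldroyd in
theorem lemma2 (d : ℕ) (hd : d = 2 ∨ d = 3) (r₁ r₂ : ℕ) (hr₁ : 1 ≤ r₁)
    (hr₂ : r₁ ≤ r₂ + 1) (hr₂' : r₂ ≤ r₁ + 1) (ρ : ℝ) (hρ : 0 < ρ) :
    -- the coercivity requirements hold for sufficiently large penalty parameters
    (∃ σ₀ > 0, ∀ (O : Set (E d)), IsConvexPolyhedralDomain O →
      ∀ m : Mesh O, m.ShapeRegular ρ →
        (∀ σ > 0, m.CoerciveVel r₁ 1 σ) ∧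
        (∀ ε, ε = -1 ∨ ε = 0 → ∀ σ ≥ σ₀, m.CoerciveVel r₁ ε σ) ∧
        (∀ σ' ≥ σ₀, m.CoerciveSip r₂ σ')) ∧
    -- under these requirements, every step of the scheme is uniquely solvable
    ∀ q : Params,
      (∀ (O : Set (E d)), IsConvexPolyhedralDomain O → ∀ m : Mesh O, m.ShapeRegular ρ →
        m.CoerciveVel r₁ (-1) q.σ → m.CoerciveSip r₂ q.σ' →
        ∀ τ > 0, ∀ n ≥ 1, UniquelySolvable m r₁ r₂ q (-1) τ n) ∧
      (∀ ε, ε = 0 ∨ ε = 1 → ∃ τ₀ > 0,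
        ∀ (O : Set (E d)), IsConvexPolyhedralDomain O → ∀ m : Mesh O, m.ShapeRegular ρ →
          m.CoerciveVel r₁ ε q.σ → m.CoerciveSip r₂ q.σ' →
          ∀ τ > 0, τ < τ₀ → ∀ n ≥ 1, UniquelySolvable m r₁ r₂ q ε τ n) := by
  have hd2 : 2 ≤ d := by omega
  -- The value `τ₀ = 1` is arbitrary: `uniquelySolvable_of_coercive` covers every positive time
  -- step.
  refine ⟨?_, fun q => ⟨fun O hO m _ hvel hsip τ hτ n hn =>
    uniquelySolvable_of_coercive hd2 hO m q hvel hsip hτ hn, fun ε _ => ⟨1, one_pos,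
      fun O hO m _ hvel hsip τ hτ _ n hn =>
        uniquelySolvable_of_coercive hd2 hO m q hvel hsip hτ hn⟩⟩⟩
  obtain ⟨σ₁, hσ₁, h₁⟩ := exists_coerciveVel hd2 r₁ hρ
  obtain ⟨σ₂, hσ₂, h₂⟩ := exists_coerciveSip hd2 r₂ hρ
  refine ⟨max σ₁ σ₂, lt_max_of_lt_left hσ₁, fun O _ m hm => ⟨fun σ _ w _ => ?_,
    fun ε hε σ hσ => h₁ O m hm ε hε σ ((le_max_left _ _).trans hσ),
    fun σ' hσ' => h₂ O m hm σ' ((le_max_right _ _).trans hσ')⟩⟩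
  -- For `ε = 1` the factor `1 - ε` removes the consistency term and `omega 1 = 1`, so both sides
  -- agree.
  rw [m.Aeps_self]
  simp [omega]
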